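/- Let $(M^n,g)$, $n\ge 2$, be a compact smooth Riemannian manifold with smooth (possibly empty) boundary $\partial M$, and write $\bar M=M\cup\partial M$. Identify covectors with vectors through $g$; let $\nabla$ be the Levi-Civita connection. For $x\in\bar M$, $z\in\mathbb R$, $p\in T_x\bar M$ let $A(x,z,p)$ be a symmetric bilinear form on $T_x\bar M$ and $\psi(x,z,p)>0$ a real number, both depending smoothly on $(x,z,p)$; write $A^{\xi\xi}=A(\cdot)(\xi,\xi)$ and $A[v]=A(x,v,\nabla v)$. For a bilinear form $U$ let $\lambda(U)=(\lambda_1,\dots,\lambda_n)$ be its eigenvalues with respect to $g$. Let $\Gamma\subset\mathbb R^n$, $\Gamma\neq\mathbb R^n$, be an open convex cone with vertex $0$, invariant under permutations of the coordinates and containing $\{\lambda:\lambda_i>0\ \forall i\}$, and let $f:\Gamma\to\mathbb R$ be a smooth symmetric concave function with $\partial f/\partial\lambda_i>0$ in $\Gamma$ for all $i$, with $\limsup_{\lambda\to\lambda_0}f(\lambda)\le 0$ for every $\lambda_0\in\partial\Gamma$, and with $\lim_{t\to\infty}f(t,\dots,t)=+\infty$. A function $v\in C^2(\bar M)$ is called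 admissible if $\lambda(\nabla^2v+A[v])\in\Gamma$ on $\bar M$. Assume that (i) for all $x,z$ and all $\xi\in T_x\bar M$, the functions $p\mapsto-\psi(x,z,p)$ and $p\mapsto A^{\xi\xi}(x,z,p)$ are concave; (ii) (MTW condition) there is $c_0>0$ such that $A^{\xi\xi}_{p_kp_l}(x,z,p)\,\eta_k\eta_l\le -c_0|\xi|^2|\eta|^2$ for all $x,z,p$ and all $\xi,\eta\in T_x\bar M$ with $\xi\perp\eta$; (iii) (growth) there are continuous positive functions $\bar\psi_1(x,z),\bar\psi_2(x,z)$ and constants $0<\gamma_1<4$ and $\gamma_2=2$ such that for all $x,z,p,\xi$ $$p\cdot\nabla_xA^{\xi\xi}(x,z,p)+|p|^2A^{\xi\xi}_z(x,z,p)\le\bar\psi_1(x,z)|\xi|^2(1+|p|^{\gamma_1}),$$ $$p\cdot\nabla_x\psi(x,z,p)+|p|^2\psi_z(x,z,p)\ge-\bar\psi_2(x,z)(1+|p|^{\gamma_2}),$$ where $\nabla_x$ is the partial covariant derivative in $x$ ($z$ is frozen, and $p$, $\xi$ are extended to vector fields whose covariant derivative vanishes at $x$). Then for all $K,L\in\mathbb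 R$ there is a constant $C_1>0$, depending only on $K$, $L$ and the data $(M,g)$, $\Gamma$, $f$, $A$, $\psi$, $\gamma_1$, such that the following holds. If there is an admissible function $\underline u\in C^2(\bar M)$ with $|\underline u|_{C^2(\bar M)}\le L$, and $u\in C^3(\bar M)$ is an admissible solution of $$f(\lambda(\nabla^2u+A(x,u,\nabla u)))=\psi(x,u,\nabla u)\quad\text{on }\bar M$$ with $|u|_{C^0(\bar M)}\le K$, then $$\max_{\bar M}|\nabla u|\le C_1\Big(1+\max_{\partial M}|\nabla u|\Big),$$ where the maximum over $\partial M$ is read as $0$ if $\partial M=\emptyset$. -/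

import Mathlib

open Set Filter Topology Bundle
open scoped Manifold ContDiff

noncomputable section

namespace HessianEq

/-! ### Tangent spaces, Riemannian metric, gradient -/

/-- The tangent space `T_x M` of an `n`-manifold with boundary. Its elements are written in the
coordinates of the preferred chart at `x`, so it is definitionally `EuclideanSpace ℝ (Fin n)`. -/
abbrev Tan (n : ℕ) [NeZero n] {M : Type*} [TopologicalSpace M]
    [ChartedSpace (EuclideanHalfSpace n) M] (x : M) : Type :=
  TangentSpace (𝓡∂ n) x

/-- Smooth Riemannian metrics on an `n`-manifold with boundary. -/
abbrev Metric (n : ℕ) [NeZero n] (M : Type*) [TopologicalSpace M]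
    [ChartedSpace (EuclideanHalfSpace n) M] [IsManifold (𝓡∂ n) ∞ M] : Type _ :=
  Bundle.ContMDiffRiemannianMetric (𝓡∂ n) ∞ (EuclideanSpace ℝ (Fin n))
    (fun x : M => TangentSpace (𝓡∂ n) x)

section Geometry

variable {n : ℕ} [NeZero n] {M : Type*} [TopologicalSpace M]
  [ChartedSpace (EuclideanHalfSpace n) M] [IsManifold (𝓡∂ n) ∞ M]

/-- The length `|v|` of a tangent vector. -/
def gnorm (g : Metric n M) (x : M) (v : Tan n x) : ℝ := Real.sqrt (g.inner x v v)

instance instFiniteDimensionalTan (x : M) : FiniteDimensional ℝ (Tan n x) :=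
  inferInstanceAs (FiniteDimensional ℝ (EuclideanSpace ℝ (Fin n)))

/-- The map `v ↦ g(v, ·)` from `T_x M` to its dual. -/
def flat (g : Metric n M) (x : M) : Tan n x →ₗ[ℝ] Module.Dual ℝ (Tan n x) where
  toFun v := (g.inner x v).toLinearMap
  map_add' v w := by ext; simp
  map_smul' c v := by ext; simp

theorem flat_injective (g : Metric n M) (x : M) : Function.Injective (flat g x) := by
  rw [← LinearMap.ker_eq_bot, LinearMap.ker_eq_bot']
  intro v hv
  by_contra hne
  have h1 := g.pos x v hne
  have h2 : flat g x v v = 0 := by rw [hv]; rfl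
  exact absurd h2 h1.ne'

/-- The musical isomorphism from `T_x M` to its dual; its inverse raises an index. -/
def flatEquiv (g : Metric n M) (x : M) : Tan n x ≃ₗ[ℝ] Module.Dual ℝ (Tan n x) :=
  (flat g x).linearEquivOfInjective (flat_injective g x) Subspace.dual_finrank_eq.symm

/-- The differential `du` at `x`. -/
def diff (n : ℕ) [NeZero n] {M : Type*} [TopologicalSpace M]
    [ChartedSpace (EuclideanHalfSpace n) M] (u : M → ℝ) (x : M) : Module.Dual ℝ (Tan n x) :=
  (mfderiv (𝓡∂ n) 𝓘(ℝ, ℝ) u x).toLinearMap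

/-- The gradient `∇u (x)`, i.e. the vector with `g(∇u, w) = du(w)` for all `w`. -/
def grad (g : Metric n M) (u : M → ℝ) (x : M) : Tan n x :=
  (flatEquiv g x).symm (diff n u x)

theorem inner_grad (g : Metric n M) (u : M → ℝ) (x : M) (w : Tan n x) :
    g.inner x (grad g u x) w = diff n u x w :=
  LinearMap.congr_fun ((flatEquiv g x).apply_symm_apply (diff n u x)) w

/-! ### Levi-Civita connection and Hessian, in the preferred chart at the point considered -/

/-- The coordinate vector field with constant components `v` in the chart at `x`, as a map from
components to tangent vectors at the point with coordinates `y`. -/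
def coordVec (n : ℕ) [NeZero n] {M : Type*} [TopologicalSpace M]
    [ChartedSpace (EuclideanHalfSpace n) M] (x : M) (y : EuclideanSpace ℝ (Fin n)) :
    EuclideanSpace ℝ (Fin n) →L[ℝ] Tan n ((extChartAt (𝓡∂ n) x).symm y) :=
  mfderivWithin 𝓘(ℝ, EuclideanSpace ℝ (Fin n)) (𝓡∂ n) (extChartAt (𝓡∂ n) x).symm
    (range (𝓡∂ n)) y

/-- Pull-back of a bilinear form on a tangent space along `coordVec`. -/
def pullForm (n : ℕ) [NeZero n] {M : Type*} [TopologicalSpace M]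
    [ChartedSpace (EuclideanHalfSpace n) M] (x : M) (y : EuclideanSpace ℝ (Fin n))
    (B : Tan n ((extChartAt (𝓡∂ n) x).symm y) →L[ℝ]
      Tan n ((extChartAt (𝓡∂ n) x).symm y) →L[ℝ] ℝ) :
    EuclideanSpace ℝ (Fin n) →L[ℝ] EuclideanSpace ℝ (Fin n) →L[ℝ] ℝ :=
  ContinuousLinearMap.bilinearComp
    (E := EuclideanSpace ℝ (Fin n)) (F := EuclideanSpace ℝ (Fin n))
    B (coordVec n x y) (coordVec n x y)

/-- The matrix `g_{ij}(y)` of the metric in the chart at `x`, as a bilinear form. -/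
def gLoc (g : Metric n M) (x : M) (y : EuclideanSpace ℝ (Fin n)) :
    EuclideanSpace ℝ (Fin n) →L[ℝ] EuclideanSpace ℝ (Fin n) →L[ℝ] ℝ :=
  pullForm n x y (g.inner ((extChartAt (𝓡∂ n) x).symm y))

set_option synthInstance.maxHeartbeats 200000 in
/-- First derivatives at `x` of the metric coefficients in the chart at `x`:
`dgLoc g x v w z = v^k w^i z^j ∂_k g_{ij}`. -/
def dgLoc (g : Metric n M) (x : M) :
    EuclideanSpace ℝ (Fin n) →L[ℝ] EuclideanSpace ℝ (Fin n) →L[ℝ]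
      EuclideanSpace ℝ (Fin n) →L[ℝ] ℝ :=
  fderivWithin ℝ (gLoc g x) (range (𝓡∂ n)) (extChartAt (𝓡∂ n) x x)

set_option synthInstance.maxHeartbeats 200000 in
/-- The Christoffel symbols at `x` in the chart at `x`, `christoffel g x v w = Γ_{ij}^k v^i w^j`:
the vector determined by
`g(Γ(v,w), z) = (v^i w^j z^l / 2) (∂_i g_{jl} + ∂_j g_{il} - ∂_l g_{ij})`. -/
def christoffel (g : Metric n M) (x : M) (v w : Tan n x) : Tan n x :=
  (flatEquiv g x).symm
    ((1 / 2 : ℝ) • (dgLoc g x v w + dgLoc g x w v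
      - ((dgLoc g x).flip v).flip w).toLinearMap)

/-- The Hessian `∇²u (v, w) = v^i w^j (∂_i ∂_j u - Γ_{ij}^k ∂_k u)` at `x`. -/
def hess (g : Metric n M) (u : M → ℝ) (x : M) (v w : Tan n x) : ℝ :=
  fderivWithin ℝ
      (fun y => fderivWithin ℝ (u ∘ (extChartAt (𝓡∂ n) x).symm) (range (𝓡∂ n)) y)
      (range (𝓡∂ n)) (extChartAt (𝓡∂ n) x x) v w
    - diff n u x (christoffel g x v w)

/-! ### Functions and bilinear forms depending on `(x, z, p)` with `p ∈ T_x M` -/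

/-- Real functions `ψ(x, z, p)`. -/
abbrev GradFun (n : ℕ) [NeZero n] (M : Type*) [TopologicalSpace M]
    [ChartedSpace (EuclideanHalfSpace n) M] : Type _ :=
  (x : M) → ℝ → Tan n x → ℝ

/-- Bilinear forms `A(x, z, p)` on `T_x M`. -/
abbrev GradForm (n : ℕ) [NeZero n] (M : Type*) [TopologicalSpace M]
    [ChartedSpace (EuclideanHalfSpace n) M] : Type _ :=
  (x : M) → ℝ → Tan n x → (Tan n x →L[ℝ] Tan n x →L[ℝ] ℝ)

/-- `ψ` is a smooth function on `TM × ℝ`. -/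
def SmoothFun (ψ : GradFun n M) : Prop :=
  ContMDiff ((𝓡∂ n).tangent.prod 𝓘(ℝ, ℝ)) 𝓘(ℝ, ℝ) ∞
    (fun q : TangentBundle (𝓡∂ n) M × ℝ => ψ q.1.proj q.2 q.1.snd)

/-- `A` is a smooth map from `TM × ℝ` to the bundle of bilinear forms on `TM`. -/
def SmoothForm (A : GradForm n M) : Prop :=
  ContMDiff ((𝓡∂ n).tangent.prod 𝓘(ℝ, ℝ))
    ((𝓡∂ n).prod 𝓘(ℝ, EuclideanSpace ℝ (Fin n) →L[ℝ] EuclideanSpace ℝ (Fin n) →L[ℝ] ℝ)) ∞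
    (fun q : TangentBundle (𝓡∂ n) M × ℝ =>
      TotalSpace.mk' (EuclideanSpace ℝ (Fin n) →L[ℝ] EuclideanSpace ℝ (Fin n) →L[ℝ] ℝ)
        (E := fun x : M => Tan n x →L[ℝ] Tan n x →L[ℝ] ℝ)
        q.1.proj (A q.1.proj q.2 q.1.snd))

/-- Components, in the chart at `x`, of a vector field which equals `p` at `x` and whose covariant
derivative vanishes at `x`. -/
def parallelExt (g : Metric n M) (x : M) (p : Tan n x) (y : EuclideanSpace ℝ (Fin n)) :
    EuclideanSpace ℝ (Fin n) :=
  (show EuclideanSpace ℝ (Fin n) from p)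
    - (show EuclideanSpace ℝ (Fin n) from christoffel g x (y - extChartAt (𝓡∂ n) x x) p)

/-- The partial covariant derivative `X · ∇_x ψ (x, z, p)`: `z` is frozen and `p` is extended to a
vector field that is parallel at `x`. -/
def covDerivFun (g : Metric n M) (ψ : GradFun n M) (x : M) (z : ℝ) (p X : Tan n x) : ℝ :=
  fderivWithin ℝ
    (fun y => ψ ((extChartAt (𝓡∂ n) x).symm y) z (coordVec n x y (parallelExt g x p y)))
    (range (𝓡∂ n)) (extChartAt (𝓡∂ n) x x) X

/-- The partial covariant derivative `X · ∇_x A^{ξξ} (x, z, p)`: `z` is frozen and `p`, `ξ` are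
extended to vector fields that are parallel at `x`. -/
def covDerivForm (g : Metric n M) (A : GradForm n M) (x : M) (z : ℝ) (p ξ X : Tan n x) : ℝ :=
  fderivWithin ℝ
    (fun y => A ((extChartAt (𝓡∂ n) x).symm y) z (coordVec n x y (parallelExt g x p y))
      (coordVec n x y (parallelExt g x ξ y)) (coordVec n x y (parallelExt g x ξ y)))
    (range (𝓡∂ n)) (extChartAt (𝓡∂ n) x x) X

/-! ### The equation -/

/-- `lam` lists (in some order, with multiplicity) the eigenvalues of the symmetric bilinear form
`B` on `T_x M` with respect to the metric: `B` is diagonal with diagonal entries `lam` in some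
`g`-orthonormal basis. -/
def IsEigenvalues (g : Metric n M) (x : M) (B : Tan n x → Tan n x → ℝ) (lam : Fin n → ℝ) : Prop :=
  ∃ e : Fin n → Tan n x,
    (∀ i j, g.inner x (e i) (e j) = if i = j then 1 else 0) ∧
    (∀ i j, B (e i) (e j) = if i = j then lam i else 0)

/-- The tensor `∇²u + A(x, u, ∇u)` at `x`. -/
def hessA (g : Metric n M) (A : GradForm n M) (u : M → ℝ) (x : M) (v w : Tan n x) : ℝ :=
  hess g u x v w + A x (u x) (grad g u x) v w

/-- `u` is admissible: `u` is `C²` up to the boundary and `λ(∇²u + A[u]) ∈ Γ` everywhere.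
(`Γ` will be invariant under permutations, so the order of the eigenvalues is irrelevant.) -/
def Admissible (g : Metric n M) (Γ : Set (Fin n → ℝ)) (A : GradForm n M) (u : M → ℝ) : Prop :=
  ContMDiff (𝓡∂ n) 𝓘(ℝ, ℝ) 2 u ∧
    ∀ x, ∃ lam ∈ Γ, IsEigenvalues g x (hessA g A u x) lam

/-- `u` is an admissible solution of `f(λ(∇²u + A[u])) = ψ(x, u, ∇u)`. -/
def AdmissibleSolution (g : Metric n M) (Γ : Set (Fin n → ℝ)) (f : (Fin n → ℝ) → ℝ)
    (A : GradForm n M) (ψ : GradFun n M) (u : M → ℝ) : Prop :=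
  Admissible g Γ A u ∧
    ∀ x, ∃ lam ∈ Γ, IsEigenvalues g x (hessA g A u x) lam ∧ f lam = ψ x (u x) (grad g u x)

/-- `|v|_{C²(M)} ≤ L`, the norm being the maximum of the sup norms of `v`, `∇v` and `∇²v`. -/
def C2Bound (g : Metric n M) (v : M → ℝ) (L : ℝ) : Prop :=
  ∀ x, |v x| ≤ L ∧ gnorm g x (grad g v x) ≤ L ∧
    ∀ ξ η : Tan n x, |hess g v x ξ η| ≤ L * gnorm g x ξ * gnorm g x η

/-! ### Conditions on `A` and `ψ` -/

/-- `A^{ξξ}(x,z,p)` and `-ψ(x,z,p)` are concave in `p`. -/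
def ConcaveInGradient (A : GradForm n M) (ψ : GradFun n M) : Prop :=
  ∀ (x : M) (z : ℝ),
    ConcaveOn ℝ univ (fun p : Tan n x => -ψ x z p) ∧
    ∀ ξ : Tan n x, ConcaveOn ℝ univ (fun p : Tan n x => A x z p ξ ξ)

/-- The Ma–Trudinger–Wang condition: there is `c₀ > 0` such that
`A^{ξξ}_{p_k p_l}(x,z,p) η_k η_l ≤ -c₀ |ξ|² |η|²` whenever `ξ ⊥ η`. -/
def MTW (g : Metric n M) (A : GradForm n M) : Prop :=
  ∃ c₀ : ℝ, 0 < c₀ ∧ ∀ (x : M) (z : ℝ) (p ξ η : Tan n x), g.inner x ξ η = 0 →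
    iteratedDeriv 2 (fun t : ℝ => A x z (p + t • η) ξ ξ) 0
      ≤ -c₀ * gnorm g x ξ ^ 2 * gnorm g x η ^ 2

/-- The growth conditions with exponents `γ₁`, `γ₂`, with positive continuous coefficients
`b₁(x,z)`, `b₂(x,z)`:
`p·∇_x A^{ξξ} + |p|² A^{ξξ}_z ≤ b₁ |ξ|² (1 + |p|^γ₁)`, `p·∇_x ψ + |p|² ψ_z ≥ -b₂ (1 + |p|^γ₂)`. -/
def Growth (g : Metric n M) (A : GradForm n M) (ψ : GradFun n M) (γ₁ γ₂ : ℝ) : Prop :=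
  ∃ b₁ b₂ : M → ℝ → ℝ,
    Continuous (Function.uncurry b₁) ∧ Continuous (Function.uncurry b₂) ∧
    (∀ x z, 0 < b₁ x z) ∧ (∀ x z, 0 < b₂ x z) ∧
    (∀ (x : M) (z : ℝ) (p ξ : Tan n x),
      covDerivForm g A x z p ξ p + gnorm g x p ^ 2 * deriv (fun s => A x s p ξ ξ) z
        ≤ b₁ x z * gnorm g x ξ ^ 2 * (1 + gnorm g x p ^ γ₁)) ∧
    (∀ (x : M) (z : ℝ) (p : Tan n x),
      -(b₂ x z * (1 + gnorm g x p ^ γ₂))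
        ≤ covDerivFun g ψ x z p p + gnorm g x p ^ 2 * deriv (fun s => ψ x s p) z)

end Geometry

/-! ### Conditions on `f` -/

/-- The structure conditions on the cone `Γ` and on `f`. -/
structure StructureConditions {n : ℕ} (Γ : Set (Fin n → ℝ)) (f : (Fin n → ℝ) → ℝ) : Prop where
  isOpen : IsOpen Γ
  convex : Convex ℝ Γ
  cone : ∀ lam ∈ Γ, ∀ t : ℝ, 0 < t → t • lam ∈ Γ
  symm : ∀ lam ∈ Γ, ∀ σ : Equiv.Perm (Fin n), lam ∘ σ ∈ Γ
  positive_subset : {lam : Fin n → ℝ | ∀ i, 0 < lam i} ⊆ Γ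
  ne_univ : Γ ≠ univ
  f_smooth : ContDiffOn ℝ ∞ f Γ
  f_symm : ∀ lam ∈ Γ, ∀ σ : Equiv.Perm (Fin n), f (lam ∘ σ) = f lam
  f_pos : ∀ lam ∈ Γ, ∀ i, 0 < fderiv ℝ f lam (Pi.single i 1)
  f_concave : ConcaveOn ℝ Γ f
  f_boundary : (⨆ lam₀ ∈ frontier Γ, limsup (fun lam => (f lam : EReal)) (𝓝[Γ] lam₀)) ≤ 0

end HessianEq

end

/-! The proof is a maximum principle for `|∇u|² / (2 (K + 1 + u))`, with `K ≥ 0` bounding `|u|`. Let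
`m` be its maximum, attained at `x₀`. As `1 ≤ K + 1 + u ≤ 2K + 1`, the gradient at `x₀` controls the
gradient everywhere, and a boundary point `x₀` needs no further argument. At an interior `x₀` the
function `|∇u|² / 2 - m u` has a local maximum. Write `p = ∇u(x₀)`, `P = |p|`, `H = ∇²u(x₀)`, `f_i =
∂f/∂λ_i`, `F = ∑ f_i`, and let `e_i` diagonalise `H + A`. The first order condition is `H(p, ·) = m
⟨p, ·⟩`, with `m` comparable to `P²`. The second order condition, `bochner` and the equation
differentiated along `p` (`StructureConditions.sum_pder_mul_covDeriv`) eliminate the third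
derivatives of `u`; with the growth conditions this gives, for `P ≥ 1`, `∑ f_i |H e_i|² + m (∑ f_i
(-H_ii - A_p·p) + ψ_p·p) ≤ C (P^γ F + P²)`, where `γ = max γ₁ 2 < 4`.

Concavity in `p` replaces `A_p·p` by `A(p) - A(0) - E_i` with a defect `E_i ≥ 0`, so that `-λ_i +
E_i` appears. Concavity of `f`, tested at `(t₀, …, t₀)` with `f(t₀, …, t₀)` large, absorbs the terms
without `F`. What remains (`scalar_consequences`) are bounds by `C P^γ F` for `∑ f_i |H e_i|²`, `P²
∑ f_i E_i` and `-P² ∑ f_i λ_i`.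

The smallest eigenvalue `λ_k` has `f_k ≥ F / n` (`StructureConditions.exists_min_index`), so `|H
e_k|²` and `P² E_k` are `O(P^γ)`. Since `H p = m p`, the first bound makes `e_k` almost orthogonal
to `p`; the MTW condition then makes `E_k` at least of order `P²`, up to controlled errors. Hence
`P⁴ ≤ C P^γ` (`exists_quartic_bound`), which bounds `P`.

Two points need care. The map `U ↦ f(λ(U))` is never differentiated: it is touched from above by a
linear expression in an orthonormal frame. And the geometric quantities at `x` are defined in the
preferred chart at `x`, which need not depend continuously on `x`; the calculus is done in a fixed
chart after invariance has been proved, and compactness makes the constants uniform. -/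

namespace HessianEq

/-! ### Concave symmetric functions of the eigenvalues -/

/-- A concave function lies below its tangents. -/
theorem concaveOn_le_add_of_hasFDerivAt {E : Type*} [NormedAddCommGroup E] [NormedSpace ℝ E]
    {s : Set E} {f : E → ℝ} (hf : ConcaveOn ℝ s f) {a b : E} (ha : a ∈ s) (hb : b ∈ s)
    {f' : E →L[ℝ] ℝ} (h : HasFDerivAt f f' a) : f b ≤ f a + f' (b - a) := by
  have hl : HasDerivAt (fun t : ℝ => f (a + t • (b - a))) (f' (b - a)) 0 := by
    have h1 : HasDerivAt (fun t : ℝ => a + t • (b - a)) (b - a) 0 := by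
      simpa using ((hasDerivAt_id (0 : ℝ)).smul_const (b - a)).const_add a
    have h2 : HasFDerivAt f f' (a + (0 : ℝ) • (b - a)) := by simpa using h
    exact h2.comp_hasDerivAt (0 : ℝ) h1
  have hs := hl.tendsto_slope_zero_right
  -- On the segment from `a` to `b` the difference quotients at `a` of a concave function dominate
  -- the slope of the chord; then `t → 0⁺`.
  have : ∀ᶠ t : ℝ in 𝓝[>] 0, f b - f a ≤
      t⁻¹ • (f (a + (0 + t) • (b - a)) - f (a + (0 : ℝ) • (b - a))) := by
    filter_upwards [Ioo_mem_nhdsGT (zero_lt_one : (0 : ℝ) < 1)] with t ht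
    have h1 := hf.2 ha hb (by linarith [ht.2] : 0 ≤ 1 - t) ht.1.le (by ring)
    have h2 : (1 - t) • a + t • b = a + t • (b - a) := by module
    rw [h2] at h1
    simp only [smul_eq_mul] at h1 ⊢
    rw [zero_add, zero_smul, add_zero, ← sub_nonneg]
    have h3 : t⁻¹ * (f (a + t • (b - a)) - f a) - (f b - f a)
        = t⁻¹ * (f (a + t • (b - a)) - ((1 - t) * f a + t * f b)) := by
      field_simp [ht.1.ne']; ring
    rw [h3]
    exact mul_nonneg (inv_nonneg.2 ht.1.le) (by linarith)
  have := ge_of_tendsto hs this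
  linarith

section Structure

variable {n : ℕ} {Γ : Set (Fin n → ℝ)} {f : (Fin n → ℝ) → ℝ}

/-- The partial derivative `∂f/∂λ_i`. -/
noncomputable def pder (f : (Fin n → ℝ) → ℝ) (lam : Fin n → ℝ) (i : Fin n) : ℝ :=
  fderiv ℝ f lam (Pi.single i 1)

theorem fderiv_apply_eq_sum_pder (f : (Fin n → ℝ) → ℝ) (lam w : Fin n → ℝ) :
    fderiv ℝ f lam w = ∑ i, pder f lam i * w i := by
  conv_lhs => rw [← Finset.univ_sum_single w]
  rw [map_sum]
  refine Finset.sum_congr rfl fun i _ => ?_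
  have : Pi.single i (w i) = w i • (Pi.single i (1 : ℝ) : Fin n → ℝ) := by
    rw [← Pi.single_smul]; simp
  rw [this, map_smul, smul_eq_mul, mul_comm]; rfl

theorem StructureConditions.hasFDerivAt (hf : StructureConditions Γ f) {lam : Fin n → ℝ}
    (h : lam ∈ Γ) : HasFDerivAt f (fderiv ℝ f lam) lam :=
  ((hf.f_smooth.contDiffAt (hf.isOpen.mem_nhds h)).differentiableAt (by simp)).hasFDerivAt

theorem StructureConditions.le_add_sum (hf : StructureConditions Γ f) {lam mu : Fin n → ℝ}
    (h : lam ∈ Γ) (h' : mu ∈ Γ) : f mu ≤ f lam + ∑ i, pder f lam i * (mu i - lam i) := by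
  have := concaveOn_le_add_of_hasFDerivAt hf.f_concave h h' (hf.hasFDerivAt h)
  rwa [fderiv_apply_eq_sum_pder] at this

theorem StructureConditions.pder_pos (hf : StructureConditions Γ f) {lam : Fin n → ℝ}
    (h : lam ∈ Γ) (i : Fin n) : 0 < pder f lam i := hf.f_pos lam h i

/-- Birkhoff's theorem: `S` is a convex combination of permutation matrices, so `S mu` is an average
of rearrangements of `mu`. All of these lie in `Γ` and have the same value of `f`, and Jensen's
inequality applies. -/
theorem StructureConditions.mulVec_mem (hf : StructureConditions Γ f) {mu : Fin n → ℝ}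
    (h : mu ∈ Γ) {S : Matrix (Fin n) (Fin n) ℝ} (hS : S ∈ doublyStochastic ℝ (Fin n)) :
    S.mulVec mu ∈ Γ ∧ f mu ≤ f (S.mulVec mu) := by
  obtain ⟨w, hw0, hw1, hS'⟩ := exists_eq_sum_perm_of_mem_doublyStochastic hS
  have hv : S.mulVec mu = ∑ σ, w σ • (mu ∘ σ) := by
    rw [← hS', Matrix.sum_mulVec]
    refine Finset.sum_congr rfl fun σ _ => ?_
    rw [Matrix.smul_mulVec, Matrix.permMatrix_mulVec]
  rw [hv]
  refine ⟨hf.convex.sum_mem (fun σ _ => hw0 σ) hw1 (fun σ _ => hf.symm mu h σ), ?_⟩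
  have := hf.f_concave.le_map_sum (t := Finset.univ) (w := w) (p := fun σ => mu ∘ σ)
    (fun σ _ => hw0 σ) hw1 (fun σ _ => hf.symm mu h σ)
  refine le_trans (le_of_eq ?_) this
  have h2 : ∀ σ ∈ (Finset.univ : Finset (Equiv.Perm (Fin n))), w σ • f (mu ∘ σ) = w σ * f mu :=
    fun σ _ => by rw [hf.f_symm mu h σ, smul_eq_mul]
  rw [Finset.sum_congr rfl h2, ← Finset.sum_mul, hw1, one_mul]

/-- The smallest eigenvalue carries at least the average of the weights `∂f/∂λ_i`. -/
theorem StructureConditions.exists_min_index [NeZero n] (hf : StructureConditions Γ f)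
    {lam : Fin n → ℝ} (h : lam ∈ Γ) :
    ∃ k, (∀ i, lam k ≤ lam i) ∧ ∑ i, pder f lam i ≤ n * pder f lam k := by
  obtain ⟨k₀, -, hk₀⟩ := Finset.exists_min_image Finset.univ lam Finset.univ_nonempty
  -- Ties for the smallest eigenvalue are broken in favour of the largest derivative, so equal
  -- eigenvalues need no comparison of their derivatives.
  obtain ⟨k, hk, hkm⟩ := Finset.exists_max_image
    (Finset.univ.filter fun i => lam i = lam k₀) (pder f lam) ⟨k₀, by simp⟩
  have hkk : lam k = lam k₀ := by simpa using hk
  have hmin : ∀ i, lam k ≤ lam i := fun i => hkk ▸ hk₀ i (Finset.mem_univ i)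
  refine ⟨k, hmin, ?_⟩
  have hle : ∀ i, pder f lam i ≤ pder f lam k := by
    intro i
    by_cases hi : lam i = lam k₀
    · exact hkm i (by simp [hi])
    have hlt : lam k < lam i := lt_of_le_of_ne (hmin i) (fun h => hi (h ▸ hkk))
    have hik : i ≠ k := fun h => by simp [h] at hlt
    -- A transposition does not change `f`, so the tangent inequality reduces to `0 ≤ (f_i -
    -- f_k)(λ_k - λ_i)`.
    have h1 := hf.le_add_sum h (hf.symm lam h (Equiv.swap i k))
    rw [hf.f_symm lam h] at h1
    have h2 : ∑ j, pder f lam j * ((lam ∘ Equiv.swap i k) j - lam j)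
        = (pder f lam i - pder f lam k) * (lam k - lam i) := by
      rw [Finset.sum_eq_add i k hik]
      · simp; ring
      · intro c _ hc
        simp [Equiv.swap_apply_of_ne_of_ne hc.1 hc.2]
      · simp
      · simp
    rw [h2] at h1
    by_contra hcon
    push Not at hcon
    nlinarith
  calc ∑ i, pder f lam i ≤ ∑ _i : Fin n, pder f lam k := Finset.sum_le_sum fun i _ => hle i
    _ = n * pder f lam k := by simp

end Structure

end HessianEq

namespace HessianEq

set_option maxSynthPendingDepth 3

/-! ### Orthonormal frames of a bilinear form -/

section Frame

variable {n : ℕ} {V : Type*} [NormedAddCommGroup V] [NormedSpace ℝ V] [FiniteDimensional ℝ V]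

/-- `e` is an orthonormal frame for `G`. -/
def IsFrame (G : V →L[ℝ] V →L[ℝ] ℝ) (e : Fin n → V) : Prop :=
  ∀ i j, G (e i) (e j) = if i = j then 1 else 0

variable {G : V →L[ℝ] V →L[ℝ] ℝ} {e : Fin n → V}

theorem IsFrame.eq_sum (he : IsFrame G e) (hd : Module.finrank ℝ V = n) (v : V) :
    v = ∑ i, G v (e i) • e i := by
  have key : ∀ (c : Fin n → ℝ) (j), G (∑ i, c i • e i) (e j) = c j := by
    intro c j
    simp [map_sum, he _ j]
  have hli : LinearIndependent ℝ e := by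
    rw [Fintype.linearIndependent_iff]
    intro c hc j
    have := key c j
    rw [hc] at this
    simpa using this.symm
  have hspan : v ∈ Submodule.span ℝ (range e) := by
    rw [hli.span_eq_top_of_card_eq_finrank' (by simp [hd])]; trivial
  obtain ⟨c, rfl⟩ := (Submodule.mem_span_range_iff_exists_fun ℝ).1 hspan
  exact Finset.sum_congr rfl fun i _ => by rw [key c i]

theorem IsFrame.apply_eq_sum (he : IsFrame G e) (hd : Module.finrank ℝ V = n)
    (B : V →L[ℝ] V →L[ℝ] ℝ) (v w : V) : B v w = ∑ i, G w (e i) * B v (e i) := by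
  conv_lhs => rw [he.eq_sum hd w]
  simp [map_sum]

theorem IsFrame.parseval (he : IsFrame G e) (hd : Module.finrank ℝ V = n)
    (v w : V) : G v w = ∑ i, G v (e i) * G w (e i) := by
  rw [he.apply_eq_sum hd G v w]
  exact Finset.sum_congr rfl fun i _ => mul_comm _ _

theorem IsFrame.diag_apply (he : IsFrame G e) (hd : Module.finrank ℝ V = n)
    {B : V →L[ℝ] V →L[ℝ] ℝ} {lam : Fin n → ℝ}
    (hB : ∀ i j, B (e i) (e j) = if i = j then lam i else 0) (v : V) :
    B v v = ∑ i, lam i * G v (e i) ^ 2 := by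
  rw [he.apply_eq_sum hd B v v]
  refine Finset.sum_congr rfl fun i _ => ?_
  have : B v (e i) = G v (e i) * lam i := by
    conv_lhs => rw [he.eq_sum hd v]
    simp [map_sum, hB _ i]
  rw [this]; ring

/-- The squared coefficients of one orthonormal frame in another form a doubly stochastic
matrix. -/
theorem IsFrame.doublyStochastic (he : IsFrame G e) (hG : ∀ v w, G v w = G w v)
    (hd : Module.finrank ℝ V = n) {e' : Fin n → V} (he' : IsFrame G e') :
    (Matrix.of fun i k => G (e i) (e' k) ^ 2) ∈ doublyStochastic ℝ (Fin n) := by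
  rw [mem_doublyStochastic_iff_sum]
  refine ⟨fun i j => by simpa using sq_nonneg _, fun i => ?_, fun j => ?_⟩
  · have := he'.parseval hd (e i) (e i)
    rw [he i i] at this
    simpa [sq] using this.symm
  · have := he.parseval hd (e' j) (e' j)
    rw [he' j j] at this
    simp only [if_true] at this
    rw [this]
    exact Finset.sum_congr rfl fun i _ => by simp [hG (e i) (e' j), sq]

variable {Γ : Set (Fin n → ℝ)} {f : (Fin n → ℝ) → ℝ}

/-- Concavity of `f ∘ λ` on bilinear forms, tested with orthonormal frames. -/
theorem StructureConditions.le_add_sum_diag (hf : StructureConditions Γ f)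
    (hG : ∀ v w, G v w = G w v) (hd : Module.finrank ℝ V = n)
    {lam mu : Fin n → ℝ} (hl : lam ∈ Γ) (hm : mu ∈ Γ) (he : IsFrame G e) {e' : Fin n → V}
    (he' : IsFrame G e') {B : V →L[ℝ] V →L[ℝ] ℝ}
    (hB : ∀ i j, B (e' i) (e' j) = if i = j then mu i else 0) :
    f mu ≤ f lam + ∑ i, pder f lam i * (B (e i) (e i) - lam i) := by
  -- Schur: the diagonal of `B` in the frame `e` is a doubly stochastic matrix applied to its
  -- eigenvalues.
  have hS := he.doublyStochastic hG hd he'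
  obtain ⟨h1, h2⟩ := hf.mulVec_mem hm hS
  refine h2.trans ((hf.le_add_sum hl h1).trans (le_of_eq ?_))
  congr 1
  refine Finset.sum_congr rfl fun i _ => ?_
  rw [he'.diag_apply hd hB (e i)]
  congr 2
  simp only [Matrix.mulVec, dotProduct, Matrix.of_apply]
  exact Finset.sum_congr rfl fun k _ => mul_comm _ _

end Frame

/-! ### The pointwise inequality at a maximum bounds the gradient -/

/-- The arithmetic that exploits the inequality at the maximum. `P2` is the squared gradient, `a`
the power `P ^ γ`, and `X`, `Y`, `Z` are the sums of `f_i` against `|H e_i|²`, the concavity defects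
and `-λ_i`. The size of `N₀` first forces `P2 ≤ C₄ a F`; every term without the factor `F` can then
be absorbed into `a F`. -/
theorem scalar_consequences {F m P2 a X Y Z ψp N₀ C_A C_ψ C₃ D t₀ : ℝ} (hF : 0 < F)
    (hP : 0 < P2) (hA : 0 ≤ C_A) (hψ : 0 ≤ C_ψ) (hC : 0 ≤ C₃) (ht : 0 ≤ t₀)
    (hX : 0 ≤ X) (hY : 0 ≤ Y) (hψp : 0 < ψp) (hm1 : P2 ≤ 2 * D * m) (hm2 : m ≤ P2 / 2)
    (hm : 0 < m) (hD : 0 < D) (ha : P2 ≤ a)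
    (h : X + m * (Z + Y + ψp - C_A * F - C_ψ) ≤ C₃ * (a * F + P2))
    (hZ : N₀ - t₀ * F ≤ Z + ψp) (hN : C_ψ + 2 * D * (C₃ + 1) ≤ N₀) :
    let C₄ := C₃ + (C_A + t₀) / 2
    let C₆ := C₃ + C₃ * C₄ + (C_A + t₀) / 2
    let C₇ := C₃ + C₃ * C₄ + C_A / 2 + C_ψ * C₄ / 2
    X ≤ C₆ * (a * F) ∧ P2 * Y ≤ 2 * D * C₆ * (a * F) ∧ P2 * Z ≤ 2 * D * C₇ * (a * F) := by
  intro C₄ C₆ C₇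
  have haF : P2 * F ≤ a * F := by gcongr
  have haF0 : 0 < a * F := lt_of_lt_of_le (mul_pos hP hF) haF
  have hmF : m * F ≤ a * F / 2 := by nlinarith
  have hmF0 : 0 < m * F := mul_pos hm hF
  have e1 : m * (N₀ - C_ψ - (C_A + t₀) * F) ≤ m * (Z + Y + ψp - C_A * F - C_ψ) :=
    mul_le_mul_of_nonneg_left (by linarith) hm.le
  -- Here `N₀` is large enough: as `m ≥ P2 / (2D)`, the good term exceeds `C₃ * P2` by a full `P2`.
  have e2 : P2 * (C₃ + 1) ≤ m * (N₀ - C_ψ) := by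
    have : m * (2 * D * (C₃ + 1)) ≤ m * (N₀ - C_ψ) :=
      mul_le_mul_of_nonneg_left (by linarith) hm.le
    have h3 : P2 * (C₃ + 1) ≤ 2 * D * m * (C₃ + 1) := by gcongr
    linarith
  have hQ : m * ((C_A + t₀) * F) ≤ (C_A + t₀) / 2 * (a * F) := by
    have := mul_le_mul_of_nonneg_left hmF (by positivity : 0 ≤ C_A + t₀)
    nlinarith
  have hC4 : 0 ≤ C₄ := by positivity
  have e3 : P2 ≤ C₄ * (a * F) := by
    simp only [C₄]; nlinarith
  have e4 : C₃ * P2 ≤ C₃ * C₄ * (a * F) := by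
    have := mul_le_mul_of_nonneg_left e3 hC; linarith
  have e5 : 0 ≤ m * (N₀ - C_ψ) := le_trans (by positivity) e2
  have e6 : X + m * Y ≤ C₆ * (a * F) := by
    have : m * (N₀ - C_ψ - (C_A + t₀) * F) + m * Y ≤ m * (Z + Y + ψp - C_A * F - C_ψ) := by
      rw [← mul_add]; exact mul_le_mul_of_nonneg_left (by linarith) hm.le
    simp only [C₆]; nlinarith
  have hmY : 0 ≤ m * Y := by positivity
  have hC6 : 0 ≤ C₆ := by positivity
  have hC7 : 0 ≤ C₇ := by positivity
  refine ⟨by linarith, ?_, ?_⟩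
  · have : P2 * Y ≤ 2 * D * m * Y := by gcongr
    have h2 : 2 * D * (m * Y) ≤ 2 * D * (C₆ * (a * F)) :=
      mul_le_mul_of_nonneg_left (by linarith) (by positivity)
    linarith
  · have hmZ : m * Z ≤ C₇ * (a * F) := by
      have h1 : m * (Z - C_A * F - C_ψ) ≤ m * (Z + Y + ψp - C_A * F - C_ψ) :=
        mul_le_mul_of_nonneg_left (by linarith) hm.le
      have h2 : m * C_ψ ≤ C_ψ * C₄ / 2 * (a * F) := by
        have h3 : m ≤ C₄ * (a * F) / 2 := by linarith
        have := mul_le_mul_of_nonneg_right h3 hψ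
        linarith
      have h3 : m * (C_A * F) ≤ C_A / 2 * (a * F) := by
        have := mul_le_mul_of_nonneg_left hmF hA
        linarith
      simp only [C₇]; nlinarith
    -- `Z` has no sign, and `P2 ≤ 2 D m` may only be multiplied by it when it is nonnegative.
    rcases le_total Z 0 with hZ0 | hZ0
    · have : P2 * Z ≤ 0 := mul_nonpos_of_nonneg_of_nonpos hP.le hZ0
      have h5 : 0 ≤ 2 * D * C₇ * (a * F) := by positivity
      linarith
    · have h1 : P2 * Z ≤ 2 * D * m * Z := by gcongr
      have h2 : 2 * D * (m * Z) ≤ 2 * D * (C₇ * (a * F)) := by gcongr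
      linarith

set_option maxHeartbeats 1000000 in
set_option synthInstance.maxHeartbeats 200000 in
-- The linear algebra at the maximum point. `H` is the Hessian, `A₀`, `A₂`, `A₁` are the values of
-- `A` at the gradients `0`, `p/2`, `p`, and `dA`, `dψ` are the derivatives in the gradient variable
-- along `p`; `a = P ^ γ` and `b = P ^ (γ/2)` in the application. The constant is chosen before the
-- space and the forms, which is what makes the final estimate uniform.
theorem exists_quartic_bound {n : ℕ} [NeZero n] {Γ : Set (Fin n → ℝ)} {f : (Fin n → ℝ) → ℝ}
    (hf : StructureConditions Γ f) {C_A C_ψ C₃ D t₀ c₀ : ℝ} (hA : 0 ≤ C_A) (hψ : 0 ≤ C_ψ)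
    (hC : 0 ≤ C₃) (ht : 0 < t₀) (hc : 0 < c₀) (hD : 0 < D)
    (hN : C_ψ + 2 * D * (C₃ + 1) ≤ f (fun _ => t₀)) :
    ∃ C : ℝ, ∀ {V : Type} [NormedAddCommGroup V] [NormedSpace ℝ V] [FiniteDimensional ℝ V]
      (_ : Module.finrank ℝ V = n) (G H A₀ A₁ A₂ : V →L[ℝ] V →L[ℝ] ℝ) (p : V)
      (e : Fin n → V) (lam dA : Fin n → ℝ) (dψ ψ₀ ψp m P a b : ℝ),
      (∀ v w, G v w = G w v) → (∀ v w, A₀ v w = A₀ w v) → (∀ v w, A₁ v w = A₁ w v) →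
      (∀ v w, A₂ v w = A₂ w v) → IsFrame G e → lam ∈ Γ →
      (∀ i j, (H + A₁) (e i) (e j) = if i = j then lam i else 0) → f lam = ψp →
      (∀ v w, H v w = H w v) → (∀ w, H p w = m * G p w) → G p p = P ^ 2 → 1 ≤ P → b ^ 2 = a →
      P ≤ b → b ≤ P ^ 2 → P ^ 2 ≤ 2 * D * m → m ≤ P ^ 2 / 2 →
      (∑ i, pder f lam i * ∑ k, H (e i) (e k) ^ 2)
        + m * ((∑ i, pder f lam i * (-H (e i) (e i) - dA i)) + dψ)
        ≤ C₃ * (a * (∑ i, pder f lam i) + P ^ 2) →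
      (∀ i, dA i ≤ A₁ (e i) (e i) - A₀ (e i) (e i)) →
      (∀ i, dA i ≤ 2 * (A₁ (e i) (e i) - A₂ (e i) (e i))) →
      ψp - ψ₀ ≤ dψ → (∀ ξ, |A₀ ξ ξ| ≤ C_A * G ξ ξ) →
      (∀ ξ, A₁ ξ ξ ≤ 2 * C_A * P * G ξ ξ) → (∀ ξ, A₂ ξ ξ ≤ 2 * C_A * P * G ξ ξ) →
      (∀ ξ, A₀ ξ ξ + A₁ ξ ξ ≤ 2 * A₂ ξ ξ) →
      (∀ τ, G p τ = 0 → c₀ / 4 * P ^ 2 * G τ τ ≤ 2 * A₂ τ τ - A₀ τ τ - A₁ τ τ) →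
      ψ₀ ≤ C_ψ → 0 < ψp → P ^ 4 ≤ C * a := by
  obtain ⟨C₄, hC₄⟩ : ∃ x, x = C₃ + (C_A + t₀) / 2 := ⟨_, rfl⟩
  obtain ⟨C₆, hC₆⟩ : ∃ x, x = C₃ + C₃ * C₄ + (C_A + t₀) / 2 := ⟨_, rfl⟩
  obtain ⟨C₇, hC₇⟩ : ∃ x, x = C₃ + C₃ * C₄ + C_A / 2 + C_ψ * C₄ / 2 := ⟨_, rfl⟩
  obtain ⟨C₉, hC₉⟩ : ∃ x, x = 2 * D * C₇ + 1 / 2 + 2 * C_A + C₆ / 2 := ⟨_, rfl⟩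
  obtain ⟨C₁₀, hC₁₀⟩ : ∃ x, x = 5 * C_A + 1 / 2 + n * C₉ := ⟨_, rfl⟩
  obtain ⟨C₁₁, hC₁₁⟩ : ∃ x, x = 4 * D ^ 2 * n * C₆ := ⟨_, rfl⟩
  have h4 : 0 ≤ C₄ := by rw [hC₄]; positivity
  have h6 : 0 ≤ C₆ := by rw [hC₆]; positivity
  have h7 : 0 ≤ C₇ := by rw [hC₇]; positivity
  have h9 : 0 ≤ C₉ := by rw [hC₉]; positivity
  have h10 : 0 ≤ C₁₀ := by rw [hC₁₀]; positivity
  have h11 : 0 ≤ C₁₁ := by rw [hC₁₁]; positivity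
  refine ⟨C₁₁ + 4 / c₀ * (4 * D * n * C₆ + 2 * C₁₀ * C₁₁), ?_⟩
  intro V _ _ _ hd G H A₀ A₁ A₂ p e lam dA dψ ψ₀ ψp m P a b hG hA₀ hA₁ hA₂ he hl hdiag hfl hH
    hHp hpp hP hb hPb hbP hm1 hm2 hkey hdA1 hdA2 hdψ hA0 hA1 hA2 hJ hmtw hψ₀ hψp
  have hP0 : 0 < P := by linarith
  have hb0 : 0 < b := by linarith
  have ha : P ^ 2 ≤ a := by rw [← hb]; gcongr
  have ha4 : a ≤ P ^ 2 * P ^ 2 := by rw [← hb, sq]; gcongr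
  have ha0 : 0 < a := lt_of_lt_of_le (by positivity) ha
  have hm : 0 < m := by
    by_contra hcon
    push Not at hcon
    have : 2 * D * m ≤ 0 := mul_nonpos_of_nonneg_of_nonpos (by positivity) hcon
    have : 0 < P ^ 2 := by positivity
    linarith
  obtain ⟨F, hFdef⟩ : ∃ F, F = ∑ i, pder f lam i := ⟨_, rfl⟩
  have hfi : ∀ i, 0 < pder f lam i := fun i => hf.pder_pos hl i
  have hF : 0 < F := by
    rw [hFdef]; exact Finset.sum_pos (fun i _ => hfi i) Finset.univ_nonempty
  obtain ⟨h, hh⟩ : ∃ h : Fin n → ℝ, h = fun i => ∑ k, H (e i) (e k) ^ 2 := ⟨_, rfl⟩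
  have hh0 : ∀ i, 0 ≤ h i := fun i => by
    rw [hh]; exact Finset.sum_nonneg fun _ _ => sq_nonneg _
  have hei : ∀ i, G (e i) (e i) = 1 := fun i => by rw [he i i]; simp
  have hlam : ∀ i, lam i = H (e i) (e i) + A₁ (e i) (e i) := fun i => by
    have := hdiag i i; simpa using this.symm
  -- `E i` is the defect of the tangent inequality for `A` in the direction `e i`, from `p` to `0`.
  -- It is kept because it dominates the second difference to which MTW applies.
  obtain ⟨E, hE⟩ : ∃ E : Fin n → ℝ, E = fun i => A₁ (e i) (e i) - A₀ (e i) (e i) - dA i :=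
    ⟨_, rfl⟩
  have hE0 : ∀ i, 0 ≤ E i := fun i => by rw [hE]; have := hdA1 i; simp only; linarith
  obtain ⟨X, hX⟩ : ∃ X, X = ∑ i, pder f lam i * h i := ⟨_, rfl⟩
  obtain ⟨Y, hY⟩ : ∃ Y, Y = ∑ i, pder f lam i * E i := ⟨_, rfl⟩
  obtain ⟨Z, hZ⟩ : ∃ Z, Z = ∑ i, pder f lam i * (-lam i) := ⟨_, rfl⟩
  have hX0 : 0 ≤ X := by
    rw [hX]; exact Finset.sum_nonneg fun i _ => mul_nonneg (hfi i).le (hh0 i)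
  have hY0 : 0 ≤ Y := by
    rw [hY]; exact Finset.sum_nonneg fun i _ => mul_nonneg (hfi i).le (hE0 i)
  have hcone : (fun _ : Fin n => t₀) ∈ Γ := hf.positive_subset fun _ => ht
  -- The competitor in the tangent inequality for `f` is the diagonal point `(t₀, …, t₀)`.
  have hZN : f (fun _ => t₀) - t₀ * F ≤ Z + ψp := by
    have := hf.le_add_sum hl hcone
    have h2 : ∑ i, pder f lam i * (t₀ - lam i) = t₀ * F + Z := by
      rw [hFdef, hZ, Finset.mul_sum, ← Finset.sum_add_distrib]
      exact Finset.sum_congr rfl fun i _ => by ring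
    rw [h2, hfl] at this
    linarith
  have hmain : X + m * (Z + Y + ψp - C_A * F - C_ψ) ≤ C₃ * (a * F + P ^ 2) := by
    refine le_trans ?_ (hFdef ▸ hkey)
    rw [hX, hh]
    have h3 : Z + Y - C_A * F ≤ ∑ i, pder f lam i * (-H (e i) (e i) - dA i) := by
      rw [hZ, hY, hFdef, Finset.mul_sum, ← Finset.sum_add_distrib, ← Finset.sum_sub_distrib]
      refine Finset.sum_le_sum fun i _ => ?_
      have h5 : -lam i + E i - C_A ≤ -H (e i) (e i) - dA i := by
        have := neg_abs_le (A₀ (e i) (e i))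
        have h6 := hA0 (e i)
        rw [hei] at h6
        rw [hlam, hE]
        simp only
        linarith
      have := mul_le_mul_of_nonneg_left h5 (hfi i).le
      linarith
    have h4 : m * (Z + Y + ψp - C_A * F - C_ψ)
        ≤ m * ((∑ i, pder f lam i * (-H (e i) (e i) - dA i)) + dψ) :=
      mul_le_mul_of_nonneg_left (by linarith) hm.le
    linarith
  obtain ⟨r1, r2, r3⟩ := scalar_consequences hF (by positivity) hA hψ hC ht.le hX0 hY0 hψp hm1
    hm2 hm hD ha hmain hZN hN
  rw [← hC₄] at r1 r2 r3
  rw [← hC₆] at r1 r2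
  rw [← hC₇] at r3
  obtain ⟨k, hk, hkF⟩ := hf.exists_min_index hl
  rw [← hFdef] at hkF
  have hn0 : (0 : ℝ) < n := by exact_mod_cast Nat.pos_of_ne_zero (NeZero.ne n)
  -- a quantity weighted by `f_k` is controlled by the weighted sum
  have single : ∀ q : Fin n → ℝ, (∀ i, 0 ≤ q i) → F * q k ≤ n * ∑ i, pder f lam i * q i := by
    intro q hq
    have h1 : pder f lam k * q k ≤ ∑ i, pder f lam i * q i :=
      Finset.single_le_sum (f := fun i => pder f lam i * q i)
        (fun i _ => mul_nonneg (hfi i).le (hq i)) (Finset.mem_univ k)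
    have h2 : F * q k ≤ n * pder f lam k * q k := mul_le_mul_of_nonneg_right hkF (hq k)
    have h3 := mul_le_mul_of_nonneg_left h1 hn0.le
    linarith
  have hhk : h k ≤ n * C₆ * a := by
    have h1 := single h hh0
    rw [← hX] at h1
    have h2 := mul_le_mul_of_nonneg_left r1 hn0.le
    have h3 : F * h k ≤ F * (n * C₆ * a) := by linarith
    exact le_of_mul_le_mul_left h3 hF
  have hEk : P ^ 2 * E k ≤ 2 * D * n * C₆ * a := by
    have h1 := single E hE0
    rw [← hY] at h1
    have h2 := mul_le_mul_of_nonneg_left r2 hn0.le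
    have h4 := mul_le_mul_of_nonneg_left h1 (by positivity : 0 ≤ P ^ 2)
    have h3 : F * (P ^ 2 * E k) ≤ F * (2 * D * n * C₆ * a) := by linarith
    exact le_of_mul_le_mul_left h3 hF
  -- The negative parts of the eigenvalues sum to `Z` plus the positive parts, so an upper bound for
  -- the positive parts bounds `λ_k` from below.
  have hlamk : -lam k ≤ n * C₉ * P ^ 2 := by
    -- Young's inequality with weight `b = √a` balances `b F` against `X / b ≤ C₆ b F`.
    have hplus : ∑ i, pder f lam i * max (lam i) 0 ≤ (1 / 2 + 2 * C_A + C₆ / 2) * b * F := by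
      have h1 : ∀ i, max (lam i) 0 ≤ (1 / 2 + 2 * C_A) * b + h i / (2 * b) := by
        intro i
        have hHi : H (e i) (e i) ≤ b / 2 + h i / (2 * b) := by
          have h2 : H (e i) (e i) ^ 2 ≤ h i := by
            rw [hh]
            exact Finset.single_le_sum (f := fun k => H (e i) (e k) ^ 2)
              (fun _ _ => sq_nonneg _) (Finset.mem_univ i)
          have h3 : b / 2 + h i / (2 * b) - H (e i) (e i)
              = ((b - H (e i) (e i)) ^ 2 + (h i - H (e i) (e i) ^ 2)) / (2 * b) := by
            field_simp; ring
          have h4 : 0 ≤ ((b - H (e i) (e i)) ^ 2 + (h i - H (e i) (e i) ^ 2)) / (2 * b) := by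
            apply div_nonneg _ (by positivity)
            have := sq_nonneg (b - H (e i) (e i))
            linarith
          linarith
        have hAi := hA1 (e i)
        rw [hei, mul_one] at hAi
        have : 2 * C_A * P ≤ 2 * C_A * b := by gcongr
        refine max_le ?_ ?_
        · rw [hlam]; linarith
        · have := hh0 i; positivity
      calc ∑ i, pder f lam i * max (lam i) 0
          ≤ ∑ i, pder f lam i * ((1 / 2 + 2 * C_A) * b + h i / (2 * b)) :=
            Finset.sum_le_sum fun i _ => mul_le_mul_of_nonneg_left (h1 i) (hfi i).le
        _ = (1 / 2 + 2 * C_A) * b * F + X / (2 * b) := by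
            rw [hFdef, hX, Finset.mul_sum, Finset.sum_div, ← Finset.sum_add_distrib]
            exact Finset.sum_congr rfl fun i _ => by ring
        _ ≤ (1 / 2 + 2 * C_A) * b * F + C₆ * (a * F) / (2 * b) := by gcongr
        _ = (1 / 2 + 2 * C_A + C₆ / 2) * b * F := by
            rw [← hb]; field_simp
    have h1 := single (fun i => max (-lam i) 0) (fun i => le_max_right _ _)
    have h2 : ∑ i, pder f lam i * max (-lam i) 0 = Z + ∑ i, pder f lam i * max (lam i) 0 := by
      rw [hZ, ← Finset.sum_add_distrib]
      refine Finset.sum_congr rfl fun i _ => ?_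
      rw [← mul_add]
      congr 1
      rcases le_total (lam i) 0 with h0 | h0
      · rw [max_eq_left (by linarith), max_eq_right h0]; ring
      · rw [max_eq_right (by linarith), max_eq_left h0]; ring
    have h3 : Z ≤ 2 * D * C₇ * P ^ 2 * F := by
      have h5 : P ^ 2 * Z ≤ P ^ 2 * (2 * D * C₇ * P ^ 2 * F) := by
        refine r3.trans ?_
        have : 2 * D * C₇ * (a * F) ≤ 2 * D * C₇ * (P ^ 2 * P ^ 2 * F) := by gcongr
        linarith
      exact le_of_mul_le_mul_left h5 (by positivity)
    have h4 : (1 / 2 + 2 * C_A + C₆ / 2) * b * F ≤ (1 / 2 + 2 * C_A + C₆ / 2) * P ^ 2 * F := by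
      gcongr
    have h5 : F * max (-lam k) 0 ≤ F * (n * C₉ * P ^ 2) := by
      refine h1.trans ?_
      rw [h2]
      have : n * (Z + ∑ i, pder f lam i * max (lam i) 0)
          ≤ n * (2 * D * C₇ * P ^ 2 * F + (1 / 2 + 2 * C_A + C₆ / 2) * P ^ 2 * F) := by
        gcongr
        linarith
      rw [hC₉]
      linarith
    exact (le_max_left _ _).trans (le_of_mul_le_mul_left h5 hF)
  have hP4 : P ^ 4 = P ^ 2 * P ^ 2 := by ring
  -- `(H + A₁)(p, p) ≥ λ_k P²` while `H(p, p) = m P²` is at most of order `P⁴`; hence `A₁(p, p)`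
  -- cannot be more negative than order `P⁴`.
  have hApp : -A₁ p p ≤ (1 / 2 + n * C₉) * P ^ 4 := by
    have h1 := he.diag_apply hd hdiag p
    have h2 : -(n * C₉ * P ^ 2) * P ^ 2 ≤ (H + A₁) p p := by
      have h6 : P ^ 2 = ∑ i, G p (e i) * G p (e i) := by rw [← hpp, he.parseval hd p p]
      rw [h1]
      conv_lhs => rw [mul_comm, h6, Finset.sum_mul, ← h6]
      refine Finset.sum_le_sum fun i _ => ?_
      rw [← sq, mul_comm]
      have := hk i
      exact mul_le_mul_of_nonneg_right (by linarith) (sq_nonneg _)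
    have h3 : (H + A₁) p p = m * P ^ 2 + A₁ p p := by
      simp [hHp p, hpp]
    have h4 : m * P ^ 2 ≤ P ^ 2 / 2 * P ^ 2 := by gcongr
    rw [hP4]
    linarith
  -- `J` is the second difference of `A` on the segment from `0` to `p`: a nonnegative form by
  -- concavity, and bounded below by MTW on the orthogonal complement of `p`.
  obtain ⟨J, hJd⟩ : ∃ J : V →L[ℝ] V →L[ℝ] ℝ, J = (2 : ℝ) • A₂ - A₀ - A₁ := ⟨_, rfl⟩
  have hJa : ∀ v w, J v w = 2 * A₂ v w - A₀ v w - A₁ v w := fun v w => by simp [hJd]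
  have hJs : ∀ v w, J v w = J w v := fun v w => by
    rw [hJa, hJa, hA₀ v w, hA₁ v w, hA₂ v w]
  have hJ0 : ∀ v, 0 ≤ J v v := fun v => by rw [hJa]; have := hJ v; linarith
  have hJp : J p p ≤ C₁₀ * P ^ 4 := by
    rw [hJa, hC₁₀]
    have h1 := hA2 p
    have h2 := neg_abs_le (A₀ p p)
    have h3 := hA0 p
    rw [hpp] at h1 h3
    have h4 : P * P ^ 2 ≤ P ^ 4 := by
      have : P ^ 3 ≤ P ^ 4 := pow_le_pow_right₀ hP (by norm_num)
      linarith
    have h5 : P ^ 2 ≤ P ^ 4 := pow_le_pow_right₀ hP (by norm_num)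
    have h6 := mul_le_mul_of_nonneg_left h4 hA
    have h7 := mul_le_mul_of_nonneg_left h5 hA
    linarith
  -- The tangent inequality at `p`, tested at `p/2`, leaves the second difference below the defect.
  have hJe : J (e k) (e k) ≤ E k := by
    rw [hJa, hE]; have := hdA2 k; simp only; linarith
  -- `σ p` is the component of `e_k` along `p`; MTW will be applied to `e_k - σ p`.
  obtain ⟨σ, hσ⟩ : ∃ σ, σ = G (e k) p / P ^ 2 := ⟨_, rfl⟩
  have hσ' : G (e k) p = σ * P ^ 2 := by rw [hσ]; field_simp
  have hσ'' : G p (e k) = σ * P ^ 2 := by rw [hG, hσ']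
  have horth : G p (e k - σ • p) = 0 := by
    simp only [map_sub, map_smul, smul_eq_mul, hσ'', hpp]; ring
  have hGτ : G (e k - σ • p) (e k - σ • p) = 1 - σ ^ 2 * P ^ 2 := by
    simp only [map_sub, map_smul, smul_eq_mul, sub_apply,
      smul_apply, hσ'', hσ', hpp, hei]; ring
  -- Parallelogram law for `J`, discarding `J(e_k + σ p, e_k + σ p) ≥ 0`.
  have hJτ : J (e k - σ • p) (e k - σ • p) ≤ 2 * J (e k) (e k) + 2 * σ ^ 2 * J p p := by
    have h1 := hJ0 (e k + σ • p)
    simp only [map_sub, map_add, map_smul, smul_eq_mul, sub_apply, add_apply, smul_apply] at h1 ⊢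
    linear_combination h1
  -- As `p` is an eigenvector of `H`, `H(e_k, p) = m σ P²`. Cauchy–Schwarz bounds its square by `|H
  -- e_k|² P²`, and `m` is at least of order `P²`.
  have hσb : σ ^ 2 * P ^ 6 ≤ C₁₁ * a := by
    have h1 : H (e k) p ^ 2 ≤ h k * P ^ 2 := by
      rw [he.apply_eq_sum hd H (e k) p, hh, ← hpp, he.parseval hd p p, mul_comm]
      simp only [← sq]
      exact Finset.sum_mul_sq_le_sq_mul_sq _ _ _
    have h2 : H (e k) p = m * (σ * P ^ 2) := by rw [hH, hHp, hσ'']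
    rw [h2] at h1
    have h3 : (P ^ 2) ^ 2 ≤ (2 * D * m) ^ 2 := by gcongr
    have h4 : (m * (σ * P ^ 2)) ^ 2 ≤ n * C₆ * a * P ^ 2 := h1.trans (by gcongr)
    have h5 : σ ^ 2 * P ^ 4 * (P ^ 2) ^ 2 ≤ σ ^ 2 * P ^ 4 * (2 * D * m) ^ 2 := by gcongr
    have h6 : 4 * D ^ 2 * (m * (σ * P ^ 2)) ^ 2 ≤ 4 * D ^ 2 * (n * C₆ * a * P ^ 2) := by gcongr
    have h7 : P ^ 2 * (σ ^ 2 * P ^ 6) ≤ P ^ 2 * (C₁₁ * a) := by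
      rw [hC₁₁]; linear_combination h5 + h6
    exact le_of_mul_le_mul_left h7 (by positivity)
  -- `|e_k - σ p|² = 1 - σ² P²`. After multiplication by `P²` the errors are multiples of `σ² P⁶`
  -- and `P² E_k`, both already `O(a)`, and `P⁴` remains on the left.
  have hfin := hmtw _ horth
  rw [← hJa, hGτ] at hfin
  have h1 : c₀ / 4 * P ^ 2 * (1 - σ ^ 2 * P ^ 2) ≤ 2 * E k + 2 * σ ^ 2 * (C₁₀ * P ^ 4) := by
    have : 2 * σ ^ 2 * J p p ≤ 2 * σ ^ 2 * (C₁₀ * P ^ 4) := by gcongr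
    linarith
  have h2 := mul_le_mul_of_nonneg_left h1 (by positivity : 0 ≤ P ^ 2)
  have h3 : 2 * C₁₀ * (σ ^ 2 * P ^ 6) ≤ 2 * C₁₀ * (C₁₁ * a) := by gcongr
  have h4 : c₀ / 4 * (P ^ 4 - σ ^ 2 * P ^ 6) ≤ 4 * D * n * C₆ * a + 2 * C₁₀ * (C₁₁ * a) := by
    linear_combination h2 + 2 * hEk + h3
  have h5 : P ^ 4 - σ ^ 2 * P ^ 6 ≤ 4 / c₀ * (4 * D * n * C₆ * a + 2 * C₁₀ * (C₁₁ * a)) := by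
    have := mul_le_mul_of_nonneg_left h4 (by positivity : 0 ≤ 4 / c₀)
    have h8 : 4 / c₀ * (c₀ / 4 * (P ^ 4 - σ ^ 2 * P ^ 6)) = P ^ 4 - σ ^ 2 * P ^ 6 := by
      field_simp
    linarith
  linarith

end HessianEq

namespace HessianEq

noncomputable section

set_option linter.unusedSectionVars false
set_option maxSynthPendingDepth 3
set_option synthInstance.maxHeartbeats 400000
set_option maxHeartbeats 1000000

/-! ### The Levi-Civita connection of a metric on a vector space -/

section Local

variable {V : Type*} [NormedAddCommGroup V] [NormedSpace ℝ V] [FiniteDimensional ℝ V]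

theorem isInvertible_of_pos {B : V →L[ℝ] V →L[ℝ] ℝ} (hB : ∀ v, v ≠ 0 → 0 < B v v) :
    B.IsInvertible := by
  have hinj : Function.Injective B := by
    rw [injective_iff_map_eq_zero]
    intro v hv
    by_contra hne
    have := hB v hne
    rw [hv] at this
    simp at this
  have hd : Module.finrank ℝ V = Module.finrank ℝ (V →L[ℝ] ℝ) := by
    rw [← (LinearMap.toContinuousLinearMap (𝕜 := ℝ) (E := V) (F' := ℝ)).finrank_eq,
      Subspace.dual_finrank_eq]
  refine ⟨(LinearMap.linearEquivOfInjective (B : V →ₗ[ℝ] (V →L[ℝ] ℝ)) hinj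
    hd).toContinuousLinearEquiv, ?_⟩
  ext v w
  simp

/-- The connection `Γ` is torsion free and compatible with the metric `G` at `y`. -/
structure IsLeviCivitaAt (G : V → V →L[ℝ] V →L[ℝ] ℝ) (Γ : V → V →L[ℝ] V →L[ℝ] V) (y : V) :
    Prop where
  diff : DifferentiableAt ℝ G y
  symm : ∀ v w, G y v w = G y w v
  pos : ∀ v, v ≠ 0 → 0 < G y v v
  torsion : ∀ v w, Γ y v w = Γ y w v
  compat : ∀ v w z, fderiv ℝ G y v w z = G y (Γ y v w) z + G y w (Γ y v z)

theorem IsLeviCivitaAt.invertible {G : V → V →L[ℝ] V →L[ℝ] ℝ} {Γ : V → V →L[ℝ] V →L[ℝ] V}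
    {y : V} (h : IsLeviCivitaAt G Γ y) : (G y).IsInvertible := isInvertible_of_pos h.pos

/-- The Hessian `∂²u - Γ ∂u`. -/
def hessLoc (Γ : V → V →L[ℝ] V →L[ℝ] V) (u : V → ℝ) (y : V) : V →L[ℝ] V →L[ℝ] ℝ :=
  fderiv ℝ (fderiv ℝ u) y - (ContinuousLinearMap.compL ℝ V V ℝ (fderiv ℝ u y)).comp (Γ y)

/-- The gradient of `u` for the metric `G`. -/
def gradLoc (G : V → V →L[ℝ] V →L[ℝ] ℝ) (u : V → ℝ) (y : V) : V := (G y).inverse (fderiv ℝ u y)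

variable {G : V → V →L[ℝ] V →L[ℝ] ℝ} {Γ : V → V →L[ℝ] V →L[ℝ] V} {u : V → ℝ} {y : V}

theorem hessLoc_apply (v w : V) :
    hessLoc Γ u y v w = fderiv ℝ (fderiv ℝ u) y v w - fderiv ℝ u y (Γ y v w) := rfl

theorem IsLeviCivitaAt.gradLoc_apply (h : IsLeviCivitaAt G Γ y) (w : V) :
    G y (gradLoc G u y) w = fderiv ℝ u y w := by
  rw [gradLoc, h.invertible.self_apply_inverse]

theorem IsLeviCivitaAt.hessLoc_symm (h : IsLeviCivitaAt G Γ y) (hu : ContDiffAt ℝ 2 u y)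
    (v w : V) : hessLoc Γ u y v w = hessLoc Γ u y w v := by
  rw [hessLoc_apply, hessLoc_apply, h.torsion v w,
    (hu.isSymmSndFDerivAt (by simp)).eq v w]

theorem IsLeviCivitaAt.differentiableAt_gradLoc (h : IsLeviCivitaAt G Γ y)
    (hu : ContDiffAt ℝ 2 u y) : DifferentiableAt ℝ (gradLoc G u) y := by
  have h1 : DifferentiableAt ℝ (fun z => (G z).inverse) y :=
    ((h.invertible.contDiffAt_map_inverse (n := 1)).differentiableAt one_ne_zero).comp y h.diff
  exact h1.clm_apply ((hu.fderiv_right (m := 1) (by norm_num)).differentiableAt one_ne_zero)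

/-- The covariant derivative of the gradient is the Hessian. -/
theorem IsLeviCivitaAt.covDeriv_gradLoc (h : IsLeviCivitaAt G Γ y)
    (hG : ∀ᶠ z in 𝓝 y, IsLeviCivitaAt G Γ z)
    (hu : ContDiffAt ℝ 2 u y) (v w : V) :
    G y (fderiv ℝ (gradLoc G u) y v + Γ y v (gradLoc G u y)) w = hessLoc Γ u y v w := by
  have hX := (h.differentiableAt_gradLoc hu).hasFDerivAt
  have h1 := (h.diff.hasFDerivAt.clm_apply hX).clm_apply (hasFDerivAt_const w y)
  have h2 : HasFDerivAt (fun z => fderiv ℝ u z w) _ y :=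
    ((hu.fderiv_right (m := 1) (by norm_num)).differentiableAt
      one_ne_zero).hasFDerivAt.clm_apply (hasFDerivAt_const w y)
  have h3 : (fun z => G z (gradLoc G u z) w) =ᶠ[𝓝 y] fun z => fderiv ℝ u z w :=
    hG.mono fun z hz => hz.gradLoc_apply w
  have h4 := congrArg (fun T => T v) ((h2.congr_of_eventuallyEq h3).unique h1)
  simp at h4
  rw [h.compat] at h4
  rw [hessLoc_apply, h4, ← h.gradLoc_apply, map_add, add_apply]
  ring

/-- Half the squared length of the gradient. -/
def energyLoc (G : V → V →L[ℝ] V →L[ℝ] ℝ) (u : V → ℝ) (y : V) : ℝ :=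
  1 / 2 * fderiv ℝ u y (gradLoc G u y)

/-- In the product rule for `du(∇u) / 2` the two halves equal half the Hessian up to Christoffel
terms of opposite sign, by `covDeriv_gradLoc`. -/
theorem IsLeviCivitaAt.hasFDerivAt_energyLoc (h : IsLeviCivitaAt G Γ y)
    (hG : ∀ᶠ z in 𝓝 y, IsLeviCivitaAt G Γ z) (hu : ContDiffAt ℝ 2 u y) :
    HasFDerivAt (energyLoc G u) (hessLoc Γ u y (gradLoc G u y)) y := by
  have hX := (h.differentiableAt_gradLoc hu).hasFDerivAt
  have h2 := (((hu.fderiv_right (m := 1) (by norm_num)).differentiableAt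
      one_ne_zero).hasFDerivAt.clm_apply hX).const_mul (1 / 2 : ℝ)
  refine h2.congr_fderiv ?_
  ext v
  have h3 := h.covDeriv_gradLoc hG hu v (gradLoc G u y)
  rw [h.symm, h.gradLoc_apply, map_add] at h3
  have h4 := h.hessLoc_symm hu v (gradLoc G u y)
  rw [← h4]
  simp only [smul_apply, add_apply, ContinuousLinearMap.comp_apply,
    ContinuousLinearMap.flip_apply, smul_eq_mul]
  rw [hessLoc_apply] at h3 ⊢
  linarith

theorem hasFDerivAt_hessLoc (hΓ : DifferentiableAt ℝ Γ y) (hu : ContDiffAt ℝ 3 u y) :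
    ∃ S' : V →L[ℝ] V →L[ℝ] V →L[ℝ] ℝ, HasFDerivAt (hessLoc Γ u) S' y ∧
      ∀ a v w, S' a v w = fderiv ℝ (fderiv ℝ (fderiv ℝ u)) y a v w
        - fderiv ℝ (fderiv ℝ u) y a (Γ y v w) - fderiv ℝ u y (fderiv ℝ Γ y a v w) := by
  have h1 : ContDiffAt ℝ 2 (fderiv ℝ u) y := hu.fderiv_right (by norm_num)
  have h2 : ContDiffAt ℝ 1 (fderiv ℝ (fderiv ℝ u)) y := h1.fderiv_right (by norm_num)
  have d1 := (h1.differentiableAt (by norm_num)).hasFDerivAt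
  have d2 := (h2.differentiableAt (by norm_num)).hasFDerivAt
  have d3 : HasFDerivAt (fun z => ContinuousLinearMap.compL ℝ V V ℝ (fderiv ℝ u z))
      ((ContinuousLinearMap.compL ℝ V V ℝ).comp (fderiv ℝ (fderiv ℝ u) y)) y :=
    HasFDerivAt.comp (g := fun T : V →L[ℝ] ℝ => ContinuousLinearMap.compL ℝ V V ℝ T) y
      (ContinuousLinearMap.compL ℝ V V ℝ).hasFDerivAt d1
  have d4 := d2.sub (d3.clm_comp hΓ.hasFDerivAt)
  refine ⟨_, d4, fun a v w => ?_⟩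
  have : ∀ X Y : V →L[ℝ] V →L[ℝ] V →L[ℝ] ℝ, (X - Y) a v w = X a v w - Y a v w := fun _ _ => rfl
  rw [this, sub_sub]
  congr 1
  exact add_comm _ _

/-- The curvature operator `R(p, e) e` in terms of the Christoffel symbols. -/
def curvLoc (Γ : V → V →L[ℝ] V →L[ℝ] V) (y : V) (p e : V) : V :=
  Γ y p (Γ y e e) - Γ y e (Γ y p e) + fderiv ℝ Γ y p e e - fderiv ℝ Γ y e p e

/-- **Bochner's identity** for the Hessian of half the squared length of the gradient. -/
theorem bochner (hG : ∀ᶠ z in 𝓝 y, IsLeviCivitaAt G Γ z) (hΓ : DifferentiableAt ℝ Γ y)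
    (hu : ContDiffAt ℝ 3 u y) {S' : V →L[ℝ] V →L[ℝ] V →L[ℝ] ℝ}
    (hS : HasFDerivAt (hessLoc Γ u) S' y) (e : V) :
    let p := gradLoc G u y
    let Z := fderiv ℝ (gradLoc G u) y e + Γ y e p
    fderiv ℝ (fderiv ℝ (energyLoc G u)) y e e - fderiv ℝ (energyLoc G u) y (Γ y e e)
      = G y Z Z + (S' p e e - 2 * hessLoc Γ u y (Γ y p e) e)
        + G y p (curvLoc Γ y p e) := by
  intro p Z
  have h := hG.self_of_nhds
  have hu2 : ContDiffAt ℝ 2 u y := hu.of_le (by norm_num)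
  have hX := (h.differentiableAt_gradLoc hu2).hasFDerivAt
  have e1 : fderiv ℝ (energyLoc G u) =ᶠ[𝓝 y] fun z => hessLoc Γ u z (gradLoc G u z) := by
    have : ∀ᶠ z in 𝓝 y, ContDiffAt ℝ 2 u z := hu2.eventually (by simp)
    filter_upwards [hG.eventually_nhds, this] with z hz hz2
    exact (hz.self_of_nhds.hasFDerivAt_energyLoc hz hz2).fderiv
  have e2 := (hS.clm_apply hX).congr_of_eventuallyEq e1
  rw [e2.fderiv, e1.self_of_nhds]
  obtain ⟨S'', hS'', hS2⟩ := hasFDerivAt_hessLoc hΓ hu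
  obtain rfl := hS''.unique hS
  have sym := h.hessLoc_symm hu2
  have hZ : G y Z Z = hessLoc Γ u y e Z := h.covDeriv_gradLoc hG hu2 e Z
  have hR : G y p (curvLoc Γ y p e) = fderiv ℝ u y (curvLoc Γ y p e) := h.gradLoc_apply _
  -- This exchange of third partial derivatives is the commutation of derivatives behind the
  -- identity; the Christoffel terms, which do not commute, assemble into the curvature.
  have t1 : fderiv ℝ (fderiv ℝ (fderiv ℝ u)) y e p e = fderiv ℝ (fderiv ℝ (fderiv ℝ u)) y p e e :=
    ((hu.fderiv_right (m := 2) (by norm_num)).isSymmSndFDerivAt (by simp)).eq e p ▸ rfl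
  have hp : gradLoc G u y = p := rfl
  rw [hp, hZ, hR, hS2 p, sym _ e, sym e Z]
  simp only [add_apply, ContinuousLinearMap.comp_apply, ContinuousLinearMap.flip_apply]
  rw [hS2 e, t1]
  have r1 : hessLoc Γ u y Z e = hessLoc Γ u y (fderiv ℝ (gradLoc G u) y e) e
      + hessLoc Γ u y (Γ y e p) e := by rw [map_add, add_apply]
  have r2 := hessLoc_apply (Γ := Γ) (u := u) (y := y) e (Γ y p e)
  have r3 := hessLoc_apply (Γ := Γ) (u := u) (y := y) p (Γ y e e)
  have r4 : fderiv ℝ u y (curvLoc Γ y p e) = fderiv ℝ u y (Γ y p (Γ y e e))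
      - fderiv ℝ u y (Γ y e (Γ y p e)) + fderiv ℝ u y (fderiv ℝ Γ y p e e)
      - fderiv ℝ u y (fderiv ℝ Γ y e p e) := by simp only [curvLoc, map_add, map_sub]
  rw [r1, r4, h.torsion e p, sym (Γ y p e) e]
  linarith

end Local

end

end HessianEq

namespace HessianEq

noncomputable section

set_option linter.unusedSectionVars false
set_option maxSynthPendingDepth 3
set_option synthInstance.maxHeartbeats 400000
set_option maxHeartbeats 1000000

/-! ### Change of coordinates -/

section ChangeOfCoordinates

variable {V : Type*} [NormedAddCommGroup V] [NormedSpace ℝ V] [FiniteDimensional ℝ V]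
  {G₁ G₂ : V → V →L[ℝ] V →L[ℝ] ℝ} {Γ₁ Γ₂ : V → V →L[ℝ] V →L[ℝ] V} {τ : V → V} {y : V}

/-- The transformation law of the Christoffel symbols. -/
theorem IsLeviCivitaAt.change (h₁ : IsLeviCivitaAt G₁ Γ₁ y) (h₂ : IsLeviCivitaAt G₂ Γ₂ (τ y))
    (hτ : ContDiffAt ℝ 2 τ y) (hT : Function.Surjective (fderiv ℝ τ y))
    (hG : ∀ᶠ z in 𝓝 y, ∀ v w, G₁ z v w = G₂ (τ z) (fderiv ℝ τ z v) (fderiv ℝ τ z w)) (v w : V) :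
    fderiv ℝ τ y (Γ₁ y v w)
      = Γ₂ (τ y) (fderiv ℝ τ y v) (fderiv ℝ τ y w) + fderiv ℝ (fderiv ℝ τ) y v w := by
  have dτ := (hτ.differentiableAt (by norm_num)).hasFDerivAt
  have d2 := ((hτ.fderiv_right (m := 1) (by norm_num)).differentiableAt one_ne_zero).hasFDerivAt
  have hder : ∀ a v w, fderiv ℝ G₁ y a v w
      = fderiv ℝ G₂ (τ y) (fderiv ℝ τ y a) (fderiv ℝ τ y v) (fderiv ℝ τ y w)
        + G₂ (τ y) (fderiv ℝ (fderiv ℝ τ) y a v) (fderiv ℝ τ y w)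
        + G₂ (τ y) (fderiv ℝ τ y v) (fderiv ℝ (fderiv ℝ τ) y a w) := by
    intro a v w
    have e1 := (h₁.diff.hasFDerivAt.clm_apply (hasFDerivAt_const v y)).clm_apply
      (hasFDerivAt_const w y)
    have e2 := ((h₂.diff.hasFDerivAt.comp y dτ).clm_apply
      (d2.clm_apply (hasFDerivAt_const v y))).clm_apply (d2.clm_apply (hasFDerivAt_const w y))
    have e3 : (fun z => G₁ z v w)
        =ᶠ[𝓝 y] fun z => (G₂ ∘ τ) z (fderiv ℝ τ z v) (fderiv ℝ τ z w) :=
      hG.mono fun z hz => hz v w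
    have e4 := congrArg (fun T => T a) (e1.unique (e2.congr_of_eventuallyEq e3))
    simp at e4
    rw [e4]; ring
  -- `B` is the defect of the law. It is symmetric, and by compatibility of both connections
  -- `G₂(B(a, v), dτ w)` is antisymmetric in `v, w`. A trilinear form symmetric in one pair of slots
  -- and antisymmetric in another vanishes.
  obtain ⟨B, hB⟩ : ∃ B : V → V → V, ∀ v w, B v w = fderiv ℝ τ y (Γ₁ y v w)
      - Γ₂ (τ y) (fderiv ℝ τ y v) (fderiv ℝ τ y w) - fderiv ℝ (fderiv ℝ τ) y v w :=
    ⟨_, fun _ _ => rfl⟩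
  have hBs : ∀ v w, B v w = B w v := fun v w => by
    rw [hB, hB, h₁.torsion v w, h₂.torsion (fderiv ℝ τ y v), (hτ.isSymmSndFDerivAt (by simp)).eq v w]
  have hBa : ∀ a v w, G₂ (τ y) (B a v) (fderiv ℝ τ y w)
      + G₂ (τ y) (B a w) (fderiv ℝ τ y v) = 0 := by
    intro a v w
    have e1 := h₁.compat a v w
    rw [hder, h₂.compat, hG.self_of_nhds, hG.self_of_nhds] at e1
    rw [hB, hB, h₂.symm (_ - _ - _) (fderiv ℝ τ y v)]
    simp only [map_sub, sub_apply]
    linarith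
  have hb0 : ∀ a v w, G₂ (τ y) (B a v) (fderiv ℝ τ y w) = 0 := by
    intro a v w
    have e1 := hBa a v w
    have e2 := hBa w a v
    have e3 := hBa v w a
    rw [hBs w a] at e2
    rw [hBs v w, hBs v a] at e3
    linarith
  obtain ⟨z, hz⟩ := hT (B v w)
  have h0 : B v w = 0 := by
    by_contra hne
    have e1 := h₂.pos _ hne
    have e2 := hb0 v w z
    rw [hz] at e2
    linarith
  rw [hB] at h0
  rwa [sub_sub, sub_eq_zero] at h0

/-- The Hessian does not depend on the coordinates. -/
theorem IsLeviCivitaAt.hessLoc_change (h₁ : IsLeviCivitaAt G₁ Γ₁ y)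
    (h₂ : IsLeviCivitaAt G₂ Γ₂ (τ y)) (hτ : ContDiffAt ℝ 2 τ y)
    (hT : Function.Surjective (fderiv ℝ τ y))
    (hG : ∀ᶠ z in 𝓝 y, ∀ v w, G₁ z v w = G₂ (τ z) (fderiv ℝ τ z v) (fderiv ℝ τ z w))
    {u₁ u₂ : V → ℝ} (hu₂ : ContDiffAt ℝ 2 u₂ (τ y)) (hu : u₁ =ᶠ[𝓝 y] u₂ ∘ τ) (v w : V) :
    hessLoc Γ₁ u₁ y v w = hessLoc Γ₂ u₂ (τ y) (fderiv ℝ τ y v) (fderiv ℝ τ y w) := by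
  have dτ := (hτ.differentiableAt (by norm_num)).hasFDerivAt
  have d2 := ((hτ.fderiv_right (m := 1) (by norm_num)).differentiableAt one_ne_zero).hasFDerivAt
  have hd2 : DifferentiableAt ℝ (fderiv ℝ u₂) (τ y) :=
    (hu₂.fderiv_right (m := 1) (by norm_num)).differentiableAt one_ne_zero
  have e1 : fderiv ℝ u₁ =ᶠ[𝓝 y] fun z => (fderiv ℝ u₂ (τ z)).comp (fderiv ℝ τ z) := by
    have hc2 : ∀ᶠ z in 𝓝 y, DifferentiableAt ℝ u₂ (τ z) :=
      hτ.continuousAt.eventually ((hu₂.eventually (by simp)).mono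
        fun z hz => hz.differentiableAt (by norm_num))
    have hcτ : ∀ᶠ z in 𝓝 y, DifferentiableAt ℝ τ z :=
      (hτ.eventually (by simp)).mono fun z hz => hz.differentiableAt (by norm_num)
    filter_upwards [hu.eventuallyEq_nhds, hc2, hcτ] with z hz h2 h3
    rw [hz.fderiv_eq, fderiv_comp z h2 h3]
  have e2 := ((hd2.hasFDerivAt.comp y dτ).clm_comp d2).congr_of_eventuallyEq e1
  rw [hessLoc_apply, hessLoc_apply, e2.fderiv, e1.self_of_nhds, ContinuousLinearMap.comp_apply,
    h₁.change h₂ hτ hT hG, map_add]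
  simp
  ring

end ChangeOfCoordinates

/-! ### Christoffel symbols of a metric -/

section Christoffel

variable {V : Type*} [NormedAddCommGroup V] [NormedSpace ℝ V] [FiniteDimensional ℝ V]

/-- `(v, w, z) ↦ (D(v,w,z) + D(w,v,z) - D(z,v,w)) / 2`. -/
def koszul (D : V →L[ℝ] V →L[ℝ] V →L[ℝ] ℝ) : V →L[ℝ] V →L[ℝ] V →L[ℝ] ℝ :=
  (1 / 2 : ℝ) • (D + D.flip
    - (ContinuousLinearMap.flipₗᵢ ℝ V V ℝ : (V →L[ℝ] V →L[ℝ] ℝ) →L[ℝ] _).comp D.flip)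

theorem koszul_apply (D : V →L[ℝ] V →L[ℝ] V →L[ℝ] ℝ) (v w z : V) :
    koszul D v w z = (1 / 2 : ℝ) * (D v w z + D w v z - D z v w) := rfl

/-- The Christoffel symbols of the metric `G` on the set `s`. -/
def chris (G : V → V →L[ℝ] V →L[ℝ] ℝ) (s : Set V) (y : V) : V →L[ℝ] V →L[ℝ] V :=
  (ContinuousLinearMap.compL ℝ V (V →L[ℝ] ℝ) V (G y).inverse).comp
    (koszul (fderivWithin ℝ G s y))

variable {G : V → V →L[ℝ] V →L[ℝ] ℝ} {s : Set V} {y : V}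

theorem chris_apply (v w : V) :
    chris G s y v w = (G y).inverse (koszul (fderivWithin ℝ G s y) v w) := rfl

/-- Koszul's formula. Symmetry of `G` is assumed near `y`, since it has to pass to the derivative of
`G`. -/
theorem isLeviCivitaAt_chris (hs : s ∈ 𝓝 y) (hG : DifferentiableAt ℝ G y)
    (hsymm : ∀ᶠ z in 𝓝 y, ∀ v w, G z v w = G z w v) (hpos : ∀ v, v ≠ 0 → 0 < G y v v) :
    IsLeviCivitaAt G (chris G s) y := by
  have hinv := isInvertible_of_pos hpos
  have hk : ∀ v w z, G y (chris G s y v w) z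
      = (1 / 2 : ℝ) * (fderiv ℝ G y v w z + fderiv ℝ G y w v z - fderiv ℝ G y z v w) := by
    intro v w z
    rw [chris_apply, hinv.self_apply_inverse, fderivWithin_of_mem_nhds hs, koszul_apply]
  have hD : ∀ a v w, fderiv ℝ G y a v w = fderiv ℝ G y a w v := by
    intro a v w
    have e1 := (hG.hasFDerivAt.clm_apply (hasFDerivAt_const v y)).clm_apply (hasFDerivAt_const w y)
    have e2 := (hG.hasFDerivAt.clm_apply (hasFDerivAt_const w y)).clm_apply (hasFDerivAt_const v y)
    have e4 := congrArg (fun T => T a)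
      (e1.unique (e2.congr_of_eventuallyEq (hsymm.mono fun z hz => hz v w)))
    simpa using e4
  refine ⟨hG, hsymm.self_of_nhds, hpos, fun v w => ?_, fun v w z => ?_⟩
  · rw [chris_apply, chris_apply]
    congr 1
    ext z
    rw [koszul_apply, koszul_apply, fderivWithin_of_mem_nhds hs, hD z v w]
    ring
  · rw [hsymm.self_of_nhds w, hk, hk, hD v z w, hD z v w, hD w v z]
    ring

/-- Stated within `s` so that it holds up to the boundary of the half-space, where the uniform
curvature bounds are needed. -/
theorem contDiffWithinAt_chris {k m : WithTop ℕ∞} (hG : ContDiffWithinAt ℝ k G s y)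
    (hs : UniqueDiffOn ℝ s) (hkm : m + 1 ≤ k) (hy : y ∈ s) (hpos : ∀ v, v ≠ 0 → 0 < G y v v) :
    ContDiffWithinAt ℝ m (chris G s) s y := by
  have h1 : ContDiffWithinAt ℝ m (fun z => (G z).inverse) s y :=
    (isInvertible_of_pos hpos).contDiffAt_map_inverse.comp_contDiffWithinAt y
      (hG.of_le (le_trans le_self_add hkm))
  have h2 : ContDiffWithinAt ℝ m (fderivWithin ℝ G s) s y := hG.fderivWithin_right hs hkm hy
  have hkos : ∃ L : (V →L[ℝ] V →L[ℝ] V →L[ℝ] ℝ) →L[ℝ] (V →L[ℝ] V →L[ℝ] V →L[ℝ] ℝ),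
      ∀ D, L D = koszul D := by
    refine ⟨LinearMap.toContinuousLinearMap
      { toFun := koszul
        map_add' := fun D D' => ?_
        map_smul' := fun c D => ?_ }, fun D => rfl⟩
    · ext v w z; simp only [koszul_apply, add_apply]; ring
    · ext v w z; simp only [koszul_apply, smul_apply, smul_eq_mul, RingHom.id_apply]; ring
  obtain ⟨L, hL⟩ := hkos
  have h3 : ContDiffWithinAt ℝ m (fun z => koszul (fderivWithin ℝ G s z)) s y := by
    simp only [← hL]
    exact L.contDiff.comp_contDiffWithinAt h2
  exact ((ContinuousLinearMap.compL ℝ V (V →L[ℝ] ℝ) V).contDiff.comp_contDiffWithinAt h1).clm_comp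
    h3

end Christoffel

end

end HessianEq

namespace HessianEq

noncomputable section

set_option linter.unusedSectionVars false
set_option maxSynthPendingDepth 3
set_option synthInstance.maxHeartbeats 400000
set_option maxHeartbeats 1000000

/-! ### Differentiation of the equation -/

/-- Approximate inverse square root of a Gram matrix close to the identity. -/
theorem exists_mul_mul_transpose_eq_one {n : ℕ} {M : Matrix (Fin n) (Fin n) ℝ}
    (hM : M.IsSymm) {ε : ℝ} (hε : ∀ i j, |M i j - (1 : Matrix (Fin n) (Fin n) ℝ) i j| ≤ ε)
    (hε1 : n ^ 2 * ε ≤ 1 / 2) :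
    ∃ R : Matrix (Fin n) (Fin n) ℝ, R * M * R.transpose = 1 ∧
      ∀ i j, |R i j - (1 : Matrix (Fin n) (Fin n) ℝ) i j| ≤ 2 * n ^ 3 * ε := by
  have hH : M.IsHermitian := by
    rw [Matrix.IsHermitian, Matrix.conjTranspose_eq_transpose_of_trivial]; exact hM
  obtain ⟨Q, μ, hQ, hMQ⟩ : ∃ Q : Matrix (Fin n) (Fin n) ℝ, ∃ μ : Fin n → ℝ,
      Q * Q.transpose = 1 ∧ M = Q * Matrix.diagonal μ * Q.transpose := by
    refine ⟨hH.eigenvectorUnitary, hH.eigenvalues, ?_, ?_⟩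
    · have := Matrix.mem_unitaryGroup_iff.1 hH.eigenvectorUnitary.2
      rwa [Matrix.star_eq_conjTranspose, Matrix.conjTranspose_eq_transpose_of_trivial] at this
    · have := hH.spectral_theorem
      rw [Unitary.conjStarAlgAut_apply, Matrix.star_eq_conjTranspose,
        Matrix.conjTranspose_eq_transpose_of_trivial] at this
      exact this
  have hQ' : Q.transpose * Q = 1 := mul_eq_one_comm.1 hQ
  have hQ1 : ∀ i k, |Q i k| ≤ 1 := by
    intro i k
    have h1 := congrFun (congrFun hQ i) i
    rw [Matrix.mul_apply, Matrix.one_apply_eq] at h1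
    have h2 : Q i k * Q.transpose k i ≤ ∑ j, Q i j * Q.transpose j i :=
      Finset.single_le_sum (f := fun j => Q i j * Q.transpose j i)
        (fun j _ => mul_self_nonneg (Q i j)) (Finset.mem_univ k)
    rw [h1, Matrix.transpose_apply, ← sq] at h2
    exact (sq_le_one_iff_abs_le_one _).1 h2
  have hμ : ∀ k, |μ k - 1| ≤ n ^ 2 * ε := by
    intro k
    have h1 : Matrix.diagonal μ - 1 = Q.transpose * (M - 1) * Q := by
      rw [mul_sub, sub_mul, mul_one, hQ', hMQ]
      calc _ = (Q.transpose * Q) * Matrix.diagonal μ * (Q.transpose * Q) - 1 := by rw [hQ']; simp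
        _ = _ := by simp only [mul_assoc]
    have h2 := congrFun (congrFun h1 k) k
    rw [Matrix.sub_apply, Matrix.diagonal_apply_eq, Matrix.one_apply_eq, Matrix.mul_apply] at h2
    rw [h2]
    calc _ ≤ ∑ j : Fin n, ∑ i : Fin n, ε := by
          refine (Finset.abs_sum_le_sum_abs _ _).trans (Finset.sum_le_sum fun j _ => ?_)
          rw [abs_mul, Matrix.mul_apply]
          refine (mul_le_of_le_one_right (abs_nonneg _) (hQ1 _ _)).trans ?_
          refine (Finset.abs_sum_le_sum_abs _ _).trans (Finset.sum_le_sum fun i _ => ?_)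
          rw [abs_mul]
          exact (mul_le_of_le_one_left (abs_nonneg _) (hQ1 _ _)).trans (hε _ _)
      _ = _ := by simp; ring
  have hs : ∀ k, |(Real.sqrt (μ k))⁻¹ - 1| ≤ 2 * (n ^ 2 * ε) ∧ 0 < μ k := by
    intro k
    have h1 := hμ k
    have h2 := abs_le.1 (h1.trans hε1)
    have h3 : 1 / 2 ≤ μ k := by linarith
    refine ⟨?_, by linarith⟩
    have h4 : 1 / 2 ≤ Real.sqrt (μ k) := Real.le_sqrt_of_sq_le (by norm_num; linarith)
    have h5 : (Real.sqrt (μ k))⁻¹ - 1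
        = (1 - μ k) * (Real.sqrt (μ k) * (1 + Real.sqrt (μ k)))⁻¹ := by
      have h6 : μ k = Real.sqrt (μ k) ^ 2 := (Real.sq_sqrt (by linarith)).symm
      have h7 : Real.sqrt (μ k) ≠ 0 := by positivity
      have h8 : 1 + Real.sqrt (μ k) ≠ 0 := by positivity
      nth_rw 2 [h6]
      field_simp
      ring
    rw [h5, abs_mul, abs_sub_comm, mul_comm]
    refine mul_le_mul ?_ h1 (abs_nonneg _) (by norm_num)
    rw [abs_of_pos (by positivity)]
    refine inv_le_of_inv_le₀ (by norm_num) ?_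
    nlinarith
  -- This is `M^(-1/2)`. The eigenvalues are within `n² ε ≤ 1/2` of `1`, so their inverse square
  -- roots are within `2 n² ε`; returning from the eigenbasis costs one more factor `n`.
  refine ⟨Q * Matrix.diagonal (fun k => (Real.sqrt (μ k))⁻¹) * Q.transpose, ?_, fun i j => ?_⟩
  · have hD : Matrix.diagonal (fun k => (Real.sqrt (μ k))⁻¹) * Matrix.diagonal μ
        * Matrix.diagonal (fun k => (Real.sqrt (μ k))⁻¹) = 1 := by
      rw [Matrix.diagonal_mul_diagonal, Matrix.diagonal_mul_diagonal, ← Matrix.diagonal_one]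
      congr 1
      ext k
      have h0 := (hs k).2
      have h7 : Real.sqrt (μ k) ≠ 0 := by positivity
      field_simp
      exact (Real.sq_sqrt h0.le).symm
    rw [Matrix.transpose_mul, Matrix.transpose_mul, Matrix.transpose_transpose,
      Matrix.diagonal_transpose]
    rw [hMQ]
    calc _ = Q * (Matrix.diagonal (fun k => (Real.sqrt (μ k))⁻¹) * (Q.transpose * Q)
          * Matrix.diagonal μ * (Q.transpose * Q)
        * Matrix.diagonal (fun k => (Real.sqrt (μ k))⁻¹)) * Q.transpose := by
          simp only [mul_assoc]
      _ = 1 := by rw [hQ', mul_one, mul_one, hD, mul_one, hQ]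
  · have h1 : Q * Matrix.diagonal (fun k => (Real.sqrt (μ k))⁻¹) * Q.transpose - 1
        = Q * Matrix.diagonal (fun k => (Real.sqrt (μ k))⁻¹ - 1) * Q.transpose := by
      have : Matrix.diagonal (fun k => (Real.sqrt (μ k))⁻¹ - 1)
        = Matrix.diagonal (fun k => (Real.sqrt (μ k))⁻¹) - 1 := by
          rw [← Matrix.diagonal_one, Matrix.diagonal_sub]
      rw [this, mul_sub, sub_mul, mul_one, hQ]
    rw [← Matrix.sub_apply, h1, Matrix.mul_apply]
    calc _ ≤ ∑ k : Fin n, 2 * (n ^ 2 * ε) := by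
          refine (Finset.abs_sum_le_sum_abs _ _).trans (Finset.sum_le_sum fun k _ => ?_)
          rw [abs_mul, Matrix.transpose_apply, Matrix.mul_diagonal, abs_mul]
          refine (mul_le_of_le_one_right (by positivity) (hQ1 _ _)).trans ?_
          exact (mul_le_of_le_one_left (abs_nonneg _) (hQ1 _ _)).trans (hs k).1
      _ = _ := by simp; ring

section Linearization

variable {n : ℕ} {V : Type*} [NormedAddCommGroup V] [NormedSpace ℝ V] [FiniteDimensional ℝ V]

/-- Almost orthonormal vectors are close to an orthonormal frame. -/
theorem exists_isFrame_of_almost {G B : V →L[ℝ] V →L[ℝ] ℝ} (hG : ∀ v w, G v w = G w v)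
    {E : Fin n → V} {ε C : ℝ} (hε : ∀ i j, |G (E i) (E j) - (if i = j then 1 else 0)| ≤ ε)
    (hε0 : 0 ≤ ε) (hε1 : n ^ 2 * ε ≤ 1 / 2) (hε2 : 2 * n ^ 3 * ε ≤ 1)
    (hC : ∀ i j, |B (E i) (E j)| ≤ C) :
    ∃ e : Fin n → V, IsFrame G e ∧
      ∀ i, |B (e i) (e i) - B (E i) (E i)| ≤ n ^ 2 * (3 * (2 * n ^ 3 * ε) * C) := by
  obtain ⟨M, hM⟩ : ∃ M : Matrix (Fin n) (Fin n) ℝ, ∀ i j, M i j = G (E i) (E j) :=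
    ⟨Matrix.of fun i j => G (E i) (E j), fun _ _ => rfl⟩
  obtain ⟨R, hR, hR1⟩ := exists_mul_mul_transpose_eq_one (M := M) (ε := ε)
    (by ext i j; rw [Matrix.transpose_apply, hM, hM, hG])
    (fun i j => by rw [hM, Matrix.one_apply]; exact hε i j) hε1
  have hexp : ∀ (B : V →L[ℝ] V →L[ℝ] ℝ) (i j), B (∑ k, R i k • E k) (∑ l, R j l • E l)
      = ∑ k, ∑ l, R i k * R j l * B (E k) (E l) := by
    intro B i j
    simp only [map_sum, map_smul, sum_apply, smul_apply, smul_eq_mul,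
      Finset.mul_sum]
    rw [Finset.sum_comm]
    exact Finset.sum_congr rfl fun k _ => Finset.sum_congr rfl fun l _ => by ring
  refine ⟨fun i => ∑ k, R i k • E k, fun i j => ?_, fun i => ?_⟩
  · have h1 := congrFun (congrFun hR i) j
    rw [Matrix.one_apply, mul_assoc, Matrix.mul_apply] at h1
    rw [← h1, hexp]
    refine Finset.sum_congr rfl fun k _ => ?_
    rw [Matrix.mul_apply, Finset.mul_sum]
    refine Finset.sum_congr rfl fun l _ => ?_
    rw [hM, Matrix.transpose_apply]; ring
  · obtain ⟨δ, hδ⟩ : ∃ δ, δ = 2 * n ^ 3 * ε := ⟨_, rfl⟩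
    rw [← hδ] at hε2 hR1 ⊢
    have hδ0 : 0 ≤ δ := by rw [hδ]; positivity
    have hone : B (E i) (E i) = ∑ k, ∑ l, (1 : Matrix (Fin n) (Fin n) ℝ) i k
        * (1 : Matrix (Fin n) (Fin n) ℝ) i l * B (E k) (E l) := by
      simp [Matrix.one_apply]
    have h1 : ∀ k, |(1 : Matrix (Fin n) (Fin n) ℝ) i k| ≤ 1 := by
      intro k; rw [Matrix.one_apply]; split_ifs <;> simp
    rw [hexp, hone, ← Finset.sum_sub_distrib]
    calc _ ≤ ∑ k : Fin n, ∑ l : Fin n, 3 * δ * C := by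
          refine (Finset.abs_sum_le_sum_abs _ _).trans (Finset.sum_le_sum fun k _ => ?_)
          rw [← Finset.sum_sub_distrib]
          refine (Finset.abs_sum_le_sum_abs _ _).trans (Finset.sum_le_sum fun l _ => ?_)
          rw [← sub_mul, abs_mul]
          refine mul_le_mul ?_ (hC k l) (abs_nonneg _) (by positivity)
          have h2 : R i k * R i l - (1 : Matrix (Fin n) (Fin n) ℝ) i k
              * (1 : Matrix (Fin n) (Fin n) ℝ) i l
              = (R i k - (1 : Matrix (Fin n) (Fin n) ℝ) i k)
                * (R i l - (1 : Matrix (Fin n) (Fin n) ℝ) i l)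
              + (R i k - (1 : Matrix (Fin n) (Fin n) ℝ) i k) * (1 : Matrix (Fin n) (Fin n) ℝ) i l
              + (1 : Matrix (Fin n) (Fin n) ℝ) i k
                * (R i l - (1 : Matrix (Fin n) (Fin n) ℝ) i l) := by ring
          rw [h2]
          have a1 : |(R i k - (1 : Matrix (Fin n) (Fin n) ℝ) i k)
                * (R i l - (1 : Matrix (Fin n) (Fin n) ℝ) i l)| ≤ δ := by
            rw [abs_mul]
            exact (mul_le_of_le_one_right (abs_nonneg _) ((hR1 i l).trans hε2)).trans (hR1 i k)
          have a2 : |(R i k - (1 : Matrix (Fin n) (Fin n) ℝ) i k)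
                * (1 : Matrix (Fin n) (Fin n) ℝ) i l| ≤ δ := by
            rw [abs_mul]
            exact (mul_le_of_le_one_right (abs_nonneg _) (h1 l)).trans (hR1 i k)
          have a3 : |(1 : Matrix (Fin n) (Fin n) ℝ) i k
                * (R i l - (1 : Matrix (Fin n) (Fin n) ℝ) i l)| ≤ δ := by
            rw [abs_mul]
            exact (mul_le_of_le_one_left (abs_nonneg _) (h1 k)).trans (hR1 i l)
          refine (abs_add_three _ _ _).trans ?_
          linarith
      _ = _ := by simp; ring

/-- A quantity that is `o(t)` stays so after taking absolute values; this makes the orthonormality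
error of a moving frame differentiable at `0`. -/
theorem hasDerivAt_abs_of_zero {h : ℝ → ℝ} (h0 : h 0 = 0) (hd : HasDerivAt h 0 0) :
    HasDerivAt (fun t => |h t|) 0 0 := by
  rw [hasDerivAt_iff_isLittleO] at hd ⊢
  simp only [h0, smul_zero, sub_zero, abs_zero] at hd ⊢
  exact hd.abs_left

variable {Γ : Set (Fin n → ℝ)} {f : (Fin n → ℝ) → ℝ} {G : V → V →L[ℝ] V →L[ℝ] ℝ}
  {Γc : V → V →L[ℝ] V →L[ℝ] V} {y : V}

/-- The covariant derivative of the equation `f (λ(U)) = ψ`. No differentiability of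
`U ↦ f (λ(U))` is needed. -/
theorem StructureConditions.sum_pder_mul_covDeriv (hf : StructureConditions Γ f)
    (hd : Module.finrank ℝ V = n) (hLC : IsLeviCivitaAt G Γc y)
    (hGs : ∀ᶠ z in 𝓝 y, ∀ v w, G z v w = G z w v)
    {U : V → V →L[ℝ] V →L[ℝ] ℝ} {U' : V →L[ℝ] V →L[ℝ] V →L[ℝ] ℝ} (hU : HasFDerivAt U U' y)
    {ψ : V → ℝ} {ψ' : V →L[ℝ] ℝ} (hψ : HasFDerivAt ψ ψ' y)
    {lam : Fin n → ℝ} (hl : lam ∈ Γ) {e : Fin n → V} (he : IsFrame (G y) e)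
    (hdiag : ∀ i j, U y (e i) (e j) = if i = j then lam i else 0) (hfl : f lam = ψ y)
    (heq : ∀ᶠ z in 𝓝 y, ∃ mu ∈ Γ, ∃ e' : Fin n → V, IsFrame (G z) e' ∧
      (∀ i j, U z (e' i) (e' j) = if i = j then mu i else 0) ∧ f mu = ψ z) (v : V) :
    ∑ i, pder f lam i * (U' v (e i) (e i) - U y (Γc y v (e i)) (e i)
      - U y (e i) (Γc y v (e i))) = ψ' v := by
  have hy : HasDerivAt (fun t : ℝ => y + t • v) v 0 := by
    simpa using ((hasDerivAt_id (0 : ℝ)).smul_const v).const_add y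
  -- First order parallel transport of the frame along `y + t v`; by metric compatibility it stays
  -- orthonormal up to `o(t)`.
  have hE : ∀ i, HasDerivAt (fun t : ℝ => e i - t • Γc y v (e i)) (-(Γc y v (e i))) 0 := by
    intro i
    simpa using ((hasDerivAt_id (0 : ℝ)).smul_const (Γc y v (e i))).const_sub (e i)
  have hy0 : y + (0 : ℝ) • v = y := by simp
  have hB : ∀ {B : V → V →L[ℝ] V →L[ℝ] ℝ} {B' : V →L[ℝ] V →L[ℝ] V →L[ℝ] ℝ},
      HasFDerivAt B B' y → ∀ i j, HasDerivAt
        (fun t : ℝ => B (y + t • v) (e i - t • Γc y v (e i)) (e j - t • Γc y v (e j)))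
        (B' v (e i) (e j) - B y (Γc y v (e i)) (e j) - B y (e i) (Γc y v (e j))) 0 := by
    intro B B' hB i j
    have h1 : HasDerivAt (fun t : ℝ => B (y + t • v)) (B' v) 0 :=
      HasFDerivAt.comp_hasDerivAt_of_eq (0 : ℝ) hB hy (by simp)
    have h2 := (h1.clm_apply (hE i)).clm_apply (hE j)
    refine h2.congr_deriv ?_
    simp
    ring
  -- `ε t` is the total deviation of the Gram matrix from the identity; it vanishes at `0` together
  -- with its derivative.
  obtain ⟨ε, hε⟩ : ∃ ε : ℝ → ℝ, ∀ t, ε t = ∑ i, ∑ j, |G (y + t • v) (e i - t • Γc y v (e i))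
      (e j - t • Γc y v (e j)) - (if i = j then 1 else 0)| := ⟨_, fun _ => rfl⟩
  have hεd : HasDerivAt ε 0 0 := by
    have h1 : ∀ i j, HasDerivAt (fun t : ℝ => |G (y + t • v) (e i - t • Γc y v (e i))
        (e j - t • Γc y v (e j)) - (if i = j then 1 else 0)|) 0 0 := by
      intro i j
      refine hasDerivAt_abs_of_zero ?_ ?_
      · simp [he i j]
      · refine ((hB hLC.diff.hasFDerivAt i j).sub_const _).congr_deriv ?_
        rw [hLC.compat]; ring
    have h2 := HasDerivAt.fun_sum (u := Finset.univ)
      fun i _ => HasDerivAt.fun_sum (u := Finset.univ) fun j _ => h1 i j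
    simp only [Finset.sum_const_zero] at h2
    exact h2.congr_of_eventuallyEq (Eventually.of_forall hε)
  have hε0 : ε 0 = 0 := by rw [hε]; simp [he _ _]
  have hεt : ∀ t i j, |G (y + t • v) (e i - t • Γc y v (e i))
      (e j - t • Γc y v (e j)) - (if i = j then 1 else 0)| ≤ ε t := by
    intro t i j
    rw [hε]
    refine le_trans ?_ (Finset.single_le_sum (f := fun i => ∑ j, |G (y + t • v)
      (e i - t • Γc y v (e i)) (e j - t • Γc y v (e j)) - (if i = j then 1 else 0)|)
      (fun i _ => Finset.sum_nonneg fun j _ => abs_nonneg _) (Finset.mem_univ i))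
    exact Finset.single_le_sum (f := fun j => |G (y + t • v)
      (e i - t • Γc y v (e i)) (e j - t • Γc y v (e j)) - (if i = j then 1 else 0)|)
      (fun j _ => abs_nonneg _) (Finset.mem_univ j)
  have hεp : ∀ t, 0 ≤ ε t := fun t => by
    rw [hε]; exact Finset.sum_nonneg fun i _ => Finset.sum_nonneg fun j _ => abs_nonneg _
  obtain ⟨C, hC⟩ : ∃ C : ℝ, C = 1 + ∑ i, ∑ j, |U y (e i) (e j)| := ⟨_, rfl⟩
  have hCe : ∀ᶠ t in 𝓝 (0 : ℝ), ∀ i j, |U (y + t • v) (e i - t • Γc y v (e i))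
      (e j - t • Γc y v (e j))| ≤ C := by
    rw [eventually_all]; intro i
    rw [eventually_all]; intro j
    have h1 := (hB hU i j).continuousAt.abs
    refine (h1.eventually_lt continuousAt_const ?_).mono fun t ht => le_of_lt ht
    simp only [zero_smul, add_zero, sub_zero]
    rw [hC]
    have a1 := Finset.single_le_sum (f := fun i => ∑ j, |U y (e i) (e j)|)
      (fun i _ => Finset.sum_nonneg fun j _ => abs_nonneg _) (Finset.mem_univ i)
    have a2 := Finset.single_le_sum (f := fun j => |U y (e i) (e j)|)
      (fun j _ => abs_nonneg _) (Finset.mem_univ j)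
    linarith
  have hsmall : ∀ c : ℝ, ∀ δ > 0, ∀ᶠ t in 𝓝 (0 : ℝ), c * ε t ≤ δ := by
    intro c δ hδ
    have h1 : ContinuousAt (fun t => c * ε t) 0 := hεd.continuousAt.const_mul c
    refine (h1.eventually_lt continuousAt_const ?_).mono fun t ht => le_of_lt ht
    simpa [hε0] using hδ
  have hyt : Tendsto (fun t : ℝ => y + t • v) (𝓝 0) (𝓝 y) := by
    simpa using hy.continuousAt.tendsto
  obtain ⟨c, hc⟩ : ∃ c : ℝ, ∀ t : ℝ, n ^ 2 * (3 * (2 * n ^ 3 * ε t) * C) = c * ε t :=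
    ⟨n ^ 2 * (3 * (2 * n ^ 3) * C), fun t => by ring⟩
  -- Touching argument: concavity bounds `ψ(y + t v)` by the linear expression in an exactly
  -- orthonormal frame, hence by the one in the transported frame plus a multiple of `ε t`. The
  -- difference is nonnegative near `0` and vanishes at `0`, so its derivative is zero; `ε` does not
  -- contribute.
  have hΘ := (((HasDerivAt.fun_sum (u := Finset.univ) fun i _ =>
    (((hB hU i i).add (hεd.const_mul c)).sub_const (lam i)).const_mul (pder f lam i)).const_add
      (f lam)).sub (HasFDerivAt.comp_hasDerivAt_of_eq (0 : ℝ) hψ hy (by simp)))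
  have hmin := IsLocalMin.hasDerivAt_eq_zero ?_ hΘ
  · simp only [mul_zero, add_zero] at hmin
    linarith
  · have hn : (0:ℝ) ≤ n := Nat.cast_nonneg n
    filter_upwards [hCe, hsmall (n ^ 2) (1 / 2) (by norm_num), hsmall (2 * n ^ 3) 1 one_pos,
      hyt.eventually hGs, hyt.eventually heq] with t h1 h2 h3 h4 ⟨mu, hmu, e', he', hdg, hfm⟩
    obtain ⟨e'', hf'', hb⟩ := exists_isFrame_of_almost h4 (hεt t) (hεp t) h2 h3 h1
    have h5 := hf.le_add_sum_diag h4 hd hl hmu hf'' he' hdg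
    have h6 : f lam + ∑ i, pder f lam i * (U (y + t • v) (e'' i) (e'' i) - lam i)
        ≤ f lam + ∑ i, pder f lam i * (U (y + t • v) (e i - t • Γc y v (e i))
          (e i - t • Γc y v (e i)) + c * ε t - lam i) := by
      refine add_le_add le_rfl (Finset.sum_le_sum fun i _ =>
        mul_le_mul_of_nonneg_left ?_ (hf.pder_pos hl i).le)
      have := (abs_le.1 (hb i)).2
      rw [hc] at this
      linarith
    simp only [Pi.sub_apply, Function.comp_apply, Pi.add_apply, zero_smul, add_zero, sub_zero, hε0,
      mul_zero, hdiag, if_true, sub_self, Finset.sum_const_zero, hfl]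
    rw [hfm, hfl] at h5
    rw [hfl] at h6
    linarith

end Linearization

end

end HessianEq

namespace HessianEq

noncomputable section

set_option linter.unusedSectionVars false
set_option maxSynthPendingDepth 3
set_option synthInstance.maxHeartbeats 400000
set_option maxHeartbeats 1000000

/-! ### The differential inequality at an interior maximum, in coordinates -/

section Maximum

variable {n : ℕ} {V : Type*} [NormedAddCommGroup V] [NormedSpace ℝ V] [FiniteDimensional ℝ V]

/-- The second derivative test: necessary condition. -/
theorem fderiv_fderiv_nonpos_of_isLocalMax {h : V → ℝ} {y : V} (hm : IsLocalMax h y)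
    (h1 : ∀ᶠ z in 𝓝 y, DifferentiableAt ℝ h z) (h2 : DifferentiableAt ℝ (fderiv ℝ h) y) (e : V) :
    fderiv ℝ (fderiv ℝ h) y e e ≤ 0 := by
  by_contra! hpos
  obtain ⟨k, hk⟩ : ∃ k : ℝ → ℝ, ∀ t, k t = h (y + t • e) := ⟨_, fun _ => rfl⟩
  have hy : ∀ t : ℝ, HasDerivAt (fun t : ℝ => y + t • e) e t := by
    intro t
    simpa using ((hasDerivAt_id t).smul_const e).const_add y
  have hyt : Tendsto (fun t : ℝ => y + t • e) (𝓝 0) (𝓝 y) := by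
    simpa using (hy 0).continuousAt.tendsto
  have hk1 : ∀ᶠ t in 𝓝 (0 : ℝ), HasDerivAt k (fderiv ℝ h (y + t • e) e) t := by
    filter_upwards [hyt.eventually h1] with t ht
    refine (HasFDerivAt.comp_hasDerivAt t ht.hasFDerivAt (hy t)).congr_of_eventuallyEq
      (Eventually.of_forall hk)
  have hk2 : HasDerivAt (deriv k) (fderiv ℝ (fderiv ℝ h) y e e) 0 := by
    have e1 : HasDerivAt (fun t : ℝ => fderiv ℝ h (y + t • e)) (fderiv ℝ (fderiv ℝ h) y e) 0 :=
      HasFDerivAt.comp_hasDerivAt_of_eq (0 : ℝ) h2.hasFDerivAt (hy 0) (by simp)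
    have e2 := e1.clm_apply (hasDerivAt_const (0 : ℝ) e)
    simp only [map_zero, add_zero] at e2
    exact e2.congr_of_eventuallyEq (hk1.mono fun t ht => ht.deriv)
  have hkmax : IsLocalMax k 0 := by
    filter_upwards [hyt.eventually hm] with t ht
    rw [hk, hk]; simpa using ht
  have hk0 : deriv k 0 = 0 := hkmax.deriv_eq_zero
  -- A positive second derivative makes `0` a local minimum as well as a maximum, so `k` is locally
  -- constant, which contradicts the positivity.
  have hkmin : IsLocalMin k 0 :=
    isLocalMin_of_deriv_deriv_pos (by rw [hk2.deriv]; exact hpos) hk0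
      hk1.self_of_nhds.continuousAt
  have hc : k =ᶠ[𝓝 0] fun _ => k 0 := by
    filter_upwards [hkmax, hkmin] with t a b using le_antisymm a b
  have e3 : deriv k =ᶠ[𝓝 0] fun _ => 0 := hc.deriv.trans (Eventually.of_forall fun t => by simp)
  have e4 := hk2.unique ((hasDerivAt_const (0 : ℝ) (0 : ℝ)).congr_of_eventuallyEq e3)
  exact hpos.ne' e4

variable {Γ : Set (Fin n → ℝ)} {f : (Fin n → ℝ) → ℝ} {G : V → V →L[ℝ] V →L[ℝ] ℝ}
  {Γc : V → V →L[ℝ] V →L[ℝ] V} {y : V} {u : V → ℝ} {m : ℝ}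

/-- The first order condition at a maximum of `|∇u|² / 2 - m u`. -/
theorem hessLoc_gradLoc_of_isLocalMax (hG : ∀ᶠ z in 𝓝 y, IsLeviCivitaAt G Γc z)
    (hu : ContDiffAt ℝ 3 u y) (hmax : IsLocalMax (fun z => energyLoc G u z - m * u z) y) (w : V) :
    hessLoc Γc u y (gradLoc G u y) w = m * G y (gradLoc G u y) w := by
  have h := hG.self_of_nhds
  have hu2 : ContDiffAt ℝ 2 u y := hu.of_le (by norm_num)
  have e1 := hmax.hasFDerivAt_eq_zero ((h.hasFDerivAt_energyLoc hG hu2).sub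
    ((hu.differentiableAt (by norm_num)).hasFDerivAt.const_mul m))
  have e2 := congrArg (fun T => T w) e1
  simp only [sub_apply, smul_apply, smul_eq_mul, zero_apply] at e2
  rw [h.gradLoc_apply]
  linarith

/-- The second order condition at a maximum of `|∇u|² / 2 - m u`, combined with the derivative
of the equation. -/
theorem StructureConditions.sum_le_of_isLocalMax (hf : StructureConditions Γ f)
    (hd : Module.finrank ℝ V = n) (hG : ∀ᶠ z in 𝓝 y, IsLeviCivitaAt G Γc z)
    (hΓ : DifferentiableAt ℝ Γc y) (hu : ContDiffAt ℝ 3 u y)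
    (hmax : IsLocalMax (fun z => energyLoc G u z - m * u z) y)
    {A : V × ℝ × V → V →L[ℝ] V →L[ℝ] ℝ} {A' : V × ℝ × V →L[ℝ] V →L[ℝ] V →L[ℝ] ℝ}
    (hA : HasFDerivAt A A' (y, u y, gradLoc G u y))
    (hAs : ∀ v w, A (y, u y, gradLoc G u y) v w = A (y, u y, gradLoc G u y) w v)
    {ψ : V × ℝ × V → ℝ} {ψ' : V × ℝ × V →L[ℝ] ℝ}
    (hψ : HasFDerivAt ψ ψ' (y, u y, gradLoc G u y))
    {lam : Fin n → ℝ} (hl : lam ∈ Γ) {e : Fin n → V} (he : IsFrame (G y) e)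
    (hdiag : ∀ i j, hessLoc Γc u y (e i) (e j) + A (y, u y, gradLoc G u y) (e i) (e j)
      = if i = j then lam i else 0) (hfl : f lam = ψ (y, u y, gradLoc G u y))
    (heq : ∀ᶠ z in 𝓝 y, ∃ mu ∈ Γ, ∃ e' : Fin n → V, IsFrame (G z) e' ∧
      (∀ i j, hessLoc Γc u z (e' i) (e' j) + A (z, u z, gradLoc G u z) (e' i) (e' j)
        = if i = j then mu i else 0) ∧ f mu = ψ (z, u z, gradLoc G u z)) :
    let p := gradLoc G u y
    ∑ i, pder f lam i * ∑ k, hessLoc Γc u y (e i) (e k) ^ 2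
      + m * ((∑ i, pder f lam i * (-hessLoc Γc u y (e i) (e i) - A' (0, 0, p) (e i) (e i)))
        + ψ' (0, 0, p))
      ≤ ∑ i, pder f lam i * ((A' (p, 0, -Γc y p p) (e i) (e i)
          - 2 * A (y, u y, p) (Γc y p (e i)) (e i)
          + G y p p * A' (0, 1, 0) (e i) (e i)) - G y p (curvLoc Γc y p (e i)))
        - (ψ' (p, 0, -Γc y p p) + G y p p * ψ' (0, 1, 0)) := by
  intro p
  have h := hG.self_of_nhds
  have hu2 : ContDiffAt ℝ 2 u y := hu.of_le (by norm_num)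
  have hX := (h.differentiableAt_gradLoc hu2).hasFDerivAt
  have hdu := (hu.differentiableAt (by norm_num)).hasFDerivAt
  obtain ⟨S', hS, -⟩ := hasFDerivAt_hessLoc hΓ hu
  have hH := hessLoc_gradLoc_of_isLocalMax hG hu hmax
  -- the covariant derivative of the gradient along the gradient
  have hXp : fderiv ℝ (gradLoc G u) y p = m • p - Γc y p p := by
    rw [eq_sub_iff_add_eq]
    have hinj : Function.Injective (G y) := by
      obtain ⟨L, hL⟩ := h.invertible
      rw [← hL]; exact L.injective
    apply hinj
    ext w
    rw [h.covDeriv_gradLoc hG hu2, hH]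
    simp [p]
  have hdup : fderiv ℝ u y p = G y p p := (h.gradLoc_apply p).symm
  have htriple : HasFDerivAt (fun z => (z, u z, gradLoc G u z))
      ((ContinuousLinearMap.id ℝ V).prod ((fderiv ℝ u y).prod (fderiv ℝ (gradLoc G u) y))) y :=
    (hasFDerivAt_id y).prodMk (hdu.prodMk hX)
  -- The derivative of `(x, u, ∇u)` along `p` splits into the horizontal direction `(p, 0, -Γ(p,
  -- p))`, the `z` direction with factor `|p|²`, and the fibre direction `m p`. The first two
  -- produce the left sides of the growth conditions.
  have hsplit : ((p, fderiv ℝ u y p, fderiv ℝ (gradLoc G u) y p) : V × ℝ × V)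
      = (p, 0, -Γc y p p) + G y p p • ((0, 1, 0) : V × ℝ × V) + m • ((0, 0, p) : V × ℝ × V) := by
    rw [hXp, hdup]
    simp
    abel
  have hU := hS.add (hA.comp y htriple)
  have hlin := hf.sum_pder_mul_covDeriv hd h (hG.mono fun z hz => hz.symm) hU
    (hψ.comp y htriple) hl he hdiag hfl heq p
  have hrhs : (ψ'.comp ((ContinuousLinearMap.id ℝ V).prod
      ((fderiv ℝ u y).prod (fderiv ℝ (gradLoc G u) y)))) p
      = ψ' (p, 0, -Γc y p p) + G y p p * ψ' (0, 1, 0) + m * ψ' (0, 0, p) := by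
    change ψ' (p, fderiv ℝ u y p, fderiv ℝ (gradLoc G u) y p) = _
    rw [hsplit, map_add, map_add, map_smul, map_smul, smul_eq_mul, smul_eq_mul]
  rw [hrhs] at hlin
  -- second order condition
  have hE1 : ∀ᶠ z in 𝓝 y, HasFDerivAt (fun z => energyLoc G u z - m * u z)
      (hessLoc Γc u z (gradLoc G u z) - m • fderiv ℝ u z) z := by
    have : ∀ᶠ z in 𝓝 y, ContDiffAt ℝ 2 u z := hu2.eventually (by simp)
    filter_upwards [hG.eventually_nhds, this] with z hz hz2
    exact (hz.self_of_nhds.hasFDerivAt_energyLoc hz hz2).sub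
      ((hz2.differentiableAt (by norm_num)).hasFDerivAt.const_mul m)
  have hE0 : ∀ᶠ z in 𝓝 y, fderiv ℝ (energyLoc G u) z = hessLoc Γc u z (gradLoc G u z) := by
    have : ∀ᶠ z in 𝓝 y, ContDiffAt ℝ 2 u z := hu2.eventually (by simp)
    filter_upwards [hG.eventually_nhds, this] with z hz hz2
    exact (hz.self_of_nhds.hasFDerivAt_energyLoc hz hz2).fderiv
  have d2u := ((hu2.fderiv_right (m := 1) (by norm_num)).differentiableAt
      one_ne_zero).hasFDerivAt
  have hEE := (hS.clm_apply hX).congr_of_eventuallyEq hE0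
  have hE2 := ((hS.clm_apply hX).sub (d2u.const_smul m)).congr_of_eventuallyEq
    (hE1.mono fun z hz => hz.fderiv)
  have hsecond : ∀ i, G y (fderiv ℝ (gradLoc G u) y (e i) + Γc y (e i) p)
        (fderiv ℝ (gradLoc G u) y (e i) + Γc y (e i) p)
      + (S' p (e i) (e i) - 2 * hessLoc Γc u y (Γc y p (e i)) (e i))
      + G y p (curvLoc Γc y p (e i)) ≤ m * hessLoc Γc u y (e i) (e i) := by
    intro i
    have b := bochner hG hΓ hu hS (e i)
    have s := fderiv_fderiv_nonpos_of_isLocalMax hmax (hE1.mono fun z hz => hz.differentiableAt)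
      hE2.differentiableAt (e i)
    rw [hE2.fderiv] at s
    simp only [sub_apply, smul_apply, smul_eq_mul] at s
    simp only at b
    rw [← b, hEE.fderiv, hE0.self_of_nhds, hH, h.gradLoc_apply,
      hessLoc_apply (e i) (e i)]
    linarith
  have hZ : ∀ i, G y (fderiv ℝ (gradLoc G u) y (e i) + Γc y (e i) p)
        (fderiv ℝ (gradLoc G u) y (e i) + Γc y (e i) p)
      = ∑ k, hessLoc Γc u y (e i) (e k) ^ 2 := by
    intro i
    rw [he.parseval hd]
    refine Finset.sum_congr rfl fun k _ => ?_
    rw [h.covDeriv_gradLoc hG hu2, sq]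
  have hterm : ∀ i, (S' + A'.comp ((ContinuousLinearMap.id ℝ V).prod
        ((fderiv ℝ u y).prod (fderiv ℝ (gradLoc G u) y)))) p (e i) (e i)
      = S' p (e i) (e i) + (A' (p, 0, -Γc y p p) (e i) (e i)
        + G y p p * A' (0, 1, 0) (e i) (e i) + m * A' (0, 0, p) (e i) (e i)) := by
    intro i
    change S' p (e i) (e i) + A' (p, fderiv ℝ u y p, fderiv ℝ (gradLoc G u) y p) (e i) (e i) = _
    rw [hsplit, map_add, map_add, map_smul, map_smul]
    rfl
  have hUy : ∀ v w, (hessLoc Γc u + A ∘ fun z => (z, u z, gradLoc G u z)) y v w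
      = hessLoc Γc u y v w + A (y, u y, p) v w := fun v w => rfl
  simp only [hterm, hUy] at hlin
  have hsum := Finset.sum_le_sum fun i (_ : i ∈ Finset.univ) =>
    mul_le_mul_of_nonneg_left (hsecond i) (hf.pder_pos hl i).le
  -- Weighting the second order conditions by `f_i` and subtracting the differentiated equation
  -- removes `S'`, the only term with third derivatives of `u`.
  have key : ∑ i, pder f lam i * ∑ k, hessLoc Γc u y (e i) (e k) ^ 2
      + m * (∑ i, pder f lam i * (-hessLoc Γc u y (e i) (e i) - A' (0, 0, p) (e i) (e i)))
      - ∑ i, pder f lam i * ((A' (p, 0, -Γc y p p) (e i) (e i)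
          - 2 * A (y, u y, p) (Γc y p (e i)) (e i)
          + G y p p * A' (0, 1, 0) (e i) (e i)) - G y p (curvLoc Γc y p (e i)))
      = (∑ i, pder f lam i * (G y (fderiv ℝ (gradLoc G u) y (e i) + Γc y (e i) p)
        (fderiv ℝ (gradLoc G u) y (e i) + Γc y (e i) p)
      + (S' p (e i) (e i) - 2 * hessLoc Γc u y (Γc y p (e i)) (e i))
      + G y p (curvLoc Γc y p (e i)))) - (∑ i, pder f lam i * (m * hessLoc Γc u y (e i) (e i)))
      - (∑ i, pder f lam i * (S' p (e i) (e i) + (A' (p, 0, -Γc y p p) (e i) (e i)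
        + G y p p * A' (0, 1, 0) (e i) (e i) + m * A' (0, 0, p) (e i) (e i))
        - (hessLoc Γc u y (Γc y p (e i)) (e i) + A (y, u y, p) (Γc y p (e i)) (e i))
        - (hessLoc Γc u y (e i) (Γc y p (e i)) + A (y, u y, p) (e i) (Γc y p (e i))))) := by
    rw [Finset.mul_sum, ← Finset.sum_add_distrib, ← Finset.sum_sub_distrib,
      ← Finset.sum_sub_distrib, ← Finset.sum_sub_distrib]
    refine Finset.sum_congr rfl fun i _ => ?_
    rw [hZ i, hAs (e i) (Γc y p (e i)), h.hessLoc_symm hu2 (e i) (Γc y p (e i))]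
    ring
  rw [hlin] at key
  linarith

end Maximum

end

end HessianEq

namespace HessianEq

noncomputable section

set_option linter.unusedSectionVars false
set_option maxSynthPendingDepth 3
set_option synthInstance.maxHeartbeats 400000
set_option maxHeartbeats 1000000

/-! ### Smoothness of the coordinate expressions -/

section Coordinates

variable {n : ℕ} [NeZero n] {M : Type*} [TopologicalSpace M]
  [ChartedSpace (EuclideanHalfSpace n) M] [IsManifold (𝓡∂ n) ∞ M]

/-- Links coordinate vector fields to the trivialisations of the tangent bundle, through which
smoothness of `g`, `A` and `ψ` is expressed. -/
theorem coordVec_eq_symmL (c : M) {y : EuclideanSpace ℝ (Fin n)}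
    (hy : y ∈ (extChartAt (𝓡∂ n) c).target) (v : EuclideanSpace ℝ (Fin n)) :
    coordVec n c y v = (trivializationAt (EuclideanSpace ℝ (Fin n))
      (TangentSpace (𝓡∂ n)) c).symmL ℝ ((extChartAt (𝓡∂ n) c).symm y) v := by
  have h1 : (extChartAt (𝓡∂ n) c).symm y ∈ (chartAt (EuclideanHalfSpace n) c).source := by
    rw [← extChartAt_source (I := 𝓡∂ n)]; exact (extChartAt (𝓡∂ n) c).map_target hy
  rw [TangentBundle.symmL_trivializationAt h1, (extChartAt (𝓡∂ n) c).right_inv hy]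
  rfl

/-- The common source of smoothness of `gLoc`, `formLoc` and `funLoc`: each is a smooth bundle
object evaluated on such sections. -/
theorem contMDiffOn_mk_coordVec (c : M) {F : Type*} [NormedAddCommGroup F] [NormedSpace ℝ F]
    {s : Set F} {b v : F → EuclideanSpace ℝ (Fin n)} {k : WithTop ℕ∞} (hk : k ≤ ∞)
    (hb : ContDiffOn ℝ k b s) (hv : ContDiffOn ℝ k v s)
    (hs : MapsTo b s (extChartAt (𝓡∂ n) c).target) :
    ContMDiffOn 𝓘(ℝ, F) ((𝓡∂ n).prod 𝓘(ℝ, EuclideanSpace ℝ (Fin n))) k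
      (fun q => TotalSpace.mk' (EuclideanSpace ℝ (Fin n)) (E := fun x : M => TangentSpace (𝓡∂ n) x)
        ((extChartAt (𝓡∂ n) c).symm (b q)) (coordVec n c (b q) (v q))) s := by
  have h1 : ContMDiffOn 𝓘(ℝ, F) (𝓡∂ n) k (fun q => (extChartAt (𝓡∂ n) c).symm (b q)) s :=
    ((contMDiffOn_extChartAt_symm (n := ∞) c).of_le hk).comp hb.contMDiffOn hs
  have h2 : ∀ q ∈ s, (extChartAt (𝓡∂ n) c).symm (b q) ∈ (trivializationAt
      (EuclideanSpace ℝ (Fin n)) (TangentSpace (𝓡∂ n)) c).baseSet := by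
    intro q hq
    rw [TangentBundle.trivializationAt_baseSet, ← extChartAt_source (I := 𝓡∂ n)]
    exact (extChartAt (𝓡∂ n) c).map_target (hs hq)
  have h3 := ((trivializationAt (EuclideanSpace ℝ (Fin n))
    (TangentSpace (𝓡∂ n)) c).contMDiffOn_symm (IB := 𝓡∂ n) (n := ∞)).of_le hk
  refine (h3.comp (h1.prodMk hv.contMDiffOn) fun q hq => ?_).congr fun q hq => ?_
  · rw [mem_preimage, Trivialization.mem_target]; exact h2 q hq
  · rw [coordVec_eq_symmL c (hs hq), Trivialization.symmL_apply]
    · exact Trivialization.mk_symm _ (h2 q hq) _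
    · exact h2 q hq

/-- A bilinear form depending on `(x, z, p)`, in the chart at `c`. -/
def formLoc (A : GradForm n M) (c : M)
    (q : EuclideanSpace ℝ (Fin n) × ℝ × EuclideanSpace ℝ (Fin n)) :
    EuclideanSpace ℝ (Fin n) →L[ℝ] EuclideanSpace ℝ (Fin n) →L[ℝ] ℝ :=
  pullForm n c q.1 (A ((extChartAt (𝓡∂ n) c).symm q.1) q.2.1 (coordVec n c q.1 q.2.2))

/-- A function depending on `(x, z, p)`, in the chart at `c`. -/
def funLoc (ψ : GradFun n M) (c : M)
    (q : EuclideanSpace ℝ (Fin n) × ℝ × EuclideanSpace ℝ (Fin n)) : ℝ :=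
  ψ ((extChartAt (𝓡∂ n) c).symm q.1) q.2.1 (coordVec n c q.1 q.2.2)

theorem gLoc_apply (g : Metric n M) (c : M) (y v w : EuclideanSpace ℝ (Fin n)) :
    gLoc g c y v w = g.inner ((extChartAt (𝓡∂ n) c).symm y) (coordVec n c y v)
      (coordVec n c y w) := rfl

theorem formLoc_apply (A : GradForm n M) (c : M)
    (q : EuclideanSpace ℝ (Fin n) × ℝ × EuclideanSpace ℝ (Fin n))
    (v w : EuclideanSpace ℝ (Fin n)) :
    formLoc A c q v w = A ((extChartAt (𝓡∂ n) c).symm q.1) q.2.1 (coordVec n c q.1 q.2.2)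
      (coordVec n c q.1 v) (coordVec n c q.1 w) := rfl

theorem contDiffOn_bilin {F E : Type*} [NormedAddCommGroup F] [NormedSpace ℝ F]
    [NormedAddCommGroup E] [NormedSpace ℝ E] [FiniteDimensional ℝ E] {s : Set F}
    {B : F → E →L[ℝ] E →L[ℝ] ℝ} {k : WithTop ℕ∞}
    (h : ∀ v w, ContDiffOn ℝ k (fun q => B q v w) s) : ContDiffOn ℝ k B s :=
  contDiffOn_clm_apply.2 fun v => contDiffOn_clm_apply.2 fun w => h v w

theorem contDiffOn_gLoc (g : Metric n M) (c : M) :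
    ContDiffOn ℝ ∞ (gLoc g c) (extChartAt (𝓡∂ n) c).target := by
  refine contDiffOn_bilin fun v w => ?_
  rw [← contMDiffOn_iff_contDiffOn]
  have hb : ContDiffOn ℝ ∞ (fun q : EuclideanSpace ℝ (Fin n) => q) (extChartAt (𝓡∂ n) c).target :=
    contDiffOn_id
  have h1 := g.contMDiff.comp_contMDiffOn
    (contMDiffOn_extChartAt_symm (I := 𝓡∂ n) (n := ∞) c)
  have h2 := fun v => contMDiffOn_mk_coordVec c (b := fun q => q) (v := fun _ => v) le_rfl hb
    contDiffOn_const (fun q hq => hq)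
  have h3 := ContMDiffOn.clm_bundle_apply₂ (F₁ := EuclideanSpace ℝ (Fin n))
    (F₂ := EuclideanSpace ℝ (Fin n)) (F₃ := ℝ) (E₃ := Bundle.Trivial M ℝ) h1 (h2 v) (h2 w)
  intro y hy
  exact (Bundle.contMDiffWithinAt_totalSpace.1 (h3 y hy)).2

theorem contDiffOn_funLoc {ψ : GradFun n M} (hψ : SmoothFun ψ) (c : M) :
    ContDiffOn ℝ ∞ (funLoc ψ c) ((extChartAt (𝓡∂ n) c).target ×ˢ univ) := by
  rw [← contMDiffOn_iff_contDiffOn]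
  have h1 := contMDiffOn_mk_coordVec c
    (s := (extChartAt (𝓡∂ n) c).target ×ˢ (univ : Set (ℝ × EuclideanSpace ℝ (Fin n))))
    (b := fun q => q.1) (v := fun q => q.2.2) le_rfl
    contDiff_fst.contDiffOn (contDiff_snd.comp contDiff_snd).contDiffOn (fun q hq => hq.1)
  have h2 : ContMDiffOn 𝓘(ℝ, EuclideanSpace ℝ (Fin n) × ℝ × EuclideanSpace ℝ (Fin n)) 𝓘(ℝ, ℝ) ∞
      (fun q : EuclideanSpace ℝ (Fin n) × ℝ × EuclideanSpace ℝ (Fin n) => q.2.1)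
      ((extChartAt (𝓡∂ n) c).target ×ˢ (univ : Set (ℝ × EuclideanSpace ℝ (Fin n)))) :=
    (contDiff_fst.comp contDiff_snd).contDiffOn.contMDiffOn
  exact ContMDiff.comp_contMDiffOn hψ (h1.prodMk h2)

theorem contDiffOn_formLoc {A : GradForm n M} (hA : SmoothForm A) (c : M) :
    ContDiffOn ℝ ∞ (formLoc A c) ((extChartAt (𝓡∂ n) c).target ×ˢ univ) := by
  refine contDiffOn_bilin fun v w => ?_
  rw [← contMDiffOn_iff_contDiffOn]
  have h1 := fun v : EuclideanSpace ℝ (Fin n) × ℝ × EuclideanSpace ℝ (Fin n) →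
      EuclideanSpace ℝ (Fin n) => fun hv => contMDiffOn_mk_coordVec c
    (s := (extChartAt (𝓡∂ n) c).target ×ˢ (univ : Set (ℝ × EuclideanSpace ℝ (Fin n))))
    (b := fun q => q.1) (v := v) le_rfl contDiff_fst.contDiffOn hv (fun q hq => hq.1)
  have h2 : ContMDiffOn 𝓘(ℝ, EuclideanSpace ℝ (Fin n) × ℝ × EuclideanSpace ℝ (Fin n)) 𝓘(ℝ, ℝ) ∞
      (fun q : EuclideanSpace ℝ (Fin n) × ℝ × EuclideanSpace ℝ (Fin n) => q.2.1)
      ((extChartAt (𝓡∂ n) c).target ×ˢ (univ : Set (ℝ × EuclideanSpace ℝ (Fin n)))) :=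
    (contDiff_fst.comp contDiff_snd).contDiffOn.contMDiffOn
  have h3 := ContMDiff.comp_contMDiffOn hA
    ((h1 (fun q => q.2.2) (contDiff_snd.comp contDiff_snd).contDiffOn).prodMk h2)
  have h4 := ContMDiffOn.clm_bundle_apply₂ (F₁ := EuclideanSpace ℝ (Fin n))
    (F₂ := EuclideanSpace ℝ (Fin n)) (F₃ := ℝ) (E₃ := Bundle.Trivial M ℝ) h3
    (h1 (fun _ => v) contDiffOn_const) (h1 (fun _ => w) contDiffOn_const)
  intro y hy
  exact (Bundle.contMDiffWithinAt_totalSpace.1 (h4 y hy)).2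

theorem coordVec_bijective (c : M) {y : EuclideanSpace ℝ (Fin n)}
    (hy : y ∈ (extChartAt (𝓡∂ n) c).target) : Function.Bijective (coordVec n c y) := by
  obtain ⟨L, hL⟩ := isInvertible_mfderivWithin_extChartAt_symm (I := 𝓡∂ n) hy
  unfold coordVec
  rw [← hL]
  exact L.bijective

theorem coordVec_self (x : M) (v : EuclideanSpace ℝ (Fin n)) :
    (show EuclideanSpace ℝ (Fin n) from coordVec n x (extChartAt (𝓡∂ n) x x) v) = v := by
  have := mfderivWithin_range_extChartAt_symm (I := 𝓡∂ n) (x := x)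
  exact congrArg (fun T : EuclideanSpace ℝ (Fin n) →L[ℝ] EuclideanSpace ℝ (Fin n) => T v) this

theorem gLoc_symm (g : Metric n M) (c : M) (y v w : EuclideanSpace ℝ (Fin n)) :
    gLoc g c y v w = gLoc g c y w v := g.symm _ _ _

theorem gLoc_pos (g : Metric n M) (c : M) {y : EuclideanSpace ℝ (Fin n)}
    (hy : y ∈ (extChartAt (𝓡∂ n) c).target) (v : EuclideanSpace ℝ (Fin n)) (hv : v ≠ 0) :
    0 < gLoc g c y v v := by
  refine g.pos _ _ fun h => hv ?_
  exact (coordVec_bijective c hy).injective (h.trans (map_zero _).symm)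

theorem target_mem_nhds (c : M) {y : EuclideanSpace ℝ (Fin n)}
    (hy : y ∈ (extChartAt (𝓡∂ n) c).target) (hyi : y ∈ interior (range (𝓡∂ n))) :
    (extChartAt (𝓡∂ n) c).target ∈ 𝓝 y := by
  have h1 := extChartAt_target_mem_nhdsWithin_of_mem (I := 𝓡∂ n) hy
  rwa [nhdsWithin_eq_nhds.2 (mem_interior_iff_mem_nhds.1 hyi)] at h1

/-- The Christoffel symbols in the chart at `c`. -/
def chrisLoc (g : Metric n M) (c : M) (y : EuclideanSpace ℝ (Fin n)) :
    EuclideanSpace ℝ (Fin n) →L[ℝ] EuclideanSpace ℝ (Fin n) →L[ℝ] EuclideanSpace ℝ (Fin n) :=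
  chris (gLoc g c) (range (𝓡∂ n)) y

theorem contDiffAt_gLoc (g : Metric n M) (c : M) {y : EuclideanSpace ℝ (Fin n)}
    (hy : y ∈ (extChartAt (𝓡∂ n) c).target) (hyi : y ∈ interior (range (𝓡∂ n))) :
    ContDiffAt ℝ ∞ (gLoc g c) y :=
  (contDiffOn_gLoc g c y hy).contDiffAt (target_mem_nhds c hy hyi)

theorem isLeviCivitaAt_chrisLoc (g : Metric n M) (c : M) {y : EuclideanSpace ℝ (Fin n)}
    (hy : y ∈ (extChartAt (𝓡∂ n) c).target) (hyi : y ∈ interior (range (𝓡∂ n))) :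
    IsLeviCivitaAt (gLoc g c) (chrisLoc g c) y :=
  isLeviCivitaAt_chris (mem_interior_iff_mem_nhds.1 hyi)
    ((contDiffAt_gLoc g c hy hyi).differentiableAt (by simp))
    (Eventually.of_forall fun z => gLoc_symm g c z) (gLoc_pos g c hy)

theorem eventually_target_interior (c : M) {y : EuclideanSpace ℝ (Fin n)}
    (hy : y ∈ (extChartAt (𝓡∂ n) c).target) (hyi : y ∈ interior (range (𝓡∂ n))) :
    ∀ᶠ z in 𝓝 y, z ∈ (extChartAt (𝓡∂ n) c).target ∧ z ∈ interior (range (𝓡∂ n)) :=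
  inter_mem (target_mem_nhds c hy hyi) (isOpen_interior.mem_nhds hyi)

/-! ### The transition to the chart at the point itself -/

/-- Coordinates in the chart at `x` as functions of the coordinates in the chart at `c`. -/
def trans (n : ℕ) [NeZero n] {M : Type*} [TopologicalSpace M]
    [ChartedSpace (EuclideanHalfSpace n) M] (c x : M) (z : EuclideanSpace ℝ (Fin n)) :
    EuclideanSpace ℝ (Fin n) := extChartAt (𝓡∂ n) x ((extChartAt (𝓡∂ n) c).symm z)

/-- Interior points are defined by the preferred chart; here the test is made in the chart in which
the estimates are carried out. -/
theorem isInteriorPoint_iff_of_mem_target (c : M) {y : EuclideanSpace ℝ (Fin n)}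
    (hy : y ∈ (extChartAt (𝓡∂ n) c).target) :
    (𝓡∂ n).IsInteriorPoint ((extChartAt (𝓡∂ n) c).symm y) ↔ y ∈ interior (range (𝓡∂ n)) := by
  have h1 : (extChartAt (𝓡∂ n) c).symm y ∈ (chartAt (EuclideanHalfSpace n) c).source := by
    rw [← extChartAt_source (I := 𝓡∂ n)]; exact (extChartAt (𝓡∂ n) c).map_target hy
  rw [ModelWithCorners.isInteriorPoint_iff_of_mem_atlas (n := ∞) (by simp)
    (chart_mem_atlas _ c) h1]
  have h2 : (chartAt (EuclideanHalfSpace n) c).extend (𝓡∂ n) ((extChartAt (𝓡∂ n) c).symm y) = y :=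
    (extChartAt (𝓡∂ n) c).right_inv hy
  rw [h2]
  refine ⟨fun h => interior_mono (extChartAt_target_subset_range c) h, fun h => ?_⟩
  exact mem_interior_iff_mem_nhds.2 (target_mem_nhds c hy h)

theorem contDiffAt_trans (c x : M) {z : EuclideanSpace ℝ (Fin n)}
    (hz : z ∈ (extChartAt (𝓡∂ n) c).target) (hzi : z ∈ interior (range (𝓡∂ n)))
    (hx : (extChartAt (𝓡∂ n) c).symm z ∈ (extChartAt (𝓡∂ n) x).source) :
    ContDiffAt ℝ ∞ (trans n c x) z := by
  rw [← contMDiffAt_iff_contDiffAt]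
  rw [extChartAt_source] at hx
  exact (contMDiffAt_extChartAt' (n := ∞) hx).comp z
    ((contMDiffOn_extChartAt_symm (n := ∞) c).contMDiffAt (target_mem_nhds c hz hzi))

end Coordinates

end

end HessianEq

namespace HessianEq

noncomputable section

set_option linter.unusedSectionVars false
set_option maxSynthPendingDepth 3
set_option synthInstance.maxHeartbeats 400000
set_option maxHeartbeats 1000000

/-! ### Comparison of a fixed chart with the preferred chart at each point. -/

section Transition

variable {n : ℕ} [NeZero n] {M : Type*} [TopologicalSpace M]
  [ChartedSpace (EuclideanHalfSpace n) M] [IsManifold (𝓡∂ n) ∞ M]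

theorem two_le_infty : (2 : WithTop ℕ∞) ≤ ∞ :=
  WithTop.coe_le_coe.2 (le_top : (2 : ℕ∞) ≤ ⊤)

/-- The chain rule for the inverse chart at `c` written as the inverse chart at `x` after the
transition map. The laws for the metric, `A` and `ψ` follow by substitution. -/
theorem coordVec_trans (c x : M) {z : EuclideanSpace ℝ (Fin n)}
    (hz : z ∈ (extChartAt (𝓡∂ n) c).target) (hzi : z ∈ interior (range (𝓡∂ n)))
    (hx : (extChartAt (𝓡∂ n) c).symm z ∈ (extChartAt (𝓡∂ n) x).source)
    (v : EuclideanSpace ℝ (Fin n)) :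
    (show EuclideanSpace ℝ (Fin n) from coordVec n c z v)
      = (show EuclideanSpace ℝ (Fin n) from
        coordVec n x (trans n c x z) (fderiv ℝ (trans n c x) z v)) := by
  have ht : trans n c x z ∈ (extChartAt (𝓡∂ n) x).target := (extChartAt (𝓡∂ n) x).map_source hx
  have hmem := target_mem_nhds c hz hzi
  have h1 := (mdifferentiableWithinAt_extChartAt_symm (I := 𝓡∂ n) hz).mdifferentiableAt
    (mem_interior_iff_mem_nhds.1 hzi)
  have hcont : ContinuousAt (extChartAt (𝓡∂ n) c).symm z := h1.continuousAt
  have hd := (contDiffAt_trans c x hz hzi hx).differentiableAt (by simp)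
  have h2 := (mdifferentiableWithinAt_extChartAt_symm (I := 𝓡∂ n) ht).hasMFDerivWithinAt
  have h3 : HasMFDerivWithinAt 𝓘(ℝ, EuclideanSpace ℝ (Fin n)) 𝓘(ℝ, EuclideanSpace ℝ (Fin n))
      (trans n c x) univ z (fderiv ℝ (trans n c x) z) := hd.hasFDerivAt.hasMFDerivAt.hasMFDerivWithinAt
  have h4 := HasMFDerivWithinAt.comp z h2 h3 (fun w _ => mem_range_self _)
  have h5 : (extChartAt (𝓡∂ n) c).symm =ᶠ[𝓝 z] ((extChartAt (𝓡∂ n) x).symm ∘ trans n c x) := by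
    filter_upwards [hcont.eventually ((isOpen_extChartAt_source (I := 𝓡∂ n) x).mem_nhds hx)]
      with w hw
    exact ((extChartAt (𝓡∂ n) x).left_inv hw).symm
  rw [hasMFDerivWithinAt_univ] at h4
  have h6 := (mdifferentiableWithinAt_extChartAt_symm (I := 𝓡∂ n) hz).hasMFDerivWithinAt.hasMFDerivAt
    (mem_interior_iff_mem_nhds.1 hzi)
  have h7 := hasMFDerivAt_unique h6 (h4.congr_of_eventuallyEq h5)
  exact congrArg (fun T : EuclideanSpace ℝ (Fin n) →L[ℝ] EuclideanSpace ℝ (Fin n) => T v) h7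

/-- Tangent spaces at provably equal points are formally different types; all are the same Euclidean
space, so the equality can be substituted once vectors are written there. -/
theorem inner_congr (g : Metric n M) {p q : M} (h : p = q) {v w v' w' : EuclideanSpace ℝ (Fin n)}
    (hv : v = v') (hw : w = w') :
    g.inner p (show Tan n p from v) (show Tan n p from w)
      = g.inner q (show Tan n q from v') (show Tan n q from w') := by
  subst h hv hw; rfl

theorem form_congr (A : GradForm n M) {p q : M} (h : p = q) (r : ℝ)
    {a v w a' v' w' : EuclideanSpace ℝ (Fin n)} (ha : a = a') (hv : v = v') (hw : w = w') :
    A p r (show Tan n p from a) (show Tan n p from v) (show Tan n p from w)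
      = A q r (show Tan n q from a') (show Tan n q from v') (show Tan n q from w') := by
  subst h ha hv hw; rfl

theorem fun_congr (ψ : GradFun n M) {p q : M} (h : p = q) (r : ℝ)
    {a a' : EuclideanSpace ℝ (Fin n)} (ha : a = a') :
    ψ p r (show Tan n p from a) = ψ q r (show Tan n q from a') := by
  subst h ha; rfl

variable (g : Metric n M) (A : GradForm n M) (ψ : GradFun n M)

theorem gLoc_trans (c x : M) {z : EuclideanSpace ℝ (Fin n)}
    (hz : z ∈ (extChartAt (𝓡∂ n) c).target) (hzi : z ∈ interior (range (𝓡∂ n)))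
    (hx : (extChartAt (𝓡∂ n) c).symm z ∈ (extChartAt (𝓡∂ n) x).source)
    (v w : EuclideanSpace ℝ (Fin n)) :
    gLoc g c z v w = gLoc g x (trans n c x z) (fderiv ℝ (trans n c x) z v)
      (fderiv ℝ (trans n c x) z w) :=
  inner_congr g ((extChartAt (𝓡∂ n) x).left_inv hx).symm (coordVec_trans c x hz hzi hx v)
    (coordVec_trans c x hz hzi hx w)

theorem formLoc_trans (c x : M) {z : EuclideanSpace ℝ (Fin n)}
    (hz : z ∈ (extChartAt (𝓡∂ n) c).target) (hzi : z ∈ interior (range (𝓡∂ n)))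
    (hx : (extChartAt (𝓡∂ n) c).symm z ∈ (extChartAt (𝓡∂ n) x).source) (r : ℝ)
    (p v w : EuclideanSpace ℝ (Fin n)) :
    formLoc A c (z, r, p) v w = formLoc A x (trans n c x z, r, fderiv ℝ (trans n c x) z p)
      (fderiv ℝ (trans n c x) z v) (fderiv ℝ (trans n c x) z w) :=
  form_congr A ((extChartAt (𝓡∂ n) x).left_inv hx).symm r (coordVec_trans c x hz hzi hx p)
    (coordVec_trans c x hz hzi hx v) (coordVec_trans c x hz hzi hx w)

theorem funLoc_trans (c x : M) {z : EuclideanSpace ℝ (Fin n)}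
    (hz : z ∈ (extChartAt (𝓡∂ n) c).target) (hzi : z ∈ interior (range (𝓡∂ n)))
    (hx : (extChartAt (𝓡∂ n) c).symm z ∈ (extChartAt (𝓡∂ n) x).source) (r : ℝ)
    (p : EuclideanSpace ℝ (Fin n)) :
    funLoc ψ c (z, r, p) = funLoc ψ x (trans n c x z, r, fderiv ℝ (trans n c x) z p) :=
  fun_congr ψ ((extChartAt (𝓡∂ n) x).left_inv hx).symm r (coordVec_trans c x hz hzi hx p)

theorem gLoc_self (x : M) (v w : EuclideanSpace ℝ (Fin n)) :
    gLoc g x (extChartAt (𝓡∂ n) x x) v w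
      = g.inner x (show Tan n x from v) (show Tan n x from w) :=
  inner_congr g ((extChartAt (𝓡∂ n) x).left_inv (mem_extChartAt_source x)) (coordVec_self x v)
    (coordVec_self x w)

/-- At the centre of the second chart the transition map has derivative `coordVec`. -/
theorem coordVec_eq_fderiv_trans (c : M) {y : EuclideanSpace ℝ (Fin n)}
    (hy : y ∈ (extChartAt (𝓡∂ n) c).target) (hyi : y ∈ interior (range (𝓡∂ n)))
    (v : EuclideanSpace ℝ (Fin n)) :
    (show EuclideanSpace ℝ (Fin n) from coordVec n c y v)
      = fderiv ℝ (trans n c ((extChartAt (𝓡∂ n) c).symm y)) y v :=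
  (coordVec_trans c _ hy hyi (mem_extChartAt_source _) v).trans (coordVec_self _ _)

/-! ### Christoffel symbols, Hessian and gradient -/

theorem christoffel_eq (x : M) (v w : EuclideanSpace ℝ (Fin n)) :
    (show EuclideanSpace ℝ (Fin n) from christoffel g x v w)
      = chrisLoc g x (extChartAt (𝓡∂ n) x x) v w := by
  have hpos := gLoc_pos g x (mem_extChartAt_target (I := 𝓡∂ n) x)
  have hinv := isInvertible_of_pos hpos
  apply (flat_injective g x)
  have h1 : flat g x (christoffel g x v w) = _ := (flatEquiv g x).apply_symm_apply _
  refine h1.trans ?_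
  ext z
  have h2 : gLoc g x (extChartAt (𝓡∂ n) x x) (chrisLoc g x (extChartAt (𝓡∂ n) x x) v w) z
      = koszul (dgLoc g x) v w z := by
    rw [chrisLoc, chris_apply, hinv.self_apply_inverse]; rfl
  rw [gLoc_self] at h2
  exact h2.symm

theorem diff_eq_fderivWithin {u : M → ℝ} (c : M) {y : EuclideanSpace ℝ (Fin n)}
    (hy : y ∈ (extChartAt (𝓡∂ n) c).target)
    (hu : MDifferentiableAt (𝓡∂ n) 𝓘(ℝ, ℝ) u ((extChartAt (𝓡∂ n) c).symm y))
    (v : EuclideanSpace ℝ (Fin n)) :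
    diff n u ((extChartAt (𝓡∂ n) c).symm y) (coordVec n c y v)
      = fderivWithin ℝ (u ∘ (extChartAt (𝓡∂ n) c).symm) (range (𝓡∂ n)) y v := by
  have h1 := (mdifferentiableWithinAt_extChartAt_symm (I := 𝓡∂ n) hy).hasMFDerivWithinAt
  have h2 := hu.hasMFDerivAt.comp_hasMFDerivWithinAt y h1
  obtain ⟨D, hD, hv⟩ : ∃ D : EuclideanSpace ℝ (Fin n) →L[ℝ] ℝ,
      HasFDerivWithinAt (u ∘ (extChartAt (𝓡∂ n) c).symm) D (range (𝓡∂ n)) y ∧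
        ∀ v, D v = diff n u ((extChartAt (𝓡∂ n) c).symm y) (coordVec n c y v) :=
    ⟨_, h2.hasFDerivWithinAt, fun v => rfl⟩
  rw [hD.fderivWithin ((𝓡∂ n).uniqueDiffOn y (extChartAt_target_subset_range c hy)), hv]

theorem grad_eq {u : M → ℝ} (c : M) {y : EuclideanSpace ℝ (Fin n)}
    (hy : y ∈ (extChartAt (𝓡∂ n) c).target)
    (hu : MDifferentiableAt (𝓡∂ n) 𝓘(ℝ, ℝ) u ((extChartAt (𝓡∂ n) c).symm y)) :
    grad g u ((extChartAt (𝓡∂ n) c).symm y) = coordVec n c y ((gLoc g c y).inverse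
      (fderivWithin ℝ (u ∘ (extChartAt (𝓡∂ n) c).symm) (range (𝓡∂ n)) y)) := by
  have hinv := isInvertible_of_pos (gLoc_pos g c hy)
  apply (flat_injective g _)
  have h1 : flat g _ (grad g u ((extChartAt (𝓡∂ n) c).symm y)) = _ :=
    (flatEquiv g _).apply_symm_apply _
  refine h1.trans ?_
  ext z
  obtain ⟨w, rfl⟩ := (coordVec_bijective c hy).surjective z
  rw [diff_eq_fderivWithin c hy hu]
  have h2 := hinv.self_apply_inverse
    (fderivWithin ℝ (u ∘ (extChartAt (𝓡∂ n) c).symm) (range (𝓡∂ n)) y)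
  exact (congrArg (fun T => T w) h2).symm

theorem grad_eq_gradLoc {u : M → ℝ} (c : M) {y : EuclideanSpace ℝ (Fin n)}
    (hy : y ∈ (extChartAt (𝓡∂ n) c).target) (hyi : y ∈ interior (range (𝓡∂ n)))
    (hu : MDifferentiableAt (𝓡∂ n) 𝓘(ℝ, ℝ) u ((extChartAt (𝓡∂ n) c).symm y)) :
    grad g u ((extChartAt (𝓡∂ n) c).symm y)
      = coordVec n c y (gradLoc (gLoc g c) (u ∘ (extChartAt (𝓡∂ n) c).symm) y) := by
  rw [grad_eq g c hy hu, fderivWithin_of_mem_nhds (mem_interior_iff_mem_nhds.1 hyi)]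
  rfl

theorem contDiffAt_comp_symm {u : M → ℝ} {k : ℕ∞} (hu : ContMDiff (𝓡∂ n) 𝓘(ℝ, ℝ) k u) (c : M)
    {y : EuclideanSpace ℝ (Fin n)}
    (hy : y ∈ (extChartAt (𝓡∂ n) c).target) (hyi : y ∈ interior (range (𝓡∂ n))) :
    ContDiffAt ℝ k (u ∘ (extChartAt (𝓡∂ n) c).symm) y := by
  rw [← contMDiffAt_iff_contDiffAt]
  have h1 : ContMDiffAt 𝓘(ℝ, EuclideanSpace ℝ (Fin n)) (𝓡∂ n) k (extChartAt (𝓡∂ n) c).symm y :=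
    ((contMDiffOn_extChartAt_symm (n := ∞) c).contMDiffAt (target_mem_nhds c hy hyi)).of_le
      (by exact_mod_cast le_top)
  exact (hu _).comp y h1

/-- At an interior point derivatives within the half-space are ordinary derivatives, so the
definition agrees with the formula used for calculus. -/
theorem hess_self {u : M → ℝ} (hu : ContMDiff (𝓡∂ n) 𝓘(ℝ, ℝ) 2 u) (x : M)
    (hx : (𝓡∂ n).IsInteriorPoint x) (v w : EuclideanSpace ℝ (Fin n)) :
    hess g u x (show Tan n x from v) (show Tan n x from w)
      = hessLoc (chrisLoc g x) (u ∘ (extChartAt (𝓡∂ n) x).symm) (extChartAt (𝓡∂ n) x x) v w := by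
  have hs : range (𝓡∂ n) ∈ 𝓝 (extChartAt (𝓡∂ n) x x) := mem_interior_iff_mem_nhds.1 hx
  have h1 : (fun y => fderivWithin ℝ (u ∘ (extChartAt (𝓡∂ n) x).symm) (range (𝓡∂ n)) y)
      =ᶠ[𝓝 (extChartAt (𝓡∂ n) x x)] fderiv ℝ (u ∘ (extChartAt (𝓡∂ n) x).symm) := by
    filter_upwards [eventually_mem_nhds_iff.2 hs] with y hy
    exact fderivWithin_of_mem_nhds hy
  have hd : MDifferentiableAt (𝓡∂ n) 𝓘(ℝ, ℝ) u x := (hu x).mdifferentiableAt (by norm_num)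
  have h2 : ∀ a : EuclideanSpace ℝ (Fin n), diff n u x (show Tan n x from a)
      = fderiv ℝ (u ∘ (extChartAt (𝓡∂ n) x).symm) (extChartAt (𝓡∂ n) x x) a := by
    intro a
    rw [← fderivWithin_of_mem_nhds hs]
    exact congrArg (fun T : EuclideanSpace ℝ (Fin n) →L[ℝ] ℝ => T a) hd.mfderiv
  rw [hessLoc_apply, ← christoffel_eq, ← h2, ← h1.fderiv_eq, ← fderivWithin_of_mem_nhds hs]
  rfl

/-- Data on the transition from the chart at `c` to the chart at the point with coordinates `y`. -/
theorem trans_data (c : M) {y : EuclideanSpace ℝ (Fin n)}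
    (hy : y ∈ (extChartAt (𝓡∂ n) c).target) (hyi : y ∈ interior (range (𝓡∂ n))) :
    let x := (extChartAt (𝓡∂ n) c).symm y
    ContDiffAt ℝ ∞ (trans n c x) y ∧ Function.Surjective (fderiv ℝ (trans n c x) y) ∧
    IsLeviCivitaAt (gLoc g c) (chrisLoc g c) y ∧
    IsLeviCivitaAt (gLoc g x) (chrisLoc g x) (trans n c x y) ∧
    ∀ᶠ z in 𝓝 y, z ∈ (extChartAt (𝓡∂ n) c).target ∧ z ∈ interior (range (𝓡∂ n)) ∧
      (extChartAt (𝓡∂ n) c).symm z ∈ (extChartAt (𝓡∂ n) x).source := by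
  intro x
  have hx : (extChartAt (𝓡∂ n) c).symm y ∈ (extChartAt (𝓡∂ n) x).source := mem_extChartAt_source x
  have hxi : (𝓡∂ n).IsInteriorPoint x := (isInteriorPoint_iff_of_mem_target c hy).2 hyi
  refine ⟨contDiffAt_trans c x hy hyi hx, fun v => ?_, isLeviCivitaAt_chrisLoc g c hy hyi,
    isLeviCivitaAt_chrisLoc g x (mem_extChartAt_target x) hxi, ?_⟩
  · obtain ⟨w, hw⟩ := (coordVec_bijective c hy).surjective v
    exact ⟨w, (coordVec_eq_fderiv_trans c hy hyi w).symm.trans hw⟩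
  · have hcont : ContinuousAt (extChartAt (𝓡∂ n) c).symm y :=
      ((mdifferentiableWithinAt_extChartAt_symm (I := 𝓡∂ n) hy).mdifferentiableAt
        (mem_interior_iff_mem_nhds.1 hyi)).continuousAt
    filter_upwards [eventually_target_interior c hy hyi,
      hcont.eventually ((isOpen_extChartAt_source (I := 𝓡∂ n) x).mem_nhds hx)] with z h1 h2
    exact ⟨h1.1, h1.2, h2⟩

/-- `hess` is computed in the preferred chart of each point; invariance under the transition map
turns it into one expression in the chart at `c`, which can be differentiated in `y`. -/
theorem hess_eq_hessLoc {u : M → ℝ} (hu : ContMDiff (𝓡∂ n) 𝓘(ℝ, ℝ) 2 u) (c : M)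
    {y : EuclideanSpace ℝ (Fin n)}
    (hy : y ∈ (extChartAt (𝓡∂ n) c).target) (hyi : y ∈ interior (range (𝓡∂ n)))
    (v w : EuclideanSpace ℝ (Fin n)) :
    hess g u ((extChartAt (𝓡∂ n) c).symm y) (coordVec n c y v) (coordVec n c y w)
      = hessLoc (chrisLoc g c) (u ∘ (extChartAt (𝓡∂ n) c).symm) y v w := by
  obtain ⟨x, hxy⟩ : ∃ x, x = (extChartAt (𝓡∂ n) c).symm y := ⟨_, rfl⟩
  have hxi : (𝓡∂ n).IsInteriorPoint x := hxy ▸ (isInteriorPoint_iff_of_mem_target c hy).2 hyi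
  obtain ⟨h1, h2, h3, h4, h5⟩ := trans_data g c hy hyi
  have h6 := hess_self g hu _ ((isInteriorPoint_iff_of_mem_target c hy).2 hyi)
    (coordVec n c y v) (coordVec n c y w)
  refine h6.trans ?_
  rw [h3.hessLoc_change h4 (h1.of_le two_le_infty) h2 (h5.mono fun z hz =>
    gLoc_trans g c _ hz.1 hz.2.1 hz.2.2)
    (contDiffAt_comp_symm (k := 2) hu _ (mem_extChartAt_target _)
      ((isInteriorPoint_iff_of_mem_target c hy).2 hyi)) (h5.mono fun z hz => ?_),
    ← coordVec_eq_fderiv_trans c hy hyi, ← coordVec_eq_fderiv_trans c hy hyi]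
  · rfl
  · exact congrArg u ((extChartAt (𝓡∂ n) _).left_inv hz.2.2).symm

end Transition

end

end HessianEq

namespace HessianEq

noncomputable section

set_option linter.unusedSectionVars false
set_option maxSynthPendingDepth 3
set_option synthInstance.maxHeartbeats 400000
set_option maxHeartbeats 1000000

/-! ### Partial covariant derivatives -/

section ChangeOfCoordinates

variable {V : Type*} [NormedAddCommGroup V] [NormedSpace ℝ V] {τ : V → V} {y p v w a b : V} {r : ℝ}

theorem hasDerivAt_line (y v : V) : HasDerivAt (fun t : ℝ => y + t • v) v 0 := by
  simpa using ((hasDerivAt_id (0 : ℝ)).smul_const v).const_add y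

theorem hasDerivAt_comp_line {F : Type*} [NormedAddCommGroup F] [NormedSpace ℝ F]
    {h : V × ℝ × V → F} (hh : DifferentiableAt ℝ h (y, r, p)) :
    HasDerivAt (fun t : ℝ => h (y + t • v, r, p + t • w)) (fderiv ℝ h (y, r, p) (v, 0, w)) 0 :=
  HasFDerivAt.comp_hasDerivAt_of_eq (0 : ℝ) hh.hasFDerivAt
    ((hasDerivAt_line y v).prodMk ((hasDerivAt_const (0 : ℝ) r).prodMk (hasDerivAt_line p w)))
    (by simp)

theorem hasDerivAt_fderiv_line (hτ : ContDiffAt ℝ 2 τ y) (p w : V) :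
    HasDerivAt (fun t : ℝ => fderiv ℝ τ (y + t • v) (p + t • w))
      (fderiv ℝ (fderiv ℝ τ) y v p + fderiv ℝ τ y w) 0 := by
  have d2 := ((hτ.fderiv_right (m := 1) (by norm_num)).differentiableAt one_ne_zero).hasFDerivAt
  have h1 : HasDerivAt (fun t : ℝ => fderiv ℝ τ (y + t • v)) (fderiv ℝ (fderiv ℝ τ) y v) 0 :=
    HasFDerivAt.comp_hasDerivAt_of_eq (0 : ℝ) d2 (hasDerivAt_line y v) (by simp)
  simpa using h1.clm_apply (hasDerivAt_line p w)

theorem hasDerivAt_comp_trans {F : Type*} [NormedAddCommGroup F] [NormedSpace ℝ F]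
    {h : V × ℝ × V → F} (hτ : ContDiffAt ℝ 2 τ y)
    (hh : DifferentiableAt ℝ h (τ y, r, fderiv ℝ τ y p)) :
    HasDerivAt (fun t : ℝ => h (τ (y + t • v), r, fderiv ℝ τ (y + t • v) (p + t • w)))
      (fderiv ℝ h (τ y, r, fderiv ℝ τ y p)
        (fderiv ℝ τ y v, 0, fderiv ℝ (fderiv ℝ τ) y v p + fderiv ℝ τ y w)) 0 := by
  have dτ := (hτ.differentiableAt (by norm_num)).hasFDerivAt
  exact HasFDerivAt.comp_hasDerivAt_of_eq (0 : ℝ) hh.hasFDerivAt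
    ((HasFDerivAt.comp_hasDerivAt_of_eq (0 : ℝ) dτ (hasDerivAt_line y v) (by simp)).prodMk
      ((hasDerivAt_const (0 : ℝ) r).prodMk (hasDerivAt_fderiv_line hτ p w)))
    (by simp)

theorem tendsto_line (y v : V) : Tendsto (fun t : ℝ => y + t • v) (𝓝 0) (𝓝 y) := by
  simpa using (hasDerivAt_line y v).continuousAt.tendsto

/-- The chain rule on the tangent bundle: a vector transforms by `dτ`, so moving the base point
produces `D²τ(v, p)`. -/
theorem fderiv_fun_change {h₁ h₂ : V × ℝ × V → ℝ} (hτ : ContDiffAt ℝ 2 τ y)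
    (d₁ : DifferentiableAt ℝ h₁ (y, r, p))
    (d₂ : DifferentiableAt ℝ h₂ (τ y, r, fderiv ℝ τ y p))
    (hh : ∀ᶠ z in 𝓝 y, ∀ q, h₁ (z, r, q) = h₂ (τ z, r, fderiv ℝ τ z q)) :
    fderiv ℝ h₁ (y, r, p) (v, 0, w) = fderiv ℝ h₂ (τ y, r, fderiv ℝ τ y p)
      (fderiv ℝ τ y v, 0, fderiv ℝ (fderiv ℝ τ) y v p + fderiv ℝ τ y w) := by
  refine (hasDerivAt_comp_line d₁).unique
    ((hasDerivAt_comp_trans hτ d₂).congr_of_eventuallyEq ?_)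
  filter_upwards [(tendsto_line y v).eventually hh] with t ht using ht _

theorem fderiv_form_change {h₁ h₂ : V × ℝ × V → V →L[ℝ] V →L[ℝ] ℝ} (hτ : ContDiffAt ℝ 2 τ y)
    (d₁ : DifferentiableAt ℝ h₁ (y, r, p))
    (d₂ : DifferentiableAt ℝ h₂ (τ y, r, fderiv ℝ τ y p))
    (hh : ∀ᶠ z in 𝓝 y, ∀ q a b, h₁ (z, r, q) a b
      = h₂ (τ z, r, fderiv ℝ τ z q) (fderiv ℝ τ z a) (fderiv ℝ τ z b)) :
    fderiv ℝ h₁ (y, r, p) (v, 0, w) a b = fderiv ℝ h₂ (τ y, r, fderiv ℝ τ y p)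
        (fderiv ℝ τ y v, 0, fderiv ℝ (fderiv ℝ τ) y v p + fderiv ℝ τ y w)
        (fderiv ℝ τ y a) (fderiv ℝ τ y b)
      + h₂ (τ y, r, fderiv ℝ τ y p) (fderiv ℝ (fderiv ℝ τ) y v a) (fderiv ℝ τ y b)
      + h₂ (τ y, r, fderiv ℝ τ y p) (fderiv ℝ τ y a) (fderiv ℝ (fderiv ℝ τ) y v b) := by
  have e1 := ((hasDerivAt_comp_line (v := v) (w := w) d₁).clm_apply
    (hasDerivAt_const (0 : ℝ) a)).clm_apply (hasDerivAt_const (0 : ℝ) b)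
  have e2 := ((hasDerivAt_comp_trans (v := v) (w := w) hτ d₂).clm_apply
    (hasDerivAt_fderiv_line (v := v) hτ a 0)).clm_apply (hasDerivAt_fderiv_line (v := v) hτ b 0)
  have e3 := e1.unique (e2.congr_of_eventuallyEq (by
    filter_upwards [(tendsto_line y v).eventually hh] with t ht
    simpa using ht (p + t • w) a b))
  simpa using e3

end ChangeOfCoordinates

/-! ### Partial covariant derivatives in an arbitrary chart. -/

section CovariantDerivative

variable {n : ℕ} [NeZero n] {M : Type*} [TopologicalSpace M]
  [ChartedSpace (EuclideanHalfSpace n) M] [IsManifold (𝓡∂ n) ∞ M]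
  (g : Metric n M) {A : GradForm n M} {ψ : GradFun n M}

theorem contDiffAt_funLoc (hψ : SmoothFun ψ) (c : M) {y : EuclideanSpace ℝ (Fin n)}
    (hy : y ∈ (extChartAt (𝓡∂ n) c).target) (hyi : y ∈ interior (range (𝓡∂ n))) (r : ℝ)
    (p : EuclideanSpace ℝ (Fin n)) : ContDiffAt ℝ ∞ (funLoc ψ c) (y, r, p) :=
  (contDiffOn_funLoc hψ c (y, r, p) ⟨hy, trivial⟩).contDiffAt
    (prod_mem_nhds (target_mem_nhds c hy hyi) univ_mem)

theorem contDiffAt_formLoc (hA : SmoothForm A) (c : M) {y : EuclideanSpace ℝ (Fin n)}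
    (hy : y ∈ (extChartAt (𝓡∂ n) c).target) (hyi : y ∈ interior (range (𝓡∂ n))) (r : ℝ)
    (p : EuclideanSpace ℝ (Fin n)) : ContDiffAt ℝ ∞ (formLoc A c) (y, r, p) :=
  (contDiffOn_formLoc hA c (y, r, p) ⟨hy, trivial⟩).contDiffAt
    (prod_mem_nhds (target_mem_nhds c hy hyi) univ_mem)

theorem hasDerivAt_parallelExt (x : M) (p X : EuclideanSpace ℝ (Fin n)) :
    HasDerivAt (fun t : ℝ => parallelExt g x (show Tan n x from p) (extChartAt (𝓡∂ n) x x + t • X))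
      (-(chrisLoc g x (extChartAt (𝓡∂ n) x x) X p)) 0 := by
  have h1 : ∀ t : ℝ, parallelExt g x (show Tan n x from p) (extChartAt (𝓡∂ n) x x + t • X)
      = p + t • -(chrisLoc g x (extChartAt (𝓡∂ n) x x) X p) := by
    intro t
    have h2 := congrArg (fun q => p - q) (christoffel_eq g x
      ((extChartAt (𝓡∂ n) x x + t • X) - extChartAt (𝓡∂ n) x x) p)
    refine h2.trans ?_
    rw [add_sub_cancel_left, map_smul, smul_apply, smul_neg, sub_eq_add_neg]
  simp only [h1]
  exact hasDerivAt_line _ _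

theorem parallelExt_self (x : M) (p : EuclideanSpace ℝ (Fin n)) :
    parallelExt g x (show Tan n x from p) (extChartAt (𝓡∂ n) x x) = p := by
  have := congrArg (fun q => p - q) (christoffel_eq g x
    (extChartAt (𝓡∂ n) x x - extChartAt (𝓡∂ n) x x) p)
  refine this.trans ?_
  simp

theorem differentiableAt_parallelExt (x : M) (p : EuclideanSpace ℝ (Fin n))
    (y : EuclideanSpace ℝ (Fin n)) :
    DifferentiableAt ℝ (parallelExt g x (show Tan n x from p)) y := by
  have h1 : parallelExt g x (show Tan n x from p) = fun y => p
      - (chrisLoc g x (extChartAt (𝓡∂ n) x x)).flip p (y - extChartAt (𝓡∂ n) x x) := by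
    ext1 y
    exact congrArg (fun q => p - q) (christoffel_eq g x _ p)
  rw [h1]
  exact (differentiableAt_const p).sub
    (((chrisLoc g x (extChartAt (𝓡∂ n) x x)).flip p).differentiableAt.comp y
      (differentiableAt_id.sub_const _))

/-- A field that is parallel at `x` moves in the fibre with velocity `-Γ(X, p)`, so the derivative
is taken along the horizontal lift of `X`. -/
theorem covDerivFun_self (hψ : SmoothFun ψ) (x : M) (hx : (𝓡∂ n).IsInteriorPoint x) (r : ℝ)
    (p X : EuclideanSpace ℝ (Fin n)) :
    covDerivFun g ψ x r (show Tan n x from p) (show Tan n x from X)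
      = fderiv ℝ (funLoc ψ x) (extChartAt (𝓡∂ n) x x, r, p)
        (X, 0, -(chrisLoc g x (extChartAt (𝓡∂ n) x x) X p)) := by
  have hs : range (𝓡∂ n) ∈ 𝓝 (extChartAt (𝓡∂ n) x x) := mem_interior_iff_mem_nhds.1 hx
  have h1 := (contDiffAt_funLoc hψ x (mem_extChartAt_target x) hx r p).differentiableAt
    (by simp)
  have hd : DifferentiableAt ℝ (fun y => funLoc ψ x (y, r, parallelExt g x (show Tan n x from p) y))
      (extChartAt (𝓡∂ n) x x) := by
    refine DifferentiableAt.comp (g := funLoc ψ x) _ (by rwa [parallelExt_self])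
      (differentiableAt_id.prodMk ((differentiableAt_const r).prodMk
        (differentiableAt_parallelExt g x p _)))
  have e1 : HasDerivAt (fun t : ℝ => funLoc ψ x (extChartAt (𝓡∂ n) x x + t • X, r,
      parallelExt g x (show Tan n x from p) (extChartAt (𝓡∂ n) x x + t • X))) _ 0 :=
    HasFDerivAt.comp_hasDerivAt_of_eq (0 : ℝ) h1.hasFDerivAt
      ((hasDerivAt_line _ X).prodMk ((hasDerivAt_const (0 : ℝ) r).prodMk
        (hasDerivAt_parallelExt g x p X)))
      (by rw [zero_smul, add_zero, parallelExt_self])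
  have e2 : HasDerivAt (fun t : ℝ => funLoc ψ x (extChartAt (𝓡∂ n) x x + t • X, r,
      parallelExt g x (show Tan n x from p) (extChartAt (𝓡∂ n) x x + t • X))) _ 0 :=
    HasFDerivAt.comp_hasDerivAt_of_eq (0 : ℝ) hd.hasFDerivAt (hasDerivAt_line _ X) (by simp)
  refine Eq.trans ?_ (e2.unique e1)
  rw [← fderivWithin_of_mem_nhds hs]
  rfl

theorem covDerivForm_self (hA : SmoothForm A) (x : M) (hx : (𝓡∂ n).IsInteriorPoint x) (r : ℝ)
    (p ξ X : EuclideanSpace ℝ (Fin n)) :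
    covDerivForm g A x r (show Tan n x from p) (show Tan n x from ξ) (show Tan n x from X)
      = fderiv ℝ (formLoc A x) (extChartAt (𝓡∂ n) x x, r, p)
          (X, 0, -(chrisLoc g x (extChartAt (𝓡∂ n) x x) X p)) ξ ξ
        - formLoc A x (extChartAt (𝓡∂ n) x x, r, p)
          (chrisLoc g x (extChartAt (𝓡∂ n) x x) X ξ) ξ
        - formLoc A x (extChartAt (𝓡∂ n) x x, r, p) ξ
          (chrisLoc g x (extChartAt (𝓡∂ n) x x) X ξ) := by
  have hs : range (𝓡∂ n) ∈ 𝓝 (extChartAt (𝓡∂ n) x x) := mem_interior_iff_mem_nhds.1 hx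
  have h1 := (contDiffAt_formLoc hA x (mem_extChartAt_target x) hx r p).differentiableAt
    (by simp)
  have hd : DifferentiableAt ℝ (fun y => formLoc A x
      (y, r, parallelExt g x (show Tan n x from p) y) (parallelExt g x (show Tan n x from ξ) y)
      (parallelExt g x (show Tan n x from ξ) y)) (extChartAt (𝓡∂ n) x x) := by
    have h2 : DifferentiableAt ℝ (fun y => formLoc A x
      (y, r, parallelExt g x (show Tan n x from p) y)) (extChartAt (𝓡∂ n) x x) :=
      DifferentiableAt.comp (g := formLoc A x) _ (by rwa [parallelExt_self])
        (differentiableAt_id.prodMk ((differentiableAt_const r).prodMk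
          (differentiableAt_parallelExt g x p _)))
    exact (h2.clm_apply (differentiableAt_parallelExt g x ξ _)).clm_apply
      (differentiableAt_parallelExt g x ξ _)
  have e0 : HasDerivAt (fun t : ℝ => formLoc A x (extChartAt (𝓡∂ n) x x + t • X, r,
      parallelExt g x (show Tan n x from p) (extChartAt (𝓡∂ n) x x + t • X))) _ 0 :=
    HasFDerivAt.comp_hasDerivAt_of_eq (l := formLoc A x) (0 : ℝ) h1.hasFDerivAt
      ((hasDerivAt_line _ X).prodMk ((hasDerivAt_const (0 : ℝ) r).prodMk
        (hasDerivAt_parallelExt g x p X)))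
      (by rw [zero_smul, add_zero, parallelExt_self])
  have e1 := (e0.clm_apply (hasDerivAt_parallelExt g x ξ X)).clm_apply
    (hasDerivAt_parallelExt g x ξ X)
  have e2 : HasDerivAt (fun t : ℝ => formLoc A x (extChartAt (𝓡∂ n) x x + t • X, r,
      parallelExt g x (show Tan n x from p) (extChartAt (𝓡∂ n) x x + t • X))
      (parallelExt g x (show Tan n x from ξ) (extChartAt (𝓡∂ n) x x + t • X))
      (parallelExt g x (show Tan n x from ξ) (extChartAt (𝓡∂ n) x x + t • X))) _ 0 :=
    HasFDerivAt.comp_hasDerivAt_of_eq (0 : ℝ) hd.hasFDerivAt (hasDerivAt_line _ X) (by simp)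
  have e3 := e2.unique e1
  simp only [zero_smul, add_zero, parallelExt_self, map_neg, neg_apply, add_apply] at e3
  refine Eq.trans ?_ (e3.trans (by ring))
  rw [← fderivWithin_of_mem_nhds hs]
  rfl

/-- The term `D²τ(p, p)` from the change of the fibre variable cancels against the inhomogeneous
term in the law of the Christoffel symbols. -/
theorem covDerivFun_eq (hψ : SmoothFun ψ) (c : M) {y : EuclideanSpace ℝ (Fin n)}
    (hy : y ∈ (extChartAt (𝓡∂ n) c).target) (hyi : y ∈ interior (range (𝓡∂ n))) (r : ℝ)
    (p : EuclideanSpace ℝ (Fin n)) :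
    covDerivFun g ψ ((extChartAt (𝓡∂ n) c).symm y) r (coordVec n c y p) (coordVec n c y p)
      = fderiv ℝ (funLoc ψ c) (y, r, p) (p, 0, -(chrisLoc g c y p p)) := by
  have hxi := (isInteriorPoint_iff_of_mem_target c hy).2 hyi
  obtain ⟨h1, h2, h3, h4, h5⟩ := trans_data g c hy hyi
  have h1' := h1.of_le two_le_infty
  refine (covDerivFun_self g hψ _ hxi r _ _).trans ?_
  have hv := coordVec_eq_fderiv_trans c hy hyi
  have hch := h3.change h4 h1' h2 (h5.mono fun z hz => gLoc_trans g c _ hz.1 hz.2.1 hz.2.2) p p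
  rw [fderiv_fun_change (h₂ := funLoc ψ ((extChartAt (𝓡∂ n) c).symm y)) h1'
    ((contDiffAt_funLoc hψ c hy hyi r p).differentiableAt (by simp))
    ((contDiffAt_funLoc hψ _ (mem_extChartAt_target _) hxi r _).differentiableAt (by simp))
    (h5.mono fun z hz q => funLoc_trans ψ c _ hz.1 hz.2.1 hz.2.2 r q), map_neg, hch,
    neg_add_rev, add_neg_cancel_left, ← hv]
  rfl

theorem covDerivForm_eq (hA : SmoothForm A) (c : M) {y : EuclideanSpace ℝ (Fin n)}
    (hy : y ∈ (extChartAt (𝓡∂ n) c).target) (hyi : y ∈ interior (range (𝓡∂ n))) (r : ℝ)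
    (p ξ : EuclideanSpace ℝ (Fin n)) :
    covDerivForm g A ((extChartAt (𝓡∂ n) c).symm y) r (coordVec n c y p) (coordVec n c y ξ)
        (coordVec n c y p)
      = fderiv ℝ (formLoc A c) (y, r, p) (p, 0, -(chrisLoc g c y p p)) ξ ξ
        - formLoc A c (y, r, p) (chrisLoc g c y p ξ) ξ
        - formLoc A c (y, r, p) ξ (chrisLoc g c y p ξ) := by
  have hxi := (isInteriorPoint_iff_of_mem_target c hy).2 hyi
  obtain ⟨h1, h2, h3, h4, h5⟩ := trans_data g c hy hyi
  have h1' := h1.of_le two_le_infty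
  refine (covDerivForm_self g hA _ hxi r _ _ _).trans ?_
  have hv := coordVec_eq_fderiv_trans c hy hyi
  have hch := fun w => h3.change h4 h1' h2
    (h5.mono fun z hz => gLoc_trans g c _ hz.1 hz.2.1 hz.2.2) p w
  have hA2 := fun q v w => formLoc_trans A c _ hy hyi (mem_extChartAt_source _) r q v w
  rw [fderiv_form_change (h₂ := formLoc A ((extChartAt (𝓡∂ n) c).symm y)) h1'
    ((contDiffAt_formLoc hA c hy hyi r p).differentiableAt (by simp))
    ((contDiffAt_formLoc hA _ (mem_extChartAt_target _) hxi r _).differentiableAt (by simp))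
    (h5.mono fun z hz q a b => formLoc_trans A c _ hz.1 hz.2.1 hz.2.2 r q a b), map_neg, hch,
    neg_add_rev, add_neg_cancel_left, hA2, hA2, hch, map_add, map_add, add_apply, ← hv, ← hv]
  -- `d` and `e` contain `D²τ(p, ξ)`; they occur once in the derivative of `A` and once in the
  -- Christoffel terms.
  have : ∀ a b c d e : ℝ, a - b - c = a + d + e - (b + d) - (c + e) := fun _ _ _ _ _ => by ring
  exact this _ _ _ _ _

end CovariantDerivative

end

end HessianEq

namespace HessianEq

noncomputable section

set_option linter.unusedSectionVars false
set_option maxSynthPendingDepth 3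
set_option synthInstance.maxHeartbeats 400000
set_option maxHeartbeats 1000000

/-! ### Uniform bounds -/

section Bounds

/-- A tube lemma relative to `s`, so that it applies in half-space charts at boundary points. -/
theorem exists_eventually_le {X Y : Type*} [TopologicalSpace X] [TopologicalSpace Y]
    {F : X × Y → ℝ} {s : Set X} {T : Set Y} (hT : IsCompact T)
    (hF : ContinuousOn F (s ×ˢ univ)) {x₀ : X} (hx₀ : x₀ ∈ s) :
    ∃ C, ∀ᶠ x in 𝓝[s] x₀, ∀ y ∈ T, F (x, y) ≤ C := by
  have hc : ContinuousOn (fun y => F (x₀, y)) T :=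
    hF.comp (by fun_prop) fun y _ => ⟨hx₀, trivial⟩
  obtain ⟨C, hC⟩ := (hT.image_of_continuousOn hc).bddAbove
  refine ⟨C + 1, ?_⟩
  rw [eventually_nhdsWithin_iff]
  have key := IsCompact.eventually_forall_of_forall_eventually (x₀ := x₀) hT
    (P := fun x y => x ∈ s → F (x, y) ≤ C + 1) fun y hy => ?_
  · filter_upwards [key] with x hx hxs y hy using hx y hy hxs
  · have h1 : F (x₀, y) < C + 1 := lt_of_le_of_lt (hC ⟨y, hy, rfl⟩) (lt_add_one C)
    have h2 := (hF (x₀, y) ⟨hx₀, trivial⟩).eventually (gt_mem_nhds h1)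
    rw [eventually_nhdsWithin_iff] at h2
    filter_upwards [h2] with z hz hzs using (hz ⟨hzs, trivial⟩).le

theorem exists_eventually_norm_le {X E : Type*} [TopologicalSpace X] [SeminormedAddCommGroup E]
    {F : X → E} {s : Set X} {x₀ : X} (hF : ContinuousWithinAt F s x₀) :
    ∀ᶠ x in 𝓝[s] x₀, ‖F x‖ ≤ ‖F x₀‖ + 1 :=
  (hF.norm.eventually (gt_mem_nhds (lt_add_one _))).mono fun _ h => h.le

/-- A continuous positive bilinear form is locally uniformly positive. -/
theorem exists_eventually_sq_norm_le {V : Type*} [NormedAddCommGroup V] [NormedSpace ℝ V]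
    [FiniteDimensional ℝ V] {X : Type*} [TopologicalSpace X] {G : X → V →L[ℝ] V →L[ℝ] ℝ}
    {s : Set X} {x₀ : X} (hG : ContinuousWithinAt G s x₀) (hpos : ∀ v, v ≠ 0 → 0 < G x₀ v v) :
    ∃ ρ : ℝ, 0 < ρ ∧ ∀ᶠ x in 𝓝[s] x₀, ∀ v, ‖v‖ ^ 2 ≤ ρ * G x v v := by
  obtain ⟨κ, hκ, hκb⟩ : ∃ κ : ℝ, 0 < κ ∧ ∀ v, κ * ‖v‖ ^ 2 ≤ G x₀ v v := by
    obtain hS | hS := (Metric.sphere (0 : V) 1).eq_empty_or_nonempty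
    · refine ⟨1, one_pos, fun v => ?_⟩
      have hv : v = 0 := by
        by_contra hne
        have : (‖v‖⁻¹ • v) ∈ Metric.sphere (0 : V) 1 := by
          rw [mem_sphere_zero_iff_norm, norm_smul, norm_inv, norm_norm,
            inv_mul_cancel₀ (norm_ne_zero_iff.2 hne)]
        rw [hS] at this
        exact this
      simp [hv]
    · have hcont : Continuous fun v : V => G x₀ v v :=
        (G x₀).continuous.clm_apply continuous_id
      obtain ⟨v₀, hv₀, hmin⟩ := (isCompact_sphere (0 : V) 1).exists_isMinOn hS hcont.continuousOn
      refine ⟨G x₀ v₀ v₀, hpos v₀ (by rintro rfl; simp at hv₀), fun v => ?_⟩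
      by_cases hv : v = 0
      · simp [hv]
      have hn : ‖v‖ ≠ 0 := norm_ne_zero_iff.2 hv
      have h1 : G x₀ v₀ v₀ ≤ G x₀ (‖v‖⁻¹ • v) (‖v‖⁻¹ • v) := hmin (by
        rw [mem_sphere_zero_iff_norm, norm_smul, norm_inv, norm_norm, inv_mul_cancel₀ hn])
      simp only [map_smul, smul_apply, smul_eq_mul] at h1
      calc G x₀ v₀ v₀ * ‖v‖ ^ 2 ≤ ‖v‖⁻¹ * (‖v‖⁻¹ * G x₀ v v) * ‖v‖ ^ 2 := by gcongr
        _ = G x₀ v v := by field_simp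
  refine ⟨2 / κ, by positivity, ?_⟩
  have h1 : ∀ᶠ x in 𝓝[s] x₀, ‖G x - G x₀‖ < κ / 2 := by
    have h2 : ContinuousWithinAt (fun x => ‖G x - G x₀‖) s x₀ := (hG.sub_const _).norm
    exact h2.eventually (gt_mem_nhds (by simpa using half_pos hκ))
  filter_upwards [h1] with x hx v
  have h2 : |(G x - G x₀) v v| ≤ ‖G x - G x₀‖ * ‖v‖ * ‖v‖ := (G x - G x₀).le_opNorm₂ v v
  have h3 : ‖G x - G x₀‖ * ‖v‖ * ‖v‖ ≤ κ / 2 * ‖v‖ * ‖v‖ := by gcongr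
  have h4 := neg_le_of_abs_le (h2.trans h3)
  simp only [sub_apply] at h4
  have h5 : κ / 2 * ‖v‖ ^ 2 ≤ G x v v := by linarith [hκb v]
  rw [div_mul_eq_mul_div, le_div_iff₀ hκ]
  linarith

theorem curvLoc_bound {V : Type*} [NormedAddCommGroup V] [NormedSpace ℝ V]
    {Γ : V → V →L[ℝ] V →L[ℝ] V} {y : V} {C₁ C₂ : ℝ} (h1 : ‖Γ y‖ ≤ C₁) (h2 : ‖fderiv ℝ Γ y‖ ≤ C₂)
    (p e : V) : ‖curvLoc Γ y p e‖ ≤ (2 * C₁ ^ 2 + 2 * C₂) * ‖p‖ * ‖e‖ ^ 2 := by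
  have hC : 0 ≤ C₁ := (norm_nonneg _).trans h1
  have hΓ : ∀ v w, ‖Γ y v w‖ ≤ C₁ * ‖v‖ * ‖w‖ := fun v w =>
    ((Γ y).le_opNorm₂ v w).trans (by gcongr)
  have hD : ∀ a v w, ‖fderiv ℝ Γ y a v w‖ ≤ C₂ * ‖a‖ * ‖v‖ * ‖w‖ := fun a v w =>
    ((fderiv ℝ Γ y a).le_opNorm₂ v w).trans (by
      gcongr
      exact ((fderiv ℝ Γ y).le_opNorm a).trans (by gcongr))
  have a1 : ‖Γ y p (Γ y e e)‖ ≤ C₁ * ‖p‖ * (C₁ * ‖e‖ * ‖e‖) :=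
    (hΓ _ _).trans (by gcongr; exact hΓ _ _)
  have a2 : ‖Γ y e (Γ y p e)‖ ≤ C₁ * ‖e‖ * (C₁ * ‖p‖ * ‖e‖) :=
    (hΓ _ _).trans (by gcongr; exact hΓ _ _)
  have a3 := hD p e e
  have a4 := hD e p e
  rw [curvLoc]
  have b1 := norm_sub_le (Γ y p (Γ y e e) - Γ y e (Γ y p e) + fderiv ℝ Γ y p e e)
    (fderiv ℝ Γ y e p e)
  have b2 := norm_add_le (Γ y p (Γ y e e) - Γ y e (Γ y p e)) (fderiv ℝ Γ y p e e)
  have b3 := norm_sub_le (Γ y p (Γ y e e)) (Γ y e (Γ y p e))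
  linarith

/-- A function with `h'' ≤ -κ` has second differences bounded by `-κ`. -/
theorem second_difference_le {h : ℝ → ℝ} (hh : ContDiff ℝ 2 h) {κ : ℝ}
    (hκ : ∀ t, iteratedDeriv 2 h t ≤ -κ) : κ / 4 ≤ 2 * h (1 / 2) - h 0 - h 1 := by
  have hd : Differentiable ℝ h := hh.differentiable (by norm_num)
  have hd2 : Differentiable ℝ (deriv h) :=
    (contDiff_succ_iff_deriv (n := 1).1 hh).2.2.differentiable one_ne_zero
  have e1 : deriv (fun t => h t + κ / 2 * t ^ 2) = fun t => deriv h t + κ * t := by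
    ext t
    have h1 : HasDerivAt (fun t => h t + κ / 2 * t ^ 2) (deriv h t + κ / 2 * (2 * t ^ 1 * 1)) t := by
      simpa using (hd t).hasDerivAt.fun_add (((hasDerivAt_id t).pow 2).const_mul (κ / 2))
    rw [h1.deriv]; ring
  have e2 : ∀ t, HasDerivAt (fun t => deriv h t + κ * t) (iteratedDeriv 2 h t + κ) t := by
    intro t
    have h1 := (hd2 t).hasDerivAt.fun_add ((hasDerivAt_id t).const_mul κ)
    have h2 : iteratedDeriv 2 h t = deriv (deriv h) t := by
      rw [iteratedDeriv_succ, iteratedDeriv_one]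
    rw [h2]
    simpa using h1
  -- Adding `κ t² / 2` leaves a concave function, and midpoint concavity on `[0, 1]` yields the
  -- constant `κ / 4`.
  have hc : ConcaveOn ℝ univ (fun t => h t + κ / 2 * t ^ 2) := by
    refine concaveOn_univ_of_deriv2_nonpos (by fun_prop) ?_ fun t => ?_
    · rw [e1]; exact fun t => (e2 t).differentiableAt
    · simp only [Function.iterate_succ, Function.iterate_zero, Function.comp_apply, id_eq]
      rw [e1, (e2 t).deriv]
      linarith [hκ t]
  have h3 := hc.2 (mem_univ (0 : ℝ)) (mem_univ (1 : ℝ)) (by norm_num : (0 : ℝ) ≤ 1 / 2)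
    (by norm_num : (0 : ℝ) ≤ 1 / 2) (by norm_num)
  simp only [smul_eq_mul] at h3
  norm_num at h3 ⊢
  linarith

end Bounds

/-! ### Bounds for the data, uniform over the compact manifold and up to the boundary. -/

section LocalBounds

variable {n : ℕ} [NeZero n] {M : Type*} [TopologicalSpace M]
  [ChartedSpace (EuclideanHalfSpace n) M] [IsManifold (𝓡∂ n) ∞ M]
  (g : Metric n M) {A : GradForm n M} {ψ : GradFun n M}

/-- Bounds for the data at the point with coordinates `y` in the chart at `c`. -/
structure LocalBound (A : GradForm n M) (ψ : GradFun n M) (K C : ℝ) (c : M)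
    (y : EuclideanSpace ℝ (Fin n)) : Prop where
  mem : y ∈ (extChartAt (𝓡∂ n) c).target
  form : ∀ r, |r| ≤ K → ∀ q, gLoc g c y q q ≤ 1 → ∀ ξ,
    |formLoc A c (y, r, q) ξ ξ| ≤ C * gLoc g c y ξ ξ
  fun_zero : ∀ r, |r| ≤ K → funLoc ψ c (y, r, 0) ≤ C
  curv : y ∈ interior (range (𝓡∂ n)) → ∀ p e,
    |gLoc g c y p (curvLoc (chrisLoc g c) y p e)| ≤ C * gLoc g c y p p * gLoc g c y e e

theorem gLoc_nonneg (c : M) (y v : EuclideanSpace ℝ (Fin n)) : 0 ≤ gLoc g c y v v := by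
  rw [gLoc_apply]
  by_cases h : coordVec n c y v = 0
  · rw [h, map_zero]
  · exact (g.pos _ _ h).le

theorem LocalBound.mono {g : Metric n M} {K C C' : ℝ} {c : M} {y : EuclideanSpace ℝ (Fin n)}
    (h : LocalBound g A ψ K C c y) (hC : C ≤ C') : LocalBound g A ψ K C' c y where
  mem := h.mem
  form r hr q hq ξ := (h.form r hr q hq ξ).trans (by gcongr; exact gLoc_nonneg g c y ξ)
  fun_zero r hr := (h.fun_zero r hr).trans hC
  curv hi p e := (h.curv hi p e).trans (mul_le_mul_of_nonneg_right
    (mul_le_mul_of_nonneg_right hC (gLoc_nonneg g c y p)) (gLoc_nonneg g c y e))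

/-- Everything is continuous within the half-space at the base point, including the first
derivatives of the Christoffel symbols, so the bounds do not degenerate as interior points approach
the boundary. -/
theorem exists_eventually_localBound (hA : SmoothForm A) (hψ : SmoothFun ψ) (K : ℝ) (c : M) :
    ∃ C, ∀ᶠ y in 𝓝[range (𝓡∂ n)] (extChartAt (𝓡∂ n) c c), LocalBound g A ψ K C c y := by
  have hy₀ := mem_extChartAt_target (I := 𝓡∂ n) c
  have hr₀ : extChartAt (𝓡∂ n) c c ∈ range (𝓡∂ n) := extChartAt_target_subset_range c hy₀
  have hmem : (extChartAt (𝓡∂ n) c).target ∈ 𝓝[range (𝓡∂ n)] (extChartAt (𝓡∂ n) c c) :=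
    extChartAt_target_mem_nhdsWithin c
  have hnh : 𝓝[(extChartAt (𝓡∂ n) c).target] (extChartAt (𝓡∂ n) c c)
      = 𝓝[range (𝓡∂ n)] (extChartAt (𝓡∂ n) c c) := nhdsWithin_extChartAt_target_eq c
  have hG : ContDiffWithinAt ℝ ∞ (gLoc g c) (range (𝓡∂ n)) (extChartAt (𝓡∂ n) c c) :=
    (contDiffOn_gLoc g c _ hy₀).mono_of_mem_nhdsWithin hmem
  obtain ⟨ρ, hρ, hρb⟩ := exists_eventually_sq_norm_le hG.continuousWithinAt
    (gLoc_pos g c hy₀)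
  have hΓ : ContDiffWithinAt ℝ 1 (chrisLoc g c) (range (𝓡∂ n)) (extChartAt (𝓡∂ n) c c) :=
    contDiffWithinAt_chris (hG.of_le two_le_infty) (𝓡∂ n).uniqueDiffOn (by norm_num) hr₀
      (gLoc_pos g c hy₀)
  have hDΓ : ContinuousWithinAt (fderivWithin ℝ (chrisLoc g c) (range (𝓡∂ n))) (range (𝓡∂ n))
      (extChartAt (𝓡∂ n) c c) :=
    (hΓ.fderivWithin_right (m := 0) (𝓡∂ n).uniqueDiffOn (by norm_num) hr₀).continuousWithinAt
  have e1 := exists_eventually_norm_le hG.continuousWithinAt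
  have e2 := exists_eventually_norm_le hΓ.continuousWithinAt
  have e3 := exists_eventually_norm_le hDΓ
  -- The `g`-unit ball lies in the coordinate ball of radius `√ρ`, because `‖q‖² ≤ ρ g(q, q)`.
  obtain ⟨C₁, hC₁⟩ := exists_eventually_le (F := fun q => ‖formLoc A c q‖)
    (T := Icc (-K) K ×ˢ Metric.closedBall (0 : EuclideanSpace ℝ (Fin n)) (Real.sqrt ρ))
    (isCompact_Icc.prod (isCompact_closedBall _ _)) (contDiffOn_formLoc hA c).continuousOn.norm hy₀
  obtain ⟨C₂, hC₂⟩ := exists_eventually_le (F := funLoc ψ c)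
    (T := Icc (-K) K ×ˢ {(0 : EuclideanSpace ℝ (Fin n))})
    (isCompact_Icc.prod isCompact_singleton) (contDiffOn_funLoc hψ c).continuousOn hy₀
  rw [hnh] at hC₁ hC₂
  obtain ⟨b1, hb1⟩ : ∃ b, b = ‖gLoc g c (extChartAt (𝓡∂ n) c c)‖ + 1 := ⟨_, rfl⟩
  obtain ⟨b2, hb2⟩ : ∃ b, b = ‖chrisLoc g c (extChartAt (𝓡∂ n) c c)‖ + 1 := ⟨_, rfl⟩
  obtain ⟨b3, hb3⟩ : ∃ b, b = ‖fderivWithin ℝ (chrisLoc g c) (range (𝓡∂ n))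
    (extChartAt (𝓡∂ n) c c)‖ + 1 := ⟨_, rfl⟩
  rw [← hb1] at e1
  rw [← hb2] at e2
  rw [← hb3] at e3
  refine ⟨max (max (max C₁ 0 * ρ) C₂) (b1 * (2 * b2 ^ 2 + 2 * b3) * ρ ^ 2), ?_⟩
  filter_upwards [hmem, hρb, e1, e2, e3, hC₁, hC₂] with y h0 h1 h2 h3 h4 h5 h6
  refine ⟨h0, fun r hr q hq ξ => ?_, fun r hr => ?_, fun hi p e => ?_⟩
  · have hq2 : q ∈ Metric.closedBall (0 : EuclideanSpace ℝ (Fin n)) (Real.sqrt ρ) := by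
      rw [mem_closedBall_zero_iff]
      refine Real.le_sqrt_of_sq_le ((h1 q).trans ?_)
      exact mul_le_of_le_one_right hρ.le hq
    have a1 := h5 (r, q) ⟨abs_le.1 hr, hq2⟩
    have a2 : |formLoc A c (y, r, q) ξ ξ| ≤ ‖formLoc A c (y, r, q)‖ * ‖ξ‖ * ‖ξ‖ :=
      (formLoc A c (y, r, q)).le_opNorm₂ ξ ξ
    calc _ ≤ ‖formLoc A c (y, r, q)‖ * ‖ξ‖ ^ 2 := by rw [sq, ← mul_assoc]; exact a2
      _ ≤ max C₁ 0 * (ρ * gLoc g c y ξ ξ) := by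
        gcongr
        · exact a1.trans (le_max_left _ _)
        · exact h1 ξ
      _ ≤ _ := by
        rw [← mul_assoc]
        gcongr
        · exact gLoc_nonneg g c y ξ
        · exact (le_max_left _ _).trans (le_max_left _ _)
  · exact (h6 (r, 0) ⟨abs_le.1 hr, rfl⟩).trans ((le_max_right _ _).trans (le_max_left _ _))
  · rw [fderivWithin_of_mem_nhds (mem_interior_iff_mem_nhds.1 hi)] at h4
    have a1 := curvLoc_bound h3 h4 p e
    have a2 : |gLoc g c y p (curvLoc (chrisLoc g c) y p e)|
        ≤ ‖gLoc g c y‖ * ‖p‖ * ‖curvLoc (chrisLoc g c) y p e‖ := (gLoc g c y).le_opNorm₂ _ _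
    have hb1' : 0 ≤ b1 := (norm_nonneg _).trans h2
    have hb3' : 0 ≤ b3 := (norm_nonneg _).trans h4
    calc _ ≤ b1 * ‖p‖ * ((2 * b2 ^ 2 + 2 * b3) * ‖p‖ * ‖e‖ ^ 2) := a2.trans (by gcongr)
      _ = b1 * (2 * b2 ^ 2 + 2 * b3) * (‖p‖ ^ 2 * ‖e‖ ^ 2) := by ring
      _ ≤ b1 * (2 * b2 ^ 2 + 2 * b3) * ((ρ * gLoc g c y p p) * (ρ * gLoc g c y e e)) := by
        gcongr
        · exact mul_nonneg hρ.le (gLoc_nonneg g c y p)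
        · exact h1 p
        · exact h1 e
      _ = b1 * (2 * b2 ^ 2 + 2 * b3) * ρ ^ 2 * (gLoc g c y p p * gLoc g c y e e) := by ring
      _ ≤ _ := by
        rw [mul_assoc (max _ _)]
        gcongr
        · exact mul_nonneg (gLoc_nonneg g c y p) (gLoc_nonneg g c y e)
        · exact le_max_right _ _

/-- Compactness turns the local statements into one constant; the chart still depends on the point,
which is harmless because the bounds are stated invariantly. -/
theorem exists_localBound [CompactSpace M] (hA : SmoothForm A) (hψ : SmoothFun ψ) (K : ℝ) :
    ∃ C, ∀ x : M, ∃ c y, (extChartAt (𝓡∂ n) c).symm y = x ∧ LocalBound g A ψ K C c y := by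
  have h := isCompact_univ.induction_on (X := M) (p := fun s => ∃ C, ∀ x ∈ s, ∃ c y,
    (extChartAt (𝓡∂ n) c).symm y = x ∧ LocalBound g A ψ K C c y) ⟨0, by simp⟩
    (fun s t hst ⟨C, hC⟩ => ⟨C, fun x hx => hC x (hst hx)⟩)
    (fun s t ⟨C, hC⟩ ⟨C', hC'⟩ => ⟨max C C', fun x hx => ?_⟩) (fun c _ => ?_)
  · obtain ⟨C, hC⟩ := h
    exact ⟨C, fun x => hC x trivial⟩
  · rcases hx with hx | hx
    · obtain ⟨c, y, h1, h2⟩ := hC x hx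
      exact ⟨c, y, h1, h2.mono (le_max_left _ _)⟩
    · obtain ⟨c, y, h1, h2⟩ := hC' x hx
      exact ⟨c, y, h1, h2.mono (le_max_right _ _)⟩
  · obtain ⟨C, hC⟩ := exists_eventually_localBound g hA hψ K c
    have ht : Tendsto (extChartAt (𝓡∂ n) c) (𝓝 c) (𝓝[range (𝓡∂ n)] (extChartAt (𝓡∂ n) c c)) :=
      tendsto_nhdsWithin_of_tendsto_nhds_of_eventually_within _
        (continuousAt_extChartAt c).tendsto (Eventually.of_forall fun x => mem_range_self _)
    refine ⟨_, mem_nhdsWithin_of_mem_nhds (inter_mem (ht.eventually hC)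
      (extChartAt_source_mem_nhds (I := 𝓡∂ n) c)), C, fun x hx => ?_⟩
    exact ⟨c, extChartAt (𝓡∂ n) c x, (extChartAt (𝓡∂ n) c).left_inv hx.2, hx.1⟩

end LocalBounds

end

end HessianEq

namespace HessianEq

noncomputable section

set_option linter.unusedSectionVars false
set_option maxSynthPendingDepth 3
set_option synthInstance.maxHeartbeats 400000
set_option maxHeartbeats 1000000

/-! ### The gradient bound at an interior maximum -/

section Interior

variable {n : ℕ} [NeZero n] {M : Type*} [TopologicalSpace M]
  [ChartedSpace (EuclideanHalfSpace n) M] [IsManifold (𝓡∂ n) ∞ M]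
  {g : Metric n M} {A : GradForm n M} {ψ : GradFun n M}

theorem gnorm_sq (g : Metric n M) (x : M) (v : Tan n x) : gnorm g x v ^ 2 = g.inner x v v := by
  refine Real.sq_sqrt ?_
  by_cases h : v = 0
  · rw [h, map_zero]
  · exact (g.pos _ _ h).le

theorem gnorm_nonneg (g : Metric n M) (x : M) (v : Tan n x) : 0 ≤ gnorm g x v := Real.sqrt_nonneg _

theorem gnorm_coordVec_sq (g : Metric n M) (c : M) (y v : EuclideanSpace ℝ (Fin n)) :
    gnorm g _ (coordVec n c y v) ^ 2 = gLoc g c y v v := gnorm_sq g _ _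

/-! ### Dependence on the gradient variable at a fixed point. -/

section Slice

variable {c : M} {y : EuclideanSpace ℝ (Fin n)} {r : ℝ}

theorem contDiff_formLoc_slice (hA : SmoothForm A) (hy : y ∈ (extChartAt (𝓡∂ n) c).target) :
    ContDiff ℝ ∞ (fun q => formLoc A c (y, r, q)) := by
  rw [← contDiffOn_univ]
  exact (contDiffOn_formLoc hA c).comp (by fun_prop) fun q _ => ⟨hy, trivial⟩

theorem concaveOn_formLoc (h : ConcaveInGradient A ψ) (ξ : EuclideanSpace ℝ (Fin n)) :
    ConcaveOn ℝ univ (fun q => formLoc A c (y, r, q) ξ ξ) := by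
  refine ⟨convex_univ, fun a _ b _ s t hs ht hst => ?_⟩
  have h1 := ((h ((extChartAt (𝓡∂ n) c).symm y) r).2 (coordVec n c y ξ)).2
    (mem_univ (coordVec n c y a)) (mem_univ (coordVec n c y b)) hs ht hst
  simp only [formLoc_apply, map_add, map_smul]
  exact h1

theorem concaveOn_neg_funLoc (h : ConcaveInGradient A ψ) :
    ConcaveOn ℝ univ (fun q => -funLoc ψ c (y, r, q)) := by
  refine ⟨convex_univ, fun a _ b _ s t hs ht hst => ?_⟩
  have h1 := (h ((extChartAt (𝓡∂ n) c).symm y) r).1.2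
    (mem_univ (coordVec n c y a)) (mem_univ (coordVec n c y b)) hs ht hst
  simp only [funLoc, map_add, map_smul]
  exact h1

/-- Concavity in the gradient variable turns bounds on the unit ball into linear bounds. -/
theorem formLoc_le_of_concave (h : ConcaveInGradient A ψ) {C K : ℝ}
    (hb : LocalBound g A ψ K C c y) (hr : |r| ≤ K) (ξ : EuclideanSpace ℝ (Fin n))
    {q : EuclideanSpace ℝ (Fin n)} {P : ℝ} (hP : 1 ≤ P) (hq : gLoc g c y q q ≤ P ^ 2) :
    formLoc A c (y, r, q) ξ ξ ≤ 2 * C * P * gLoc g c y ξ ξ := by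
  have hP0 : 0 < P := by linarith
  have h0 := (abs_le.1 (hb.form r hr 0 (by simp) ξ)).1
  have h1 := (abs_le.1 (hb.form r hr (P⁻¹ • q) (by
    simp only [map_smul, smul_apply, smul_eq_mul]
    rw [← mul_assoc, ← mul_inv, ← sq, inv_mul_le_iff₀ (by positivity), mul_one]
    exact hq) ξ)).2
  have hC : 0 ≤ C * gLoc g c y ξ ξ := (abs_nonneg _).trans (hb.form r hr 0 (by simp) ξ)
  -- `q / P` lies between `0` and `q`. The values at `0` and at `q / P` are controlled, and
  -- concavity is solved for the value at `q`.
  have h2 := (concaveOn_formLoc (c := c) (y := y) (r := r) h ξ).2 (mem_univ 0) (mem_univ q)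
    (sub_nonneg.2 (inv_le_one_of_one_le₀ hP)) (inv_nonneg.2 hP0.le) (by ring)
  simp only [smul_zero, zero_add, smul_eq_mul] at h2
  have h3 : (1 - P⁻¹) * -(C * gLoc g c y ξ ξ) ≤ (1 - P⁻¹) * formLoc A c (y, r, 0) ξ ξ :=
    mul_le_mul_of_nonneg_left h0 (sub_nonneg.2 (inv_le_one_of_one_le₀ hP))
  have h4 : P⁻¹ * formLoc A c (y, r, q) ξ ξ
      ≤ C * gLoc g c y ξ ξ + (1 - P⁻¹) * (C * gLoc g c y ξ ξ) := by linarith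
  have h5 := mul_le_mul_of_nonneg_left h4 hP0.le
  rw [← mul_assoc, mul_inv_cancel₀ hP0.ne', one_mul] at h5
  refine h5.trans ?_
  have h6 : P * (C * gLoc g c y ξ ξ + (1 - P⁻¹) * (C * gLoc g c y ξ ξ))
      = 2 * C * P * gLoc g c y ξ ξ - C * gLoc g c y ξ ξ := by
    field_simp
    ring
  linarith

/-- The MTW condition with `ξ = τ`, `η = p`, used at every point `t p` of the segment, bounds the
second derivative in `t` by `-c₀ |τ|² |p|²`. -/
theorem mtw_second_difference {c₀ : ℝ} (hA : SmoothForm A)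
    (hy : y ∈ (extChartAt (𝓡∂ n) c).target)
    (hm : ∀ (x : M) (z : ℝ) (p ξ η : Tan n x), g.inner x ξ η = 0 →
      iteratedDeriv 2 (fun t : ℝ => A x z (p + t • η) ξ ξ) 0
        ≤ -c₀ * gnorm g x ξ ^ 2 * gnorm g x η ^ 2) (p τ : EuclideanSpace ℝ (Fin n))
    (hp : gLoc g c y p τ = 0) :
    c₀ / 4 * gLoc g c y p p * gLoc g c y τ τ
      ≤ 2 * formLoc A c (y, r, (1 / 2 : ℝ) • p) τ τ - formLoc A c (y, r, 0) τ τ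
        - formLoc A c (y, r, p) τ τ := by
  have hh : ContDiff ℝ ∞ (fun t : ℝ => formLoc A c (y, r, t • p) τ τ) :=
    (((contDiff_formLoc_slice hA hy).comp (contDiff_id.smul contDiff_const)).clm_apply
      contDiff_const).clm_apply contDiff_const
  have h1 := second_difference_le (hh.of_le two_le_infty)
    (κ := c₀ * gLoc g c y τ τ * gLoc g c y p p) fun t => ?_
  · simp only [zero_smul, one_smul] at h1
    linarith
  · have h2 := hm ((extChartAt (𝓡∂ n) c).symm y) r (coordVec n c y (t • p)) (coordVec n c y τ)
      (coordVec n c y p) (by rw [g.symm]; exact hp)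
    rw [gnorm_coordVec_sq, gnorm_coordVec_sq] at h2
    have h3 : (fun s : ℝ => A ((extChartAt (𝓡∂ n) c).symm y) r
        (coordVec n c y (t • p) + s • coordVec n c y p) (coordVec n c y τ) (coordVec n c y τ))
        = fun s => (fun t : ℝ => formLoc A c (y, r, t • p) τ τ) (t + s) := by
      ext s
      simp only [formLoc_apply, add_smul, map_add, map_smul]
    have h4 := congrFun (iteratedDeriv_comp_const_add 2
      (fun t : ℝ => formLoc A c (y, r, t • p) τ τ) t) 0
    rw [h3, h4, add_zero] at h2
    linarith

end Slice

variable {Γ : Set (Fin n → ℝ)} {f : (Fin n → ℝ) → ℝ}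

/-- The equation in the chart at `c`. -/
theorem AdmissibleSolution.eq_local {u : M → ℝ} (hu : ContMDiff (𝓡∂ n) 𝓘(ℝ, ℝ) 3 u)
    (hsol : AdmissibleSolution g Γ f A ψ u) {c : M} {z : EuclideanSpace ℝ (Fin n)}
    (hz : z ∈ (extChartAt (𝓡∂ n) c).target) (hzi : z ∈ interior (range (𝓡∂ n))) :
    ∃ mu ∈ Γ, ∃ e' : Fin n → EuclideanSpace ℝ (Fin n), IsFrame (gLoc g c z) e' ∧
      (∀ i j, hessLoc (chrisLoc g c) (u ∘ (extChartAt (𝓡∂ n) c).symm) z (e' i) (e' j)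
        + formLoc A c (z, (u ∘ (extChartAt (𝓡∂ n) c).symm) z,
          gradLoc (gLoc g c) (u ∘ (extChartAt (𝓡∂ n) c).symm) z) (e' i) (e' j)
        = if i = j then mu i else 0) ∧
      f mu = funLoc ψ c (z, (u ∘ (extChartAt (𝓡∂ n) c).symm) z,
        gradLoc (gLoc g c) (u ∘ (extChartAt (𝓡∂ n) c).symm) z) := by
  obtain ⟨mu, hmu, ⟨e, he1, he2⟩, hf⟩ := hsol.2 ((extChartAt (𝓡∂ n) c).symm z)
  have hgr := grad_eq_gradLoc g c hz hzi (hu.mdifferentiableAt (by norm_num))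
  choose e' he' using fun i => (coordVec_bijective c hz).surjective (e i)
  refine ⟨mu, hmu, e', fun i j => ?_, fun i j => ?_, ?_⟩
  · rw [gLoc_apply, he', he', he1]
  · rw [← hess_eq_hessLoc g (hu.of_le (by norm_num)) c hz hzi, formLoc_apply, he', he', ← he2 i j,
      hessA, hgr]
    rfl
  · rw [hf, hgr]; rfl

theorem deriv_formLoc (hA : SmoothForm A) {c : M} {y : EuclideanSpace ℝ (Fin n)}
    (hy : y ∈ (extChartAt (𝓡∂ n) c).target) (hyi : y ∈ interior (range (𝓡∂ n))) (r : ℝ)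
    (p ξ : EuclideanSpace ℝ (Fin n)) :
    deriv (fun s => A ((extChartAt (𝓡∂ n) c).symm y) s (coordVec n c y p) (coordVec n c y ξ)
      (coordVec n c y ξ)) r = fderiv ℝ (formLoc A c) (y, r, p) (0, 1, 0) ξ ξ := by
  have h1 := ((contDiffAt_formLoc hA c hy hyi r p).differentiableAt (by simp)).hasFDerivAt
  have h2 : HasDerivAt (fun s : ℝ => formLoc A c (y, s, p))
      (fderiv ℝ (formLoc A c) (y, r, p) (0, 1, 0)) r :=
    HasFDerivAt.comp_hasDerivAt (l := formLoc A c) r h1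
      ((hasDerivAt_const r y).prodMk ((hasDerivAt_id r).prodMk (hasDerivAt_const r p)))
  have h3 := (h2.clm_apply (hasDerivAt_const r ξ)).clm_apply (hasDerivAt_const r ξ)
  simp only [map_zero, add_zero] at h3
  exact h3.deriv

theorem deriv_funLoc (hψ : SmoothFun ψ) {c : M} {y : EuclideanSpace ℝ (Fin n)}
    (hy : y ∈ (extChartAt (𝓡∂ n) c).target) (hyi : y ∈ interior (range (𝓡∂ n))) (r : ℝ)
    (p : EuclideanSpace ℝ (Fin n)) :
    deriv (fun s => ψ ((extChartAt (𝓡∂ n) c).symm y) s (coordVec n c y p)) r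
      = fderiv ℝ (funLoc ψ c) (y, r, p) (0, 1, 0) := by
  have h1 := ((contDiffAt_funLoc hψ c hy hyi r p).differentiableAt (by simp)).hasFDerivAt
  have h2 : HasDerivAt (fun s : ℝ => funLoc ψ c (y, s, p))
      (fderiv ℝ (funLoc ψ c) (y, r, p) (0, 1, 0)) r :=
    HasFDerivAt.comp_hasDerivAt (l := funLoc ψ c) r h1
      ((hasDerivAt_const r y).prodMk ((hasDerivAt_id r).prodMk (hasDerivAt_const r p)))
  exact h2.deriv

theorem exists_hasFDerivAt_formLoc (hA : SmoothForm A) {c : M} {y : EuclideanSpace ℝ (Fin n)}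
    (hy : y ∈ (extChartAt (𝓡∂ n) c).target) (hyi : y ∈ interior (range (𝓡∂ n))) (r : ℝ)
    (p ξ : EuclideanSpace ℝ (Fin n)) :
    ∃ T : EuclideanSpace ℝ (Fin n) →L[ℝ] ℝ,
      HasFDerivAt (fun q => formLoc A c (y, r, q) ξ ξ) T p ∧
      ∀ v, T v = fderiv ℝ (formLoc A c) (y, r, p) (0, 0, v) ξ ξ := by
  have h1 := ((contDiffAt_formLoc hA c hy hyi r p).differentiableAt (by simp)).hasFDerivAt
  have h2 : HasFDerivAt (fun q => formLoc A c (y, r, q)) _ p :=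
    HasFDerivAt.comp (g := formLoc A c) p h1
      ((hasFDerivAt_const y p).prodMk ((hasFDerivAt_const r p).prodMk (hasFDerivAt_id p)))
  refine ⟨_, (h2.clm_apply (hasFDerivAt_const ξ p)).clm_apply (hasFDerivAt_const ξ p),
    fun v => ?_⟩
  simp

theorem exists_hasFDerivAt_funLoc (hψ : SmoothFun ψ) {c : M} {y : EuclideanSpace ℝ (Fin n)}
    (hy : y ∈ (extChartAt (𝓡∂ n) c).target) (hyi : y ∈ interior (range (𝓡∂ n))) (r : ℝ)
    (p : EuclideanSpace ℝ (Fin n)) :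
    ∃ T : EuclideanSpace ℝ (Fin n) →L[ℝ] ℝ,
      HasFDerivAt (fun q => -funLoc ψ c (y, r, q)) T p ∧
      ∀ v, T v = -fderiv ℝ (funLoc ψ c) (y, r, p) (0, 0, v) := by
  have h1 := ((contDiffAt_funLoc hψ c hy hyi r p).differentiableAt (by simp)).hasFDerivAt
  have h2 : HasFDerivAt (fun q => funLoc ψ c (y, r, q)) _ p :=
    HasFDerivAt.comp (g := funLoc ψ c) p h1
      ((hasFDerivAt_const y p).prodMk ((hasFDerivAt_const r p).prodMk (hasFDerivAt_id p)))
  exact ⟨_, h2.neg, fun v => by simp⟩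

/-- This is where `γ < 4` closes the argument. -/
theorem le_rpow_inv_of_pow_le {P C γ : ℝ} (hP : 1 ≤ P) (hγ : γ < 4) (h : P ^ 4 ≤ C * P ^ γ) :
    P ≤ max C 0 ^ (4 - γ)⁻¹ := by
  have hP0 : 0 < P := by linarith
  have hγ' : 0 < 4 - γ := by linarith
  have h1 : P ^ (4 - γ) ≤ max C 0 := by
    have h2 : P ^ (4 - γ) = P ^ 4 / P ^ γ := by
      rw [Real.rpow_sub hP0]; norm_cast
    rw [h2, div_le_iff₀ (Real.rpow_pos_of_pos hP0 _)]
    exact h.trans (mul_le_mul_of_nonneg_right (le_max_left _ _) (Real.rpow_pos_of_pos hP0 _).le)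
  rw [Real.le_rpow_inv_iff_of_pos hP0.le (le_max_right _ _) hγ']
  exact h1

/-- The a priori bound for the gradient at an interior maximum point of `|∇u|² / (K + 1 + u)`. -/
theorem exists_bound_of_interior_max (hf : StructureConditions Γ f)
    (hf_lim : Tendsto (fun t : ℝ => f (fun _ => t)) atTop atTop) (hA : SmoothForm A)
    (hA_symm : ∀ (x : M) (z : ℝ) (p ξ η : Tan n x), A x z p ξ η = A x z p η ξ)
    (hψ : SmoothFun ψ) (hψ_pos : ∀ (x : M) (z : ℝ) (p : Tan n x), 0 < ψ x z p)
    (h_conc : ConcaveInGradient A ψ) {c₀ : ℝ} (hc₀ : 0 < c₀)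
    (hm : ∀ (x : M) (z : ℝ) (p ξ η : Tan n x), g.inner x ξ η = 0 →
      iteratedDeriv 2 (fun t : ℝ => A x z (p + t • η) ξ ξ) 0
        ≤ -c₀ * gnorm g x ξ ^ 2 * gnorm g x η ^ 2)
    {γ₁ : ℝ} (hγ₁ : γ₁ < 4) {K B C : ℝ} (hK : 0 ≤ K) (hB : 0 ≤ B) (hC : 0 ≤ C)
    (hg1 : ∀ (x : M) (z : ℝ), |z| ≤ K → ∀ p ξ : Tan n x,
      covDerivForm g A x z p ξ p + gnorm g x p ^ 2 * deriv (fun s => A x s p ξ ξ) z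
        ≤ B * gnorm g x ξ ^ 2 * (1 + gnorm g x p ^ γ₁))
    (hg2 : ∀ (x : M) (z : ℝ), |z| ≤ K → ∀ p : Tan n x,
      -(B * (1 + gnorm g x p ^ (2 : ℝ)))
        ≤ covDerivFun g ψ x z p p + gnorm g x p ^ 2 * deriv (fun s => ψ x s p) z) :
    ∃ C' : ℝ, ∀ u : M → ℝ, ContMDiff (𝓡∂ n) 𝓘(ℝ, ℝ) 3 u → AdmissibleSolution g Γ f A ψ u →
      (∀ x, |u x| ≤ K) → ∀ (m : ℝ) (c : M) (y : EuclideanSpace ℝ (Fin n)),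
      LocalBound g A ψ K C c y → y ∈ interior (range (𝓡∂ n)) →
      (∀ x, 1 / 2 * gnorm g x (grad g u x) ^ 2 ≤ m * (K + 1 + u x)) →
      1 / 2 * gnorm g _ (grad g u ((extChartAt (𝓡∂ n) c).symm y)) ^ 2
        = m * (K + 1 + u ((extChartAt (𝓡∂ n) c).symm y)) →
      gnorm g _ (grad g u ((extChartAt (𝓡∂ n) c).symm y)) ≤ C' := by
  obtain ⟨D, hD⟩ : ∃ D, D = 2 * K + 1 := ⟨_, rfl⟩
  have hD0 : 0 < D := by rw [hD]; linarith
  -- `2 * B` comes from `1 + P ^ γ₁ ≤ 2 P ^ γ` (and `1 + P ^ 2 ≤ 2 P ^ 2` for `ψ`), `C` from the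
  -- curvature term in Bochner's identity.
  obtain ⟨C₃, hC₃⟩ : ∃ C₃, C₃ = 2 * B + C := ⟨_, rfl⟩
  have hC₃0 : 0 ≤ C₃ := by rw [hC₃]; linarith
  -- Since `f` tends to infinity along the diagonal, its value at `(t₀, …, t₀)` can exceed the
  -- threshold of `exists_quartic_bound`.
  obtain ⟨t₀, ht₀, hN⟩ := ((eventually_gt_atTop (0 : ℝ)).and
    (hf_lim.eventually_ge_atTop (C + 2 * D * (C₃ + 1)))).exists
  obtain ⟨Q, hQ⟩ := exists_quartic_bound hf hC hC hC₃0 ht₀ hc₀ hD0 hN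
  -- The exponent is raised to at least `2` so that `P ^ γ` also dominates the curvature term of
  -- order `P ^ 2`.
  obtain ⟨γ, hγ⟩ : ∃ γ, γ = max γ₁ 2 := ⟨_, rfl⟩
  have hγ4 : γ < 4 := by rw [hγ]; exact max_lt hγ₁ (by norm_num)
  have hγ2 : 2 ≤ γ := by rw [hγ]; exact le_max_right _ _
  refine ⟨max 1 (max Q 0 ^ (4 - γ)⁻¹), ?_⟩
  intro u hu hsol huK m c y hb hyi hmax heq
  obtain ⟨P, hP⟩ : ∃ P, P = gnorm g _ (grad g u ((extChartAt (𝓡∂ n) c).symm y)) := ⟨_, rfl⟩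
  rw [← hP]
  rcases le_total P 1 with hP1 | hP1
  · exact hP1.trans (le_max_left _ _)
  refine le_trans ?_ (le_max_right _ _)
  refine le_rpow_inv_of_pow_le hP1 hγ4 ?_
  have hP0 : 0 < P := by linarith
  -- local objects
  have hy := hb.mem
  obtain ⟨v, hv⟩ : ∃ v, v = u ∘ (extChartAt (𝓡∂ n) c).symm := ⟨_, rfl⟩
  have hvy : v y = u ((extChartAt (𝓡∂ n) c).symm y) := by rw [hv]; rfl
  have hr : |v y| ≤ K := by rw [hvy]; exact huK _
  have hgr : ∀ z, z ∈ (extChartAt (𝓡∂ n) c).target → z ∈ interior (range (𝓡∂ n)) →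
      grad g u ((extChartAt (𝓡∂ n) c).symm z) = coordVec n c z (gradLoc (gLoc g c) v z) := by
    intro z hz hzi
    rw [hv]
    exact grad_eq_gradLoc g c hz hzi (hu.mdifferentiableAt (by norm_num))
  have hLC := isLeviCivitaAt_chrisLoc g c hy hyi
  have hLCe : ∀ᶠ z in 𝓝 y, IsLeviCivitaAt (gLoc g c) (chrisLoc g c) z :=
    (eventually_target_interior c hy hyi).mono fun z hz => isLeviCivitaAt_chrisLoc g c hz.1 hz.2
  have hv3 : ContDiffAt ℝ 3 v y := by rw [hv]; exact contDiffAt_comp_symm (k := 3) hu c hy hyi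
  have hΓ : DifferentiableAt ℝ (chrisLoc g c) y := by
    have h1 := contDiffWithinAt_chris (m := 1) (k := 2) (s := range (𝓡∂ n))
      ((contDiffAt_gLoc g c hy hyi).contDiffWithinAt.of_le two_le_infty) (𝓡∂ n).uniqueDiffOn
      (by norm_num) (interior_subset hyi) hLC.pos
    exact (h1.contDiffAt (mem_interior_iff_mem_nhds.1 hyi)).differentiableAt one_ne_zero
  obtain ⟨p, hp⟩ : ∃ p, p = gradLoc (gLoc g c) v y := ⟨_, rfl⟩
  have hpP : gLoc g c y p p = P ^ 2 := by
    rw [hP, hgr y hy hyi, gnorm_coordVec_sq, hp]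
  have henergy : ∀ z, z ∈ (extChartAt (𝓡∂ n) c).target → z ∈ interior (range (𝓡∂ n)) →
      energyLoc (gLoc g c) v z
        = 1 / 2 * gnorm g _ (grad g u ((extChartAt (𝓡∂ n) c).symm z)) ^ 2 := by
    intro z hz hzi
    rw [hgr z hz hzi, gnorm_coordVec_sq, energyLoc,
      ← (isLeviCivitaAt_chrisLoc g c hz hzi).gradLoc_apply]
  have hlmax : IsLocalMax (fun z => energyLoc (gLoc g c) v z - m * v z) y := by
    filter_upwards [eventually_target_interior c hy hyi] with z hz
    rw [henergy z hz.1 hz.2, henergy y hy hyi, heq, hvy]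
    have h1 := hmax ((extChartAt (𝓡∂ n) c).symm z)
    have h2 : v z = u ((extChartAt (𝓡∂ n) c).symm z) := by rw [hv]; rfl
    rw [h2]
    linarith
  -- bounds for `m`
  have huK' := abs_le.1 (huK ((extChartAt (𝓡∂ n) c).symm y))
  rw [← hP] at heq
  have hm0 : 0 < m := by
    by_contra hcon
    have h1 : m * (K + 1 + u ((extChartAt (𝓡∂ n) c).symm y)) ≤ 0 :=
      mul_nonpos_of_nonpos_of_nonneg (not_lt.1 hcon) (by linarith)
    have h2 : 0 < P ^ 2 := by positivity
    linarith
  have hm1 : P ^ 2 ≤ 2 * D * m := by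
    have h1 : m * (K + 1 + u ((extChartAt (𝓡∂ n) c).symm y)) ≤ m * D := by
      refine mul_le_mul_of_nonneg_left ?_ hm0.le
      rw [hD]; linarith
    linarith
  have hm2 : m ≤ P ^ 2 / 2 := by
    have h1 : m * 1 ≤ m * (K + 1 + u ((extChartAt (𝓡∂ n) c).symm y)) :=
      mul_le_mul_of_nonneg_left (by linarith) hm0.le
    linarith
  -- powers
  have hab : (P ^ (γ / 2)) ^ 2 = P ^ γ := by
    rw [← Real.rpow_natCast, ← Real.rpow_mul hP0.le]; norm_num
  have hPb : P ≤ P ^ (γ / 2) := by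
    conv_lhs => rw [← Real.rpow_one P]
    exact Real.rpow_le_rpow_of_exponent_le hP1 (by linarith)
  have hbP : P ^ (γ / 2) ≤ P ^ 2 := by
    rw [← Real.rpow_two]
    exact Real.rpow_le_rpow_of_exponent_le hP1 (by linarith)
  have h1a : 1 ≤ P ^ γ := Real.one_le_rpow hP1 (by linarith)
  have h2a : P ^ 2 ≤ P ^ γ := by
    rw [← Real.rpow_two]
    exact Real.rpow_le_rpow_of_exponent_le hP1 hγ2
  have hγa : P ^ γ₁ ≤ P ^ γ :=
    Real.rpow_le_rpow_of_exponent_le hP1 (by rw [hγ]; exact le_max_left _ _)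
  -- the equation
  have hEq := fun z hz hzi => hsol.eq_local hu (c := c) (z := z) hz hzi
  rw [← hv] at hEq
  obtain ⟨lam, hl, e, he, hdiag, hfl⟩ := hEq y hy hyi
  have hfd : Module.finrank ℝ (EuclideanSpace ℝ (Fin n)) = n := finrank_euclideanSpace_fin
  have dA := ((contDiffAt_formLoc hA c hy hyi (v y) p).differentiableAt (by simp)).hasFDerivAt
  have dψ := ((contDiffAt_funLoc hψ c hy hyi (v y) p).differentiableAt (by simp)).hasFDerivAt
  have hAs : ∀ q v w, formLoc A c q v w = formLoc A c q w v := fun q v w => hA_symm _ _ _ _ _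
  have hkey := hf.sum_le_of_isLocalMax hfd hLCe hΓ hv3 hlmax (by rw [← hp]; exact dA)
    (fun a b => hAs _ a b) (by rw [← hp]; exact dψ) hl he hdiag hfl
    ((eventually_target_interior c hy hyi).mono fun z hz => hEq z hz.1 hz.2)
  have hfirst := hessLoc_gradLoc_of_isLocalMax hLCe hv3 hlmax
  simp only [← hp] at hkey hfirst hdiag hfl
  have hfi : ∀ i, 0 < pder f lam i := fun i => hf.pder_pos hl i
  have hterm : ∀ i, (fderiv ℝ (formLoc A c) (y, v y, p) (p, 0, -chrisLoc g c y p p) (e i) (e i)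
      - 2 * formLoc A c (y, v y, p) (chrisLoc g c y p (e i)) (e i)
      + gLoc g c y p p * fderiv ℝ (formLoc A c) (y, v y, p) (0, 1, 0) (e i) (e i))
      - gLoc g c y p (curvLoc (chrisLoc g c) y p (e i)) ≤ C₃ * P ^ γ := by
    intro i
    have hee : gLoc g c y (e i) (e i) = 1 := by rw [he i i, if_pos rfl]
    have h1 := hg1 ((extChartAt (𝓡∂ n) c).symm y) (v y) hr (coordVec n c y p) (coordVec n c y (e i))
    have hPe : gnorm g _ (coordVec n c y p) = P := by
      rw [hP, hgr y hy hyi, hp]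
    rw [covDerivForm_eq g hA c hy hyi, deriv_formLoc hA hy hyi, gnorm_coordVec_sq,
      gnorm_coordVec_sq, hee, hPe, hAs _ (e i) (chrisLoc g c y p (e i))] at h1
    have h2 := (abs_le.1 (hb.curv hyi p (e i))).1
    rw [hee, hpP] at h2
    have h3 : B * P ^ γ₁ ≤ B * P ^ γ := mul_le_mul_of_nonneg_left hγa hB
    have h4 : B * 1 ≤ B * P ^ γ := mul_le_mul_of_nonneg_left h1a hB
    have h5 : C * P ^ 2 ≤ C * P ^ γ := mul_le_mul_of_nonneg_left h2a hC
    rw [hC₃]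
    linarith
  have hpsi : -(C₃ * P ^ 2) ≤ fderiv ℝ (funLoc ψ c) (y, v y, p) (p, 0, -chrisLoc g c y p p)
      + gLoc g c y p p * fderiv ℝ (funLoc ψ c) (y, v y, p) (0, 1, 0) := by
    have h1 := hg2 ((extChartAt (𝓡∂ n) c).symm y) (v y) hr (coordVec n c y p)
    have hPe : gnorm g _ (coordVec n c y p) = P := by
      rw [hP, hgr y hy hyi, hp]
    rw [covDerivFun_eq g hψ c hy hyi, deriv_funLoc hψ hy hyi, gnorm_coordVec_sq, hPe,
      Real.rpow_two] at h1
    have h4 : B * 1 ≤ B * P ^ 2 := mul_le_mul_of_nonneg_left (by nlinarith) hB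
    have h5 : 0 ≤ C * P ^ 2 := by positivity
    rw [hC₃]
    linarith
  have hsum : ∑ i, pder f lam i * ((fderiv ℝ (formLoc A c) (y, v y, p)
        (p, 0, -chrisLoc g c y p p) (e i) (e i)
      - 2 * formLoc A c (y, v y, p) (chrisLoc g c y p (e i)) (e i)
      + gLoc g c y p p * fderiv ℝ (formLoc A c) (y, v y, p) (0, 1, 0) (e i) (e i))
      - gLoc g c y p (curvLoc (chrisLoc g c) y p (e i))) ≤ C₃ * (P ^ γ * ∑ i, pder f lam i) := by
    rw [Finset.mul_sum, Finset.mul_sum]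
    refine Finset.sum_le_sum fun i _ => ?_
    exact (mul_le_mul_of_nonneg_left (hterm i) (hfi i).le).trans (le_of_eq (by ring))
  -- The three values of `A` are taken at `0`, `p` and `p/2`. The remaining goals are tangent
  -- inequalities at `p`, midpoint concavity and the integrated MTW condition.
  refine hQ hfd (gLoc g c y) (hessLoc (chrisLoc g c) v y) (formLoc A c (y, v y, 0))
    (formLoc A c (y, v y, p)) (formLoc A c (y, v y, (1 / 2 : ℝ) • p)) p e lam
    (fun i => fderiv ℝ (formLoc A c) (y, v y, p) (0, 0, p) (e i) (e i))
    (fderiv ℝ (funLoc ψ c) (y, v y, p) (0, 0, p)) (funLoc ψ c (y, v y, 0))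
    (funLoc ψ c (y, v y, p)) m P (P ^ γ) (P ^ (γ / 2)) hLC.symm (hAs _) (hAs _) (hAs _) he hl
    hdiag hfl (hLC.hessLoc_symm (hv3.of_le (by norm_num))) hfirst hpP hP1 hab hPb hbP hm1 hm2
    ?_ ?_ ?_ ?_ (fun ξ => hb.form _ hr 0 (by simp) ξ)
    (fun ξ => formLoc_le_of_concave h_conc hb hr ξ hP1 hpP.le)
    (fun ξ => formLoc_le_of_concave h_conc hb hr ξ hP1 ?_) (fun ξ => ?_) (fun τ hτ => ?_)
    (hb.fun_zero _ hr) (hψ_pos _ _ _)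
  · linarith
  · intro i
    obtain ⟨T, hT, hT2⟩ := exists_hasFDerivAt_formLoc hA hy hyi (v y) p (e i)
    have h1 := concaveOn_le_add_of_hasFDerivAt (concaveOn_formLoc h_conc (e i)) (mem_univ p)
      (mem_univ 0) hT
    rw [zero_sub, map_neg, hT2] at h1
    linarith
  · intro i
    obtain ⟨T, hT, hT2⟩ := exists_hasFDerivAt_formLoc hA hy hyi (v y) p (e i)
    have h1 := concaveOn_le_add_of_hasFDerivAt (concaveOn_formLoc h_conc (e i)) (mem_univ p)
      (mem_univ ((1 / 2 : ℝ) • p)) hT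
    have h2 : (1 / 2 : ℝ) • p - p = (-(1 / 2) : ℝ) • p := by module
    rw [h2, map_smul, hT2, smul_eq_mul] at h1
    linarith
  · obtain ⟨T, hT, hT2⟩ := exists_hasFDerivAt_funLoc hψ hy hyi (v y) p
    have h1 := concaveOn_le_add_of_hasFDerivAt (concaveOn_neg_funLoc h_conc) (mem_univ p)
      (mem_univ 0) hT
    rw [zero_sub, map_neg, hT2] at h1
    linarith
  · simp only [map_smul, smul_apply, smul_eq_mul, hpP]
    have : 0 ≤ P ^ 2 := by positivity
    linarith
  · have h1 := (concaveOn_formLoc (c := c) (y := y) (r := v y) h_conc ξ).2 (mem_univ 0)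
      (mem_univ p) (by norm_num : (0 : ℝ) ≤ 1 / 2) (by norm_num : (0 : ℝ) ≤ 1 / 2) (by norm_num)
    simp only [smul_zero, zero_add, smul_eq_mul] at h1
    linarith
  · have h1 := mtw_second_difference (r := v y) hA hy hm p τ hτ
    rwa [hpP] at h1

end Interior

end

end HessianEq

namespace HessianEq

noncomputable section

set_option linter.unusedSectionVars false
set_option maxSynthPendingDepth 3
set_option synthInstance.maxHeartbeats 400000
set_option maxHeartbeats 1000000

/-! ### Continuity of the length of the gradient up to the boundary. -/

section Continuity

variable {n : ℕ} [NeZero n] {M : Type*} [TopologicalSpace M]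
  [ChartedSpace (EuclideanHalfSpace n) M] [IsManifold (𝓡∂ n) ∞ M]

/-- Provides the maximum point and the boundedness of the boundary values. In one fixed chart the
length is a continuous expression in the metric and the derivative of `u` within the half-space. -/
theorem continuous_gnorm_grad (g : Metric n M) {u : M → ℝ}
    (hu : ContMDiff (𝓡∂ n) 𝓘(ℝ, ℝ) 1 u) : Continuous fun x => gnorm g x (grad g u x) := by
  rw [continuous_iff_continuousAt]
  intro c
  obtain ⟨w, hw⟩ : ∃ w, w = u ∘ (extChartAt (𝓡∂ n) c).symm := ⟨_, rfl⟩
  have hy₀ := mem_extChartAt_target (I := 𝓡∂ n) c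
  have hr₀ : extChartAt (𝓡∂ n) c c ∈ range (𝓡∂ n) := extChartAt_target_subset_range c hy₀
  have hmem : (extChartAt (𝓡∂ n) c).target ∈ 𝓝[range (𝓡∂ n)] (extChartAt (𝓡∂ n) c c) :=
    extChartAt_target_mem_nhdsWithin c
  have hG : ContinuousWithinAt (gLoc g c) (range (𝓡∂ n)) (extChartAt (𝓡∂ n) c c) :=
    ((contDiffOn_gLoc g c _ hy₀).mono_of_mem_nhdsWithin hmem).continuousWithinAt
  have hD : ContDiffWithinAt ℝ 1 w (range (𝓡∂ n)) (extChartAt (𝓡∂ n) c c) := by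
    rw [hw, ← contMDiffWithinAt_iff_contDiffWithinAt]
    refine ContMDiffWithinAt.mono_of_mem_nhdsWithin ?_ hmem
    exact (hu _).comp_contMDiffWithinAt _
      ((contMDiffOn_extChartAt_symm (n := ∞) c).of_le (by simp) _ hy₀)
  have hD' : ContinuousWithinAt (fderivWithin ℝ w (range (𝓡∂ n))) (range (𝓡∂ n))
      (extChartAt (𝓡∂ n) c c) :=
    (hD.fderivWithin_right (m := 0) (𝓡∂ n).uniqueDiffOn (by norm_num) hr₀).continuousWithinAt
  have hI : ContinuousWithinAt (fun y => (gLoc g c y).inverse) (range (𝓡∂ n))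
      (extChartAt (𝓡∂ n) c c) :=
    ((isInvertible_of_pos (gLoc_pos g c hy₀)).contDiffAt_map_inverse
      (n := 0)).continuousAt.comp_continuousWithinAt hG
  have hX := hI.clm_apply hD'
  have hF := ((hG.clm_apply hX).clm_apply hX).sqrt
  have ht : Tendsto (extChartAt (𝓡∂ n) c) (𝓝 c) (𝓝[range (𝓡∂ n)] (extChartAt (𝓡∂ n) c c)) :=
    tendsto_nhdsWithin_of_tendsto_nhds_of_eventually_within _
      (continuousAt_extChartAt c).tendsto (Eventually.of_forall fun x => mem_range_self _)
  have hloc : ∀ x ∈ (extChartAt (𝓡∂ n) c).source, gnorm g x (grad g u x)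
      = Real.sqrt (gLoc g c (extChartAt (𝓡∂ n) c x)
        ((gLoc g c (extChartAt (𝓡∂ n) c x)).inverse
          (fderivWithin ℝ w (range (𝓡∂ n)) (extChartAt (𝓡∂ n) c x)))
        ((gLoc g c (extChartAt (𝓡∂ n) c x)).inverse
          (fderivWithin ℝ w (range (𝓡∂ n)) (extChartAt (𝓡∂ n) c x)))) := by
    intro x hx
    have h1 := grad_eq g c ((extChartAt (𝓡∂ n) c).map_source hx)
      ((hu.mdifferentiable one_ne_zero) ((extChartAt (𝓡∂ n) c).symm (extChartAt (𝓡∂ n) c x)))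
    have h2 : gnorm g _ (grad g u ((extChartAt (𝓡∂ n) c).symm (extChartAt (𝓡∂ n) c x)))
        = Real.sqrt (gLoc g c (extChartAt (𝓡∂ n) c x)
        ((gLoc g c (extChartAt (𝓡∂ n) c x)).inverse
          (fderivWithin ℝ w (range (𝓡∂ n)) (extChartAt (𝓡∂ n) c x)))
        ((gLoc g c (extChartAt (𝓡∂ n) c x)).inverse
          (fderivWithin ℝ w (range (𝓡∂ n)) (extChartAt (𝓡∂ n) c x)))) := by
      rw [h1, hw]; rfl
    rwa [(extChartAt (𝓡∂ n) c).left_inv hx] at h2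
  have hlim := hF.tendsto.comp ht
  rw [ContinuousAt, hloc c (mem_extChartAt_source c)]
  refine hlim.congr' ?_
  filter_upwards [extChartAt_source_mem_nhds (I := 𝓡∂ n) c] with x hx
  exact (hloc x hx).symm

theorem exists_bound_of_continuous [CompactSpace M] {b : M → ℝ → ℝ}
    (hb : Continuous (Function.uncurry b)) (K : ℝ) :
    ∃ B, 0 ≤ B ∧ ∀ x z, |z| ≤ K → b x z ≤ B := by
  obtain ⟨B, hB⟩ := (((isCompact_univ (X := M)).prod
    (isCompact_Icc (a := -K) (b := K))).image_of_continuousOn hb.continuousOn).bddAbove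
  exact ⟨max B 0, le_max_right _ _, fun x z hz =>
    (hB ⟨(x, z), ⟨trivial, abs_le.1 hz⟩, rfl⟩).trans (le_max_left _ _)⟩

end Continuity

end

end HessianEq


/-! ### The maximum principle on the whole manifold. -/

theorem theorem6p1 {n : ℕ} [NeZero n] (hn : 2 ≤ n)
    {M : Type*} [TopologicalSpace M] [T2Space M] [CompactSpace M]
    [ChartedSpace (EuclideanHalfSpace n) M] [IsManifold (𝓡∂ n) ∞ M]
    (g : HessianEq.Metric n M)
    (Γ : Set (Fin n → ℝ)) (f : (Fin n → ℝ) → ℝ)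
    (hf : HessianEq.StructureConditions Γ f)
    (hf_lim : Tendsto (fun t : ℝ => f (fun _ => t)) atTop atTop)
    (A : HessianEq.GradForm n M) (ψ : HessianEq.GradFun n M)
    (hA_smooth : HessianEq.SmoothForm A)
    (hA_symm : ∀ (x : M) (z : ℝ) (p ξ η : HessianEq.Tan n x), A x z p ξ η = A x z p η ξ)
    (hψ_smooth : HessianEq.SmoothFun ψ)
    (hψ_pos : ∀ (x : M) (z : ℝ) (p : HessianEq.Tan n x), 0 < ψ x z p)
    (h_conc : HessianEq.ConcaveInGradient A ψ)
    (h_mtw : HessianEq.MTW g A)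
    (γ₁ : ℝ) (hγ₁_pos : 0 < γ₁) (hγ₁ : γ₁ < 4)
    (h_growth : HessianEq.Growth g A ψ γ₁ 2)
    (K L : ℝ) :
    ∃ C₁ : ℝ, 0 < C₁ ∧
      ∀ ubar : M → ℝ, HessianEq.Admissible g Γ A ubar → HessianEq.C2Bound g ubar L →
      ∀ u : M → ℝ, ContMDiff (𝓡∂ n) 𝓘(ℝ, ℝ) 3 u →
        HessianEq.AdmissibleSolution g Γ f A ψ u → (∀ x, |u x| ≤ K) →
        ∀ x : M, HessianEq.gnorm g x (HessianEq.grad g u x) ≤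
          C₁ * (1 + sSup ((fun y => HessianEq.gnorm g y (HessianEq.grad g u y)) ''
            (𝓡∂ n).boundary M)) := by
  obtain ⟨c₀, hc₀, hm⟩ := h_mtw
  obtain ⟨b₁, b₂, hb₁, hb₂, -, -, hg₁, hg₂⟩ := h_growth
  -- `|K|` replaces `K`, which may be negative, so that `|K| + 1 + u ≥ 1` and the range of `z` is a
  -- compact interval.
  obtain ⟨B₁, hB₁, hB₁'⟩ := HessianEq.exists_bound_of_continuous hb₁ |K|
  obtain ⟨B₂, hB₂, hB₂'⟩ := HessianEq.exists_bound_of_continuous hb₂ |K|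
  obtain ⟨C, hC⟩ := HessianEq.exists_localBound g hA_smooth hψ_smooth |K|
  have hpow : ∀ (x : M) (p : HessianEq.Tan n x) (s : ℝ), 0 ≤ 1 + HessianEq.gnorm g x p ^ s :=
    fun x p s => add_nonneg zero_le_one (Real.rpow_nonneg (HessianEq.gnorm_nonneg g x p) s)
  obtain ⟨C', hC'⟩ := HessianEq.exists_bound_of_interior_max (g := g) (K := |K|) (B := max B₁ B₂)
    (C := max C 0) hf hf_lim hA_smooth hA_symm hψ_smooth hψ_pos h_conc hc₀ hm hγ₁ (abs_nonneg K)
    (hB₁.trans (le_max_left _ _)) (le_max_right _ _)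
    (fun x z hz p ξ => (hg₁ x z p ξ).trans (mul_le_mul_of_nonneg_right
      (mul_le_mul_of_nonneg_right ((hB₁' x z hz).trans (le_max_left _ _)) (sq_nonneg _))
      (hpow x p γ₁)))
    (fun x z hz p => le_trans (neg_le_neg (mul_le_mul_of_nonneg_right
      ((hB₂' x z hz).trans (le_max_right _ _)) (hpow x p 2))) (hg₂ x z p))
  obtain ⟨D, hD⟩ : ∃ D, D = 2 * |K| + 1 := ⟨_, rfl⟩
  have hD1 : 1 ≤ D := by rw [hD]; linarith [abs_nonneg K]
  have hsD : 1 ≤ Real.sqrt D := Real.one_le_sqrt.2 hD1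
  -- `√D` is the cost of passing from `x₀` to an arbitrary point; the second factor covers both an
  -- interior and a boundary position of `x₀`.
  refine ⟨Real.sqrt D * (max C' 0 + 1), by positivity, ?_⟩
  intro ubar _ _ u hu hsol huK x
  have huK' : ∀ x, |u x| ≤ |K| := fun x => (huK x).trans (le_abs_self K)
  have hpos : ∀ x, 0 < |K| + 1 + u x := fun x => by linarith [(abs_le.1 (huK' x)).1]
  have hcont := HessianEq.continuous_gnorm_grad g (hu.of_le (by norm_num))
  obtain ⟨S, hS⟩ : ∃ S, S = sSup ((fun y => HessianEq.gnorm g y (HessianEq.grad g u y)) ''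
            (𝓡∂ n).boundary M) := ⟨_, rfl⟩
  -- Covers the empty boundary too, where the real supremum takes the value `0`.
  have hS0 : 0 ≤ S := by
    rw [hS]
    refine Real.sSup_nonneg ?_
    rintro _ ⟨y, -, rfl⟩
    exact HessianEq.gnorm_nonneg g _ _
  rw [← hS]
  obtain ⟨x₀, -, hx₀⟩ := (isCompact_univ (X := M)).exists_isMaxOn ⟨x, trivial⟩
    (f := fun x => 1 / 2 * HessianEq.gnorm g x (HessianEq.grad g u x) ^ 2 / (|K| + 1 + u x))
    ((continuous_const.mul (hcont.pow 2)).div (continuous_const.add hu.continuous)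
      fun x => (hpos x).ne').continuousOn
  obtain ⟨m, hmdef⟩ : ∃ m, m = 1 / 2 * HessianEq.gnorm g x₀ (HessianEq.grad g u x₀) ^ 2
    / (|K| + 1 + u x₀) := ⟨_, rfl⟩
  have hmax : ∀ x, 1 / 2 * HessianEq.gnorm g x (HessianEq.grad g u x) ^ 2
      ≤ m * (|K| + 1 + u x) := by
    intro x
    rw [hmdef, ← div_le_iff₀ (hpos x)]
    exact hx₀ (mem_univ x)
  have heq : 1 / 2 * HessianEq.gnorm g x₀ (HessianEq.grad g u x₀) ^ 2
      = m * (|K| + 1 + u x₀) := by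
    rw [hmdef, div_mul_cancel₀ _ (hpos x₀).ne']
  -- the gradient at `x₀` controls the gradient everywhere
  have hcmp : HessianEq.gnorm g x (HessianEq.grad g u x)
      ≤ Real.sqrt D * HessianEq.gnorm g x₀ (HessianEq.grad g u x₀) := by
    have h0 := HessianEq.gnorm_nonneg g x₀ (HessianEq.grad g u x₀)
    have hm0 : 0 ≤ m := by
      rw [hmdef]; exact div_nonneg (by positivity) (hpos x₀).le
    have h1 : m * (|K| + 1 + u x) ≤ m * D :=
      mul_le_mul_of_nonneg_left (by rw [hD]; linarith [(abs_le.1 (huK' x)).2]) hm0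
    have h2 : m * 1 ≤ m * (|K| + 1 + u x₀) :=
      mul_le_mul_of_nonneg_left (by linarith [(abs_le.1 (huK' x₀)).1]) hm0
    have h3 : m * D ≤ 1 / 2 * HessianEq.gnorm g x₀ (HessianEq.grad g u x₀) ^ 2 * D :=
      mul_le_mul_of_nonneg_right (by linarith) (by linarith)
    refine abs_le_of_sq_le_sq' ?_ (by positivity) |>.2
    rw [mul_pow, Real.sq_sqrt (by linarith)]
    linarith [hmax x]
  have hbd : HessianEq.gnorm g x₀ (HessianEq.grad g u x₀) ≤ (max C' 0 + 1) * (1 + S) := by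
    have hC'0 : 0 ≤ max C' 0 := le_max_right _ _
    have hprod : 0 ≤ max C' 0 * S := mul_nonneg hC'0 hS0
    rcases (𝓡∂ n).isInteriorPoint_or_isBoundaryPoint x₀ with hint | hbdy
    · obtain ⟨c, y, hxy, hLB⟩ := hC x₀
      subst hxy
      have h1 := hC' u hu hsol huK' m c y (hLB.mono (le_max_left _ _))
        ((HessianEq.isInteriorPoint_iff_of_mem_target c hLB.mem).1 hint) hmax heq
      have h2 : C' ≤ max C' 0 := le_max_left _ _
      linarith
    · have h1 : HessianEq.gnorm g x₀ (HessianEq.grad g u x₀) ≤ S := by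
        rw [hS]
        refine le_csSup ?_ ⟨x₀, hbdy, rfl⟩
        -- Boundedness is essential: the real supremum of an unbounded set would be `0`.
        exact (isCompact_univ.image hcont).bddAbove.mono (image_mono (subset_univ _))
      linarith
  calc _ ≤ Real.sqrt D * HessianEq.gnorm g x₀ (HessianEq.grad g u x₀) := hcmp
    _ ≤ Real.sqrt D * ((max C' 0 + 1) * (1 + S)) := by gcongr
    _ = _ := by ring
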